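/- **Theorem 5.1.** *Notation.* Fix $k\in\mathbb N$, let $\Delta_k$ be the set of probability distributions on $[k]=\{1,\dots,k\}$, and let $f:\Delta_k\to\mathbb R$ be a *symmetric* property, i.e. invariant under relabeling of $[k]$. A *symmetric estimator* $\hat f$ consists, for each $n$, of a function $\hat f:[k]^n\to\mathbb R$ whose value $\hat f(S)$ depends only on the anonymized histogram of $S$ (the multiplicities in $S$ of the elements of $[k]$, sorted in decreasing order). Two datasets in $[k]^n$ (or two streams of equal length) are *neighboring* if they differ in at most one position. Put: * $C_{\hat f}(f,\alpha)$: the smallest $N$ such that for all $n\ge N$ and all $\mathcal D\in\Delta_k$, $\Pr_{S\sim\mathcal D^n}[|\hat f(S)-f(\mathcal D)|>\alpha]<0.1$; * $\Delta_{n,\hat f}$: the smallest $\Delta\ge 0$ with $|\hat f(S)-\hat f(S')|\le\Delta$ for all neighboring $S,S'\in[k]^n$; * $E(n,\varepsilon)=c\,\sqrt n\,(\log n)^{3/4}/\varepsilon^{5/2}$, with a constant $c>0$ as below; * $D_{\hat f}(\alpha,\varepsilon)$: the smallest $N$ such that $\Delta_{n,\hat f}\cdot E(n,\varepsilon)\le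 0.1\,\alpha$ for all $n\ge N$. (A smallest $N$ that does not exist is $+\infty$.) *Models.* A randomized map $M$ on datasets is $(\varepsilon,\delta)$-DP if $\Pr[M(S)\in F]\le e^{\varepsilon}\Pr[M(S')\in F]+\delta$ for all neighboring $S,S'$ and all events $F$; $\varepsilon$-DP means $(\varepsilon,0)$-DP. A *pan-private $\varepsilon$-DP mechanism* is a randomized streaming algorithm (random initial state, randomized state update for each stream element, randomized output computed from the current state) such that for every $t\ge0$ its internal state after $t$ steps is $\varepsilon$-DP as a function of the stream prefix of length $t$; its answer on $S\in[k]^n$ is the output after reading $S$. An *$(\varepsilon,\delta)$-DP shuffle mechanism* for $n$ users consists of a data-independent public random string visible to all parties, a local randomizer that every user applies with independent private coins to their own element and that returns a multiset of messages, a shuffler that releases all messages in uniformly random order (equivalently, their multiset), and a randomized analyzer that computes the answer from the shuffler's output; for every value of the public string, the shuffler's output must be $(\varepsilon,\delta)$-DP. *Statement.* For every $\varepsilon_0>0$ there are a real constant $c>0$ (used in $E$) and an integer constant $K\ge1$, depending only on $\varepsilon_0$, such that the following holds for all $0<\varepsilon\le\varepsilon_0$, $\delta\in(0,1]$, $\alpha>0$,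 all $k$, every symmetric property $f:\Delta_k\to\mathbb R$ and every symmetric estimator $\hat f$. For every integer $$n\ \ge\ K\Bigl(C_{\hat f}\bigl(f,\tfrac{\alpha}{2}\bigr)+D_{\hat f}\bigl(\tfrac{\alpha}{2},\varepsilon\bigr)\Bigr)$$ there exist a pan-private $\varepsilon$-DP mechanism and an $(\varepsilon,\delta)$-DP shuffle mechanism for $n$ users such that each of them, call it $\mathcal M$, satisfies $$\Pr\bigl[|\mathcal M(S)-f(\mathcal D)|>\alpha\bigr]<0.2\qquad\text{for every }\mathcal D\in\Delta_k,$$ where the probability is over $S\sim\mathcal D^n$ and the randomness of $\mathcal M$. -/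

import Mathlib

open scoped ENNReal

noncomputable section

namespace SymmEst

/-! ### Differential privacy -/

/-- Two datasets of the same size are neighboring if they agree except possibly at one index. -/
def Neighboring {X : Type*} {n : ℕ} (S S' : Fin n → X) : Prop :=
  ∃ i, ∀ j, j ≠ i → S j = S' j

/-- `(ε, δ)`-differential privacy of a randomized map on datasets of size `n`.
All laws are discrete, so every set of outcomes is an event. -/
def IsDP {X R : Type*} {n : ℕ} (ε δ : ℝ) (M : (Fin n → X) → PMF R) : Prop :=
  ∀ S S' : Fin n → X, Neighboring S S' → ∀ E : Set R,
    (M S).toOuterMeasure E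
      ≤ ENNReal.ofReal (Real.exp ε) * (M S').toOuterMeasure E + ENNReal.ofReal δ

/-! ### The pan-private model -/

/-- A randomized streaming algorithm over the alphabet `X`: it keeps an internal state, updates it
at each stream element, and computes its answer from the current state. -/
structure StreamAlg (X : Type) where
  /-- the set of internal states -/
  State : Type
  /-- the law of the state before anything is read -/
  init : PMF State
  /-- the law of the next state, given the state and the element that is read -/
  update : State → X → PMF State
  /-- the law of the answer, given the state -/
  output : State → PMF ℝ

/-- The law of the internal state after the elements of the list were read, from left to right. -/
def StreamAlg.stateLaw {X : Type} (A : StreamAlg X) (l : List X) : PMF A.State :=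
  l.foldl (fun p x => p.bind fun s => A.update s x) A.init

/-- `ε`-DP pan-privacy (event level): after any number `t` of steps, the internal state is `ε`-DP
as a function of the stream prefix of length `t`. -/
def StreamAlg.IsPanPrivate {X : Type} (A : StreamAlg X) (ε : ℝ) : Prop :=
  ∀ t : ℕ, IsDP ε 0 fun S : Fin t → X => A.stateLaw (List.ofFn S)

/-- The law of the answer on a dataset of size `n`, read as a stream. -/
def StreamAlg.run {X : Type} (A : StreamAlg X) {n : ℕ} (S : Fin n → X) : PMF ℝ :=
  (A.stateLaw (List.ofFn S)).bind A.output

/-! ### The shuffle model -/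

/-- A shuffle protocol over the alphabet `X`. All parties see a public random string, drawn
independently of the data (for instance the hash function that all users apply). Every user applies
the local randomizer, with private coins, to their own input, and sends a multiset of messages; the
analyzer computes the answer from the shuffled messages. -/
structure ShuffleProtocol (X : Type) where
  /-- the set of public random strings -/
  Pub : Type
  /-- the law of the public random string -/
  pub : PMF Pub
  /-- the set of messages -/
  Msg : Type
  /-- the local randomizer -/
  randomizer : Pub → X → PMF (Multiset Msg)
  /-- the analyzer -/
  analyzer : Pub → Multiset Msg → PMF ℝ

/-- The law of the shuffler's output, given the public random string. The randomizers of the users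
are independent. A uniformly permuted list of messages carries the same information as the multiset
of all messages, so the output of the shuffler is this multiset. -/
def ShuffleProtocol.shuffled {X : Type} (P : ShuffleProtocol X) (w : P.Pub) :
    List X → PMF (Multiset P.Msg)
  | [] => PMF.pure 0
  | x :: l => (P.randomizer w x).bind fun m => (P.shuffled w l).map fun M => m + M

/-- `(ε, δ)`-DP in the shuffle model with `n` users: whatever the public random string is, the
shuffler's output is `(ε, δ)`-DP. -/
def ShuffleProtocol.IsShuffleDP {X : Type} (P : ShuffleProtocol X) (n : ℕ) (ε δ : ℝ) : Prop :=
  ∀ w : P.Pub, IsDP ε δ fun S : Fin n → X => P.shuffled w (List.ofFn S)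

/-- The law of the analyzer's answer on a dataset of size `n`. -/
def ShuffleProtocol.run {X : Type} (P : ShuffleProtocol X) {n : ℕ} (S : Fin n → X) : PMF ℝ :=
  P.pub.bind fun w => (P.shuffled w (List.ofFn S)).bind (P.analyzer w)

/-! ### Symmetric properties and symmetric estimators -/

theorem sum_prod_eq_one {k : ℕ} (D : PMF (Fin k)) (n : ℕ) :
    ∑ S : Fin n → Fin k, ∏ i, D (S i) = 1 := by
  have h : ∑ x, D x = 1 := by
    rw [← D.tsum_coe, tsum_fintype]
  have := Finset.prod_univ_sum (fun _ : Fin n => (Finset.univ : Finset (Fin k)))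
    (fun _ x => D x)
  simp only [Fintype.piFinset_univ, h, Finset.prod_const_one] at this
  exact this.symm

/-- The law `D^n` of `n` i.i.d. samples from `D`. -/
def iid {k : ℕ} (D : PMF (Fin k)) (n : ℕ) : PMF (Fin n → Fin k) :=
  PMF.ofFintype (fun S => ∏ i, D (S i)) (sum_prod_eq_one D n)

/-- A property of distributions over `[k]` is symmetric if it is invariant under relabeling. -/
def IsSymmetricProperty {k : ℕ} (f : PMF (Fin k) → ℝ) : Prop :=
  ∀ (σ : Equiv.Perm (Fin k)) (D : PMF (Fin k)), f (D.map σ) = f D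

/-- The histogram of a dataset. -/
def histogram {k n : ℕ} (S : Fin n → Fin k) (j : Fin k) : ℕ :=
  (Finset.univ.filter fun i => S i = j).card

/-- The anonymized histogram of a dataset: the entries of its histogram in decreasing order. -/
def anonHistogram {k n : ℕ} (S : Fin n → Fin k) : List ℕ :=
  (Finset.univ.val.map (histogram S)).sort (· ≥ ·)

/-- An estimator: a real function on datasets of size `n` over `[k]`, for each `n`. -/
abbrev Estimator (k : ℕ) : Type := (n : ℕ) → (Fin n → Fin k) → ℝ

/-- An estimator is symmetric if it depends only on the anonymized histogram. -/
def Estimator.IsSymmetric {k : ℕ} (g : Estimator k) : Prop :=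
  ∀ (n : ℕ) (S S' : Fin n → Fin k), anonHistogram S = anonHistogram S' → g n S = g n S'

/-- The sensitivity of `g` at size `n`: the smallest bound for `|g S - g S'|` over neighboring
datasets `S`, `S'` of size `n`. -/
def Estimator.sensitivity {k : ℕ} (g : Estimator k) (n : ℕ) : ℝ :=
  sInf {Δ : ℝ | 0 ≤ Δ ∧ ∀ S S' : Fin n → Fin k, Neighboring S S' → |g n S - g n S'| ≤ Δ}

/-- With `n` samples from any distribution over `[k]`, the estimate of `f` by `g` is off by more
than `α` with probability less than `0.1`. -/
def Estimator.IsAccurate {k : ℕ} (g : Estimator k) (f : PMF (Fin k) → ℝ) (α : ℝ) (n : ℕ) : Prop :=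
  ∀ D : PMF (Fin k),
    (iid D n).toOuterMeasure {S | α < |g n S - f D|} < ENNReal.ofReal 0.1

/-- The non-private sample complexity of estimating `f` up to `α` by `g`: the smallest `N` such
that `n` samples suffice for every `n ≥ N` (`⊤` if there is none). -/
def Estimator.sampleComplexity {k : ℕ} (g : Estimator k) (f : PMF (Fin k) → ℝ) (α : ℝ) : ℕ∞ :=
  ⨅ (N : ℕ) (_ : ∀ n, N ≤ n → g.IsAccurate f α n), (N : ℕ∞)

/-- The error bound `E(n, ε) = c √n (log n)^(3/4) / ε^(5/2)` with constant `c`. -/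
def errBound (c : ℝ) (n : ℕ) (ε : ℝ) : ℝ :=
  c * √(n : ℝ) * Real.log n ^ (3 / 4 : ℝ) / ε ^ (5 / 2 : ℝ)

/-- The smallest `N` such that the sensitivity of `g` at size `n` is at most `0.1 α / E(n, ε)` for
every `n ≥ N` (`⊤` if there is none); the inequality is written without the division, since
`E(n, ε) = 0` for `n ≤ 1`. -/
def Estimator.sensitivityComplexity {k : ℕ} (g : Estimator k) (c α ε : ℝ) : ℕ∞ :=
  ⨅ (N : ℕ) (_ : ∀ n, N ≤ n → g.sensitivity n * errBound c n ε ≤ 0.1 * α), (N : ℕ∞)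

/-- With `n` samples from any distribution over `[k]`, the answer of the mechanism `M` is off from
`f` by more than `α` with probability less than `0.2`. -/
def Estimates {k n : ℕ} (M : (Fin n → Fin k) → PMF ℝ) (f : PMF (Fin k) → ℝ) (α : ℝ) : Prop :=
  ∀ D : PMF (Fin k),
    ((iid D n).bind M).toOuterMeasure {y | α < |y - f D|} < ENNReal.ofReal 0.2

end SymmEst

end

noncomputable section

namespace SymmEst

section

/-! ### Laws on a commutative monoid under convolution -/

/-! Both mechanisms compute one noisy linear sketch. Every user adds one unit to two cells, chosen
by two public random hash functions: one into `100 n ^ 2` cells, collision-free on the data with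
probability at least 0.99, and one into `16 n` cells. Every cell carries two-sided geometric noise
of ratio `exp (-q)` with `q = ε / (4 b)`, `b = max 1 ε₀`. Replacing one element takes away two units
and adds two, so privacy costs `4 q ≤ ε`. A streaming algorithm draws the noise at the start. In the
shuffle model the users generate it jointly: a geometric law is an `n`-fold convolution of negative
binomial laws (`exists_geo_root`), units travel as signed messages, and a uniform number of
cancelling pairs hides a missing message at a cost controlled by `δ` (`messageNoise_close`). Both
answers then have the law `sketchAnswer`.

The decoder evaluates `g` at any dataset that fits the sketch. A symmetric `g` is Lipschitz, with
its sensitivity as constant, for the ℓ¹ distance of sorted histograms, which is bounded by that of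
the tail counts (`Estimator.abs_sub_le_anonDist`). The true dataset fits with probability at least
0.9, and any two datasets fitting the same sketch are within `4000 √(n log n / q ^ 5)`
(`anonDist_le_of_fits`).

Low tail counts, up to a threshold `T` of about `(4 / q) log n`, come from the small table. For a
root of unity `z`, the average of `z ^ load` over its cells concentrates around the exponential of
`∑ (z ^ c - 1) / m` over the multiplicities `c`. This exponent is `(z - 1) / m` times the Fourier
transform of the tail counts, so Parseval bounds their ℓ² error, and Cauchy–Schwarz over `T` levels
finishes. High tail counts come from the large table by counting cells above each level; its many
empty cells matter only when their noise reaches `T`. The square errors, weighted by the level,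
total order `n / q ^ 5`, and Cauchy–Schwarz against the harmonic sum loses a logarithm. In both
tables the bias of the noise is removed exactly by the inverse of averaging over it
(`integral_lap_deconv`).

The error obtained has `(log n) ^ (1/2)`, which for `n ≥ 2` is at most twice `(log n) ^ (3/4)`;
hence the bound `E` suffices with `K = 1`. -/

/-- Probability mass functions on an additive commutative monoid, multiplied by convolution. -/
@[ext]
structure Conv (M : Type*) where
  /-- the underlying probability mass function -/
  law : PMF M

namespace Conv

variable {M N : Type*} [AddCommMonoid M] [AddCommMonoid N]

instance : Mul (Conv M) where
  mul p q := ⟨p.law.bind fun a => q.law.bind fun b => PMF.pure (a + b)⟩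

instance : One (Conv M) where
  one := ⟨PMF.pure 0⟩

theorem law_mul (p q : Conv M) :
    (p * q).law = p.law.bind fun a => q.law.bind fun b => PMF.pure (a + b) := rfl

theorem law_one : (1 : Conv M).law = PMF.pure 0 := rfl

instance : CommMonoid (Conv M) where
  mul_assoc p q r := by
    ext1
    simp [law_mul, PMF.bind_bind, add_assoc]
  one_mul p := by
    ext1
    simp [law_mul, law_one]
  mul_one p := by
    ext1
    simp [law_mul, law_one]
  mul_comm p q := by
    ext1
    rw [law_mul, PMF.bind_comm, law_mul]
    simp [add_comm]

/-- The law of a deterministic element. -/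
def dirac (a : M) : Conv M := ⟨PMF.pure a⟩

omit [AddCommMonoid M] in
theorem law_dirac (a : M) : (dirac a).law = PMF.pure a := rfl

theorem dirac_zero : dirac (0 : M) = 1 := rfl

theorem dirac_add (a b : M) : dirac (a + b) = dirac a * dirac b := by
  ext1
  simp [law_mul, law_dirac]

theorem law_mul_dirac (a : M) (p : Conv M) : (p * dirac a).law = p.law.map fun b => b + a := by
  simp [law_mul, law_dirac, PMF.map, Function.comp_def]

/-- The pushforward of a law under a homomorphism. -/
def hom (f : M →+ N) : Conv M →* Conv N where
  toFun p := ⟨p.law.map f⟩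
  map_one' := by
    ext1
    simp [law_one, PMF.pure_map]
  map_mul' p q := by
    ext1
    simp [law_mul, PMF.map_bind, PMF.bind_map, PMF.pure_map, Function.comp_def]

theorem law_hom (f : M →+ N) (p : Conv M) : (hom f p).law = p.law.map f := rfl

theorem hom_dirac (f : M →+ N) (a : M) : hom f (dirac a) = dirac (f a) := by
  ext1
  simp [law_hom, law_dirac, PMF.pure_map]

theorem hom_hom {L : Type*} [AddCommMonoid L] (g : N →+ L) (f : M →+ N) (p : Conv M) :
    hom g (hom f p) = hom (g.comp f) p := by
  ext1
  simp [law_hom, PMF.map_comp]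

theorem hom_zero (p : Conv M) : hom (0 : M →+ N) p = 1 := by
  ext1
  exact PMF.map_const p.law 0

end Conv

/-! ### Closeness of laws -/

/-- Every event has probability under `p` at most `a` times that under `q`, plus `d`. -/
def Close {R : Type*} (a d : ℝ≥0∞) (p q : PMF R) : Prop :=
  ∀ E : Set R, p.toOuterMeasure E ≤ a * q.toOuterMeasure E + d

namespace Close

variable {R R' M N : Type*} [AddCommMonoid M] [AddCommMonoid N] {a b d e : ℝ≥0∞}

theorem trans {p q r : PMF R} (h : Close a d p q) (h' : Close b e q r) :
    Close (a * b) (a * e + d) p r := fun E => by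
  calc p.toOuterMeasure E ≤ a * q.toOuterMeasure E + d := h E
    _ ≤ a * (b * r.toOuterMeasure E + e) + d := by gcongr; exact h' E
    _ = a * b * r.toOuterMeasure E + (a * e + d) := by ring

theorem mono {p q : PMF R} (h : Close a d p q) (hab : a ≤ b) (hde : d ≤ e) : Close b e p q :=
  fun E => (h E).trans (by gcongr)

theorem map {p q : PMF R} (h : Close a d p q) (f : R → R') : Close a d (p.map f) (q.map f) :=
  fun E => by simpa only [PMF.toOuterMeasure_map_apply] using h (f ⁻¹' E)

theorem bind_left {p q : R → PMF R'} (r : PMF R) (h : ∀ x, Close a d (p x) (q x)) :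
    Close a d (r.bind p) (r.bind q) := fun E => by
  rw [PMF.toOuterMeasure_bind_apply, PMF.toOuterMeasure_bind_apply]
  calc ∑' x, r x * (p x).toOuterMeasure E
      ≤ ∑' x, (a * (r x * (q x).toOuterMeasure E) + r x * d) := by
        refine ENNReal.tsum_le_tsum fun x => ?_
        calc r x * (p x).toOuterMeasure E ≤ r x * (a * (q x).toOuterMeasure E + d) := by
              gcongr; exact h x E
          _ = _ := by ring
    _ = _ := by rw [ENNReal.tsum_add, ENNReal.tsum_mul_left, ENNReal.tsum_mul_right, r.tsum_coe,
        one_mul]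

theorem of_pointwise {p q : PMF R} (h : ∀ x, p x ≤ a * q x) : Close a 0 p q := fun E => by
  rw [PMF.toOuterMeasure_apply, PMF.toOuterMeasure_apply, add_zero, ← ENNReal.tsum_mul_left]
  refine ENNReal.tsum_le_tsum fun x => ?_
  by_cases hx : x ∈ E
  · simpa [hx] using h x
  · simp [hx]

theorem mul_left {p q : Conv M} (r : Conv M) (h : Close a d p.law q.law) :
    Close a d (r * p).law (r * q).law :=
  bind_left r.law fun x => by
    have := h.map (fun y => x + y)
    simpa [PMF.map, Function.comp_def] using this

theorem mul_right {p q : Conv M} (r : Conv M) (h : Close a d p.law q.law) :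
    Close a d (p * r).law (q * r).law := by
  rw [mul_comm p, mul_comm q]
  exact h.mul_left r

theorem hom {p q : Conv M} (h : Close a d p.law q.law) (f : M →+ N) :
    Close a d (Conv.hom f p).law (Conv.hom f q).law := h.map f

end Close

end

section

/-! ### Geometric laws and their convolution roots -/

theorem hasSum_geometric_weights (p : Set.Ioo (0 : ℝ) 1) :
    HasSum (fun k : ℕ => ENNReal.ofReal ((1 - p) * (p : ℝ) ^ k)) 1 := by
  have h := (hasSum_geometric_of_lt_one p.2.1.le p.2.2).mul_left (1 - (p : ℝ))
  rw [mul_inv_cancel₀ (by have := p.2.2; linarith)] at h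
  have hn : ∀ k : ℕ, 0 ≤ (1 - (p : ℝ)) * (p : ℝ) ^ k := fun k =>
    mul_nonneg (by have := p.2.2; linarith) (pow_nonneg p.2.1.le k)
  rw [ENNReal.summable.hasSum_iff, ← ENNReal.ofReal_tsum_of_nonneg hn h.summable, h.tsum_eq]
  simp

/-- The geometric law with ratio `p`: the number `k` has probability `(1 - p) p ^ k`. -/
def geo (p : Set.Ioo (0 : ℝ) 1) : Conv ℕ :=
  ⟨⟨fun k => ENNReal.ofReal ((1 - p) * (p : ℝ) ^ k), hasSum_geometric_weights p⟩⟩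

theorem geo_law_apply (p : Set.Ioo (0 : ℝ) 1) (k : ℕ) :
    (geo p).law k = ENNReal.ofReal ((1 - p) * (p : ℝ) ^ k) := rfl

/-- One step to the right divides every mass by `p`. The reverse comparison fails, since the shifted
law does not charge 0. This one-sidedness is why the sketch uses a difference of two geometric laws
and the shuffle protocol needs blankets. -/
theorem geo_close_shift (p : Set.Ioo (0 : ℝ) 1) :
    Close (ENNReal.ofReal (p : ℝ)⁻¹) 0 (geo p * Conv.dirac 1).law (geo p).law := by
  refine Close.of_pointwise fun k => ?_
  rw [Conv.law_mul_dirac, PMF.map_apply]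
  have hp := p.2.1
  have hp' := p.2.2
  cases k with
  | zero => simp
  | succ k =>
    rw [tsum_eq_single k (fun j hj => by rw [if_neg]; omega), if_pos rfl, geo_law_apply,
      geo_law_apply, ← ENNReal.ofReal_mul (by positivity)]
    apply le_of_eq
    congr 1
    field_simp
    ring

/-- Multiplied by `k!` it is the rising factorial `r (r + 1) ⋯ (r + k - 1)`. -/
theorem multichoose_nonneg {r : ℝ} (hr : 0 ≤ r) (k : ℕ) : 0 ≤ Ring.multichoose r k := by
  have h := Ring.factorial_nsmul_multichoose_eq_ascPochhammer r k
  have h2 : 0 ≤ (ascPochhammer ℕ k).smeval r := by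
    induction k with
    | zero => simp
    | succ k ih =>
      rw [ascPochhammer_succ_right, Polynomial.smeval_mul]
      refine mul_nonneg (ih (Ring.factorial_nsmul_multichoose_eq_ascPochhammer r k)) ?_
      rw [Polynomial.smeval_add, Polynomial.smeval_X, Polynomial.smeval_natCast]
      simp
      positivity
  rw [← h, nsmul_eq_mul] at h2
  exact nonneg_of_mul_nonneg_right h2 (by positivity)

/-- The Chu–Vandermonde identity for `choose`, carried over by negating the upper argument. -/
theorem multichoose_add (r s : ℝ) (k : ℕ) :
    ∑ x ∈ Finset.HasAntidiagonal.antidiagonal k, Ring.multichoose r x.1 * Ring.multichoose s x.2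
      = Ring.multichoose (r + s) k := by
  have key : ∀ (t : ℝ) (j : ℕ), Ring.multichoose t j = (-1) ^ j * Ring.choose (-t) j := by
    intro t j
    rw [Ring.choose_neg', Int.negOnePow_def]
    simp [Units.smul_def, ← mul_assoc, ← mul_pow]
  rw [key, neg_add, Ring.add_choose_eq k (Commute.all _ _), Finset.mul_sum]
  refine Finset.sum_congr rfl fun x hx => ?_
  rw [key, key, ← Finset.HasAntidiagonal.mem_antidiagonal.1 hx]
  ring

theorem tsum_mul_tsum_antidiagonal (u v F : ℕ → ℝ≥0∞) :
    ∑' a, ∑' b, u a * v b * F (a + b)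
      = ∑' k, (∑ x ∈ Finset.HasAntidiagonal.antidiagonal k, u x.1 * v x.2) * F k := by
  rw [← ENNReal.tsum_prod (f := fun a b => u a * v b * F (a + b)),
    ← Finset.HasAntidiagonal.sigmaAntidiagonalEquivProd.tsum_eq, ENNReal.tsum_sigma']
  refine tsum_congr fun k => ?_
  rw [tsum_fintype, Finset.sum_mul, Finset.univ_eq_attach]
  refine Eq.trans (Finset.sum_congr rfl fun x _ => ?_)
    (Finset.sum_attach _ fun x : ℕ × ℕ => u x.1 * v x.2 * F k)
  simp only [Finset.HasAntidiagonal.sigmaAntidiagonalEquivProd_apply]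
  rw [Finset.HasAntidiagonal.mem_antidiagonal.1 (Subtype.prop x)]

/-- The weights `multichoose r k * p ^ k` of a negative binomial law. -/
def nbWeight (p : Set.Ioo (0 : ℝ) 1) (r : ℝ) (k : ℕ) : ℝ≥0∞ :=
  ENNReal.ofReal (Ring.multichoose r k * (p : ℝ) ^ k)

theorem nbWeight_add (p : Set.Ioo (0 : ℝ) 1) {r s : ℝ} (hr : 0 ≤ r) (hs : 0 ≤ s) (k : ℕ) :
    ∑ x ∈ Finset.HasAntidiagonal.antidiagonal k, nbWeight p r x.1 * nbWeight p s x.2 = nbWeight p (r + s) k := by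
  have hp := p.2.1
  rw [nbWeight, ← multichoose_add, Finset.sum_mul, ENNReal.ofReal_sum_of_nonneg]
  · refine Finset.sum_congr rfl fun x hx => ?_
    rw [nbWeight, nbWeight, ← ENNReal.ofReal_mul
      (mul_nonneg (multichoose_nonneg hr _) (by positivity)), ← Finset.HasAntidiagonal.mem_antidiagonal.1 hx]
    congr 1
    ring
  · exact fun x _ => mul_nonneg (mul_nonneg (multichoose_nonneg hr _) (multichoose_nonneg hs _))
      (by positivity)

theorem nbWeight_zero (p : Set.Ioo (0 : ℝ) 1) (k : ℕ) :
    nbWeight p 0 k = if k = 0 then 1 else 0 := by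
  cases k with
  | zero => simp [nbWeight]
  | succ k => simp [nbWeight]

theorem nbWeight_one (p : Set.Ioo (0 : ℝ) 1) (k : ℕ) :
    nbWeight p 1 k = ENNReal.ofReal ((p : ℝ) ^ k) := by
  simp [nbWeight]

/-- Total masses multiply under convolution. With `r = 1 / n` this determines the `n`-th power of
the normalizing constant from the geometric series, so its value at a fractional exponent is never
needed. -/
theorem tsum_nbWeight_pow (p : Set.Ioo (0 : ℝ) 1) {r : ℝ} (hr : 0 ≤ r) (j : ℕ) :
    ∑' k, nbWeight p (j * r) k = (∑' k, nbWeight p r k) ^ j := by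
  induction j with
  | zero => simp [nbWeight_zero]
  | succ j ih =>
    rw [pow_succ, ← ih]
    have h := tsum_mul_tsum_antidiagonal (nbWeight p (j * r)) (nbWeight p r) 1
    simp only [Pi.one_apply, mul_one, ENNReal.tsum_mul_left, ENNReal.tsum_mul_right,
      nbWeight_add p (mul_nonneg j.cast_nonneg hr) hr] at h
    rw [h]
    push_cast
    congr! 3
    ring

/-- Geometric laws are infinitely divisible: the negative binomial weights form a convolution
semigroup in `r`, which is geometric at `r = 1`, so the normalized weights at `r = 1 / n` are a
root. -/
theorem exists_geo_root (p : Set.Ioo (0 : ℝ) 1) {n : ℕ} (hn : n ≠ 0) :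
    ∃ b : Conv ℕ, b ^ n = geo p := by
  set r : ℝ := (n : ℝ)⁻¹ with hr
  have hr0 : 0 ≤ r := by positivity
  have hnr : (n : ℝ) * r = 1 := mul_inv_cancel₀ (by positivity)
  set s := ∑' k, nbWeight p r k with hs
  have hsn : s ^ n ≠ ∞ := by
    rw [hs, ← tsum_nbWeight_pow p hr0, hnr]
    simp only [nbWeight_one]
    rw [← ENNReal.ofReal_tsum_of_nonneg (fun k => pow_nonneg p.2.1.le k)
      (summable_geometric_of_lt_one p.2.1.le p.2.2)]
    exact ENNReal.ofReal_ne_top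
  have hst : s ≠ ∞ := fun h => hsn (by rw [h, ENNReal.top_pow hn])
  have hs0 : s ≠ 0 := by
    intro h
    rw [hs, ENNReal.tsum_eq_zero] at h
    simpa [nbWeight] using h 0
  set b : Conv ℕ := ⟨PMF.normalize (nbWeight p r) hs0 hst⟩ with hb
  have hpow : ∀ (j k : ℕ), (b ^ j).law k = nbWeight p (j * r) k * (s ^ j)⁻¹ := by
    intro j
    induction j with
    | zero =>
      intro k
      simp [Conv.law_one, nbWeight_zero, PMF.pure_apply]
    | succ j ih =>
      intro k
      rw [pow_succ, Conv.law_mul, PMF.bind_apply]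
      simp only [PMF.bind_apply, PMF.pure_apply, ih, ← ENNReal.tsum_mul_left]
      have h := tsum_mul_tsum_antidiagonal (fun k => nbWeight p (j * r) k * (s ^ j)⁻¹)
        (fun k => nbWeight p r k * s⁻¹) (fun i => if k = i then 1 else 0)
      simp only [hb, PMF.normalize_apply, ← hs, ← mul_assoc] at h ⊢
      have h' := h.trans (tsum_eq_single k fun i hi => by rw [if_neg hi.symm, mul_zero])
      rw [if_pos rfl, mul_one] at h'
      refine Eq.trans (by congr!) (h'.trans ?_)
      have h2 := nbWeight_add p (mul_nonneg (j.cast_nonneg (α := ℝ)) hr0) hr0 k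
      push_cast
      rw [add_mul, one_mul, ← h2, Finset.sum_mul, pow_succ,
        ENNReal.mul_inv (Or.inr hst) (Or.inr hs0)]
      refine Finset.sum_congr rfl fun x _ => ?_
      ring
  refine ⟨b, ?_⟩
  have hlaw : ∀ k, (b ^ n).law k = ENNReal.ofReal ((p : ℝ) ^ k) * (s ^ n)⁻¹ := by
    intro k
    rw [hpow, hnr, nbWeight_one]
  have hsv : s ^ n = ENNReal.ofReal (1 - p)⁻¹ := by
    rw [hs, ← tsum_nbWeight_pow p hr0, hnr]
    simp only [nbWeight_one]
    rw [← ENNReal.ofReal_tsum_of_nonneg (fun k => pow_nonneg p.2.1.le k)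
      (summable_geometric_of_lt_one p.2.1.le p.2.2), tsum_geometric_of_lt_one p.2.1.le p.2.2]
  have hp1 : 0 < 1 - (p : ℝ) := by have := p.2.2; linarith
  ext1
  ext k
  rw [hlaw, hsv, geo_law_apply, ← ENNReal.ofReal_inv_of_pos (by positivity),
    ← ENNReal.ofReal_mul (pow_nonneg p.2.1.le k), inv_inv, mul_comm]

/-! ### Uniform blankets -/

/-- The uniform law on `{0, …, L}`. -/
def blanket (L : ℕ) : Conv ℕ :=
  ⟨PMF.uniformOfFinset (Finset.range (L + 1)) Finset.nonempty_range_add_one⟩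

theorem blanket_law_apply (L k : ℕ) :
    (blanket L).law k = if k < L + 1 then (L + 1 : ℝ≥0∞)⁻¹ else 0 := by
  rw [blanket, PMF.uniformOfFinset_apply]
  simp

/-- The shift only moves the mass of the endpoint 0 to `L + 1`. -/
theorem blanket_close_shift (L : ℕ) :
    Close 1 (L + 1 : ℝ≥0∞)⁻¹ (blanket L).law (blanket L * Conv.dirac 1).law := by
  have hpt : ∀ k, (blanket L).law k
      ≤ (blanket L * Conv.dirac 1).law k + if k = 0 then (L + 1 : ℝ≥0∞)⁻¹ else 0 := by
    intro k
    cases k with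
    | zero => simp [blanket_law_apply]
    | succ k =>
      rw [Conv.law_mul_dirac, PMF.map_apply,
        tsum_eq_single k (fun j hj => by rw [if_neg]; omega), if_pos rfl]
      simp only [blanket_law_apply]
      split_ifs <;> first | omega | simp
  intro E
  rw [one_mul, PMF.toOuterMeasure_apply, PMF.toOuterMeasure_apply]
  calc ∑' k, E.indicator (blanket L).law k
      ≤ ∑' k, (E.indicator (blanket L * Conv.dirac 1).law k
          + if k = 0 then (L + 1 : ℝ≥0∞)⁻¹ else 0) := by
        refine ENNReal.tsum_le_tsum fun k => ?_
        by_cases hk : k ∈ E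
        · simpa [hk] using hpt k
        · simp [hk]
    _ = _ := by rw [ENNReal.tsum_add, tsum_ite_eq]

end

section

/-! ### Noisy linear sketches -/

/-- The two-sided geometric (discrete Laplace) law with ratio `p`. -/
def lap (p : Set.Ioo (0 : ℝ) 1) : Conv ℤ :=
  Conv.hom (Nat.castAddMonoidHom ℤ) (geo p) * Conv.hom (-Nat.castAddMonoidHom ℤ) (geo p)

/-- The positive geometric summand absorbs the shift. -/
theorem lap_close_shift (p : Set.Ioo (0 : ℝ) 1) :
    Close (ENNReal.ofReal (p : ℝ)⁻¹) 0 (lap p * Conv.dirac 1).law (lap p).law := by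
  have h := ((geo_close_shift p).hom (Nat.castAddMonoidHom ℤ)).mul_right
    (Conv.hom (-Nat.castAddMonoidHom ℤ) (geo p))
  rw [map_mul, Conv.hom_dirac, mul_right_comm] at h
  simpa [lap] using h

/-- The negative summand absorbs a shift by -1; shifting both sides back by 1 gives the comparison
missing for a single geometric law. -/
theorem lap_close_shift' (p : Set.Ioo (0 : ℝ) 1) :
    Close (ENNReal.ofReal (p : ℝ)⁻¹) 0 (lap p).law (lap p * Conv.dirac 1).law := by
  have h := (((geo_close_shift p).hom (-Nat.castAddMonoidHom ℤ)).mul_left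
    (Conv.hom (Nat.castAddMonoidHom ℤ) (geo p))).mul_right (Conv.dirac 1)
  rw [map_mul, Conv.hom_dirac, ← mul_assoc, mul_assoc _ (Conv.dirac _) (Conv.dirac _),
    ← Conv.dirac_add] at h
  simpa [lap, Conv.dirac_zero] using h

section Sketch

variable {C : Type} [Fintype C] [DecidableEq C]

/-- Independent two-sided geometric noise in every cell. -/
def noise (C : Type) [Fintype C] [DecidableEq C] (p : Set.Ioo (0 : ℝ) 1) : Conv (C → ℤ) :=
  ∏ c : C, Conv.hom (AddMonoidHom.single (fun _ => ℤ) c) (lap p)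

theorem noise_close_shift (p : Set.Ioo (0 : ℝ) 1) (c : C) :
    Close (ENNReal.ofReal (p : ℝ)⁻¹) 0 (noise C p * Conv.dirac (Pi.single c 1)).law
      (noise C p).law := by
  have h := ((lap_close_shift p).hom (AddMonoidHom.single (fun _ : C => ℤ) c)).mul_left
    (∏ c' ∈ Finset.univ.erase c, Conv.hom (AddMonoidHom.single (fun _ => ℤ) c') (lap p))
  rw [map_mul, Conv.hom_dirac, ← mul_assoc, Finset.prod_erase_mul _ _ (Finset.mem_univ c)] at h
  exact h

theorem noise_close_shift' (p : Set.Ioo (0 : ℝ) 1) (c : C) :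
    Close (ENNReal.ofReal (p : ℝ)⁻¹) 0 (noise C p).law
      (noise C p * Conv.dirac (Pi.single c 1)).law := by
  have h := ((lap_close_shift' p).hom (AddMonoidHom.single (fun _ : C => ℤ) c)).mul_left
    (∏ c' ∈ Finset.univ.erase c, Conv.hom (AddMonoidHom.single (fun _ => ℤ) c') (lap p))
  rw [map_mul, Conv.hom_dirac, ← mul_assoc, Finset.prod_erase_mul _ _ (Finset.mem_univ c)] at h
  exact h

/-- Drop the two old units by `hup`, then insert the two new ones by `hdown`. Only insertions may
cost an additive error: `d` is 0 for the sketch and comes from the blanket for shuffled messages.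
The remainder `r` is the part shared by neighboring datasets. -/
theorem Close.of_two_steps {M : Type*} [AddCommMonoid M] {a d : ℝ≥0∞} {N : Conv M} {u : M → Prop}
    (hup : ∀ e, u e → Close a 0 (N * Conv.dirac e).law N.law)
    (hdown : ∀ e, u e → Close a d N.law (N * Conv.dirac e).law)
    {e₁ e₂ e₁' e₂' : M} (h₁ : u e₁) (h₂ : u e₂) (h₁' : u e₁') (h₂' : u e₂') (r : M) :
    Close (a ^ 4) (a ^ 2 * (a * d + d)) (N * Conv.dirac (e₁ + e₂ + r)).law
      (N * Conv.dirac (e₁' + e₂' + r)).law := by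
  have s1 := (hup e₁ h₁).mul_right (Conv.dirac e₂)
  have s2 := s1.trans (hup e₂ h₂)
  have s3 := (hdown e₁' h₁').mul_right (Conv.dirac e₂')
  have s4 := (hdown e₂' h₂').trans s3
  have s5 := ((s2.trans s4).mul_right (Conv.dirac r))
  rw [Conv.dirac_add, Conv.dirac_add, Conv.dirac_add, Conv.dirac_add, ← mul_assoc, ← mul_assoc,
    ← mul_assoc, ← mul_assoc]
  refine s5.mono (le_of_eq (by ring)) (le_of_eq (by ring))

/-- The contribution of a user to the sketch: one unit in each of two cells. -/
def unitVec {X : Type} (c₁ c₂ : X → C) (x : X) : C → ℤ :=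
  Pi.single (c₁ x) 1 + Pi.single (c₂ x) 1

/-- The noisy linear sketch of a dataset. -/
def sketch {X : Type} (p : Set.Ioo (0 : ℝ) 1) (c₁ c₂ : X → C) (l : List X) : Conv (C → ℤ) :=
  noise C p * Conv.dirac (l.map (unitVec c₁ c₂)).sum

theorem exists_sum_ofFn_eq {X M : Type*} [AddCommMonoid M] {n : ℕ} {S S' : Fin n → X}
    (h : Neighboring S S') (f : X → M) :
    ∃ i r, ((List.ofFn S).map f).sum = f (S i) + r ∧ ((List.ofFn S').map f).sum = f (S' i) + r := by
  obtain ⟨i, hi⟩ := h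
  refine ⟨i, ∑ j ∈ Finset.univ.erase i, f (S j), ?_, ?_⟩
  · rw [List.map_ofFn, List.sum_ofFn]
    exact (Finset.add_sum_erase _ (fun j => f (S j)) (Finset.mem_univ i)).symm
  · rw [List.map_ofFn, List.sum_ofFn, Finset.sum_congr (s₁ := Finset.univ.erase i) rfl fun j hj =>
      congrArg f (hi j (Finset.ne_of_mem_erase hj))]
    exact (Finset.add_sum_erase _ (fun j => f (S' j)) (Finset.mem_univ i)).symm

theorem sketch_close {X : Type} (p : Set.Ioo (0 : ℝ) 1) (c₁ c₂ : X → C) {n : ℕ}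
    {S S' : Fin n → X} (h : Neighboring S S') :
    Close (ENNReal.ofReal (p : ℝ)⁻¹ ^ 4) 0 (sketch p c₁ c₂ (List.ofFn S)).law
      (sketch p c₁ c₂ (List.ofFn S')).law := by
  obtain ⟨i, r, h1, h2⟩ := exists_sum_ofFn_eq h (unitVec c₁ c₂)
  rw [sketch, sketch, h1, h2]
  refine (Close.of_two_steps (u := fun e => ∃ c : C, e = Pi.single c 1)
    (a := ENNReal.ofReal (p : ℝ)⁻¹) (d := 0) ?_ ?_ ⟨_, rfl⟩ ⟨_, rfl⟩ ⟨_, rfl⟩ ⟨_, rfl⟩ r).mono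
    le_rfl (by simp)
  · rintro _ ⟨c, rfl⟩
    exact noise_close_shift p c
  · rintro _ ⟨c, rfl⟩
    exact noise_close_shift' p c

variable {X W : Type}

/-- The law of the answer computed by `dec` from the public string and the noisy sketch. -/
def sketchAnswer (p : Set.Ioo (0 : ℝ) 1) (pub : PMF W) (c₁ c₂ : W → X → C)
    (dec : W → (C → ℤ) → ℝ) (l : List X) : PMF ℝ :=
  pub.bind fun w => (sketch p (c₁ w) (c₂ w) l).law.map (dec w)

/-- The streaming algorithm which keeps the public string and the noisy sketch. -/
abbrev sketchStream (p : Set.Ioo (0 : ℝ) 1) (pub : PMF W) (c₁ c₂ : W → X → C)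
    (dec : W → (C → ℤ) → ℝ) : StreamAlg X where
  State := W × (C → ℤ)
  init := pub.bind fun w => (noise C p).law.map (Prod.mk w)
  update s x := PMF.pure (s.1, s.2 + unitVec (c₁ s.1) (c₂ s.1) x)
  output s := PMF.pure (dec s.1 s.2)

theorem sketchStream_stateLaw (p : Set.Ioo (0 : ℝ) 1) (pub : PMF W) (c₁ c₂ : W → X → C)
    (dec : W → (C → ℤ) → ℝ) (l : List X) :
    (sketchStream p pub c₁ c₂ dec).stateLaw l
      = pub.bind fun w => (sketch p (c₁ w) (c₂ w) l).law.map (Prod.mk w) := by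
  -- The starting law has to vary with the induction, since each element read becomes part of it.
  have key : ∀ (l : List X) (q : W → Conv (C → ℤ)),
      l.foldl (fun (r : PMF (W × (C → ℤ))) x => r.bind fun s =>
          PMF.pure (s.1, s.2 + unitVec (c₁ s.1) (c₂ s.1) x))
        (pub.bind fun w => (q w).law.map (Prod.mk w))
      = pub.bind fun w =>
          (q w * Conv.dirac (l.map (unitVec (c₁ w) (c₂ w))).sum).law.map (Prod.mk w) := by
    intro l
    induction l with
    | nil => intro q; simp [Conv.dirac_zero]
    | cons x l ih =>
      intro q
      rw [List.foldl_cons]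
      have h := ih fun w => q w * Conv.dirac (unitVec (c₁ w) (c₂ w) x)
      simp only [mul_assoc, ← Conv.dirac_add] at h
      simp only [List.map_cons, List.sum_cons]
      rw [← h]
      congr 1
      simp [PMF.bind_bind, Conv.law_mul_dirac, PMF.map, Function.comp_def]
  exact key l fun _ => noise C p

theorem sketchStream_run (p : Set.Ioo (0 : ℝ) 1) (pub : PMF W) (c₁ c₂ : W → X → C)
    (dec : W → (C → ℤ) → ℝ) {n : ℕ} (S : Fin n → X) :
    (sketchStream p pub c₁ c₂ dec).run S = sketchAnswer p pub c₁ c₂ dec (List.ofFn S) := by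
  rw [StreamAlg.run, sketchStream_stateLaw, sketchAnswer]
  refine (PMF.bind_bind pub _ _).trans ?_
  congr 1
  funext w
  exact PMF.bind_map _ _ _

theorem ofReal_inv_exp_pow_four (q : ℝ) :
    ENNReal.ofReal (Real.exp (-q))⁻¹ ^ 4 = ENNReal.ofReal (Real.exp (4 * q)) := by
  rw [← ENNReal.ofReal_pow (by positivity), ← Real.exp_neg, ← Real.exp_nat_mul]
  norm_num

/-- The hash functions are part of the state, so the comparison is made for each fixed value of them
and then averaged. Each prefix is covered because the noise is present from the start. -/
theorem sketchStream_isPanPrivate {q : ℝ} (p : Set.Ioo (0 : ℝ) 1) (hp : (p : ℝ) = Real.exp (-q))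
    (pub : PMF W) (c₁ c₂ : W → X → C) (dec : W → (C → ℤ) → ℝ) :
    (sketchStream p pub c₁ c₂ dec).IsPanPrivate (4 * q) := by
  intro t S S' h E
  have := Close.bind_left pub fun w => (sketch_close p (c₁ w) (c₂ w) h).map (Prod.mk w)
  rw [hp, ofReal_inv_exp_pow_four] at this
  have h' := this E
  rw [← sketchStream_stateLaw p pub c₁ c₂ dec, ← sketchStream_stateLaw p pub c₁ c₂ dec] at h'
  rw [ENNReal.ofReal_zero]
  exact h'

/-! ### The shuffle protocol computing a noisy linear sketch -/

/-- The noise messages of one user about cell `c`: independent numbers of positive and negative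
messages, with law `b`, and a number with law `u` of pairs of a positive and a negative message. -/
def cellNoise (b u : Conv ℕ) (c : C) : Conv (Multiset (C × Bool)) :=
  Conv.hom (multiplesHom _ {(c, true)}) b * Conv.hom (multiplesHom _ {(c, false)}) b
    * Conv.hom (multiplesHom _ {(c, true), (c, false)}) u

/-- The independent noise messages about all cells. -/
def messageNoise (C : Type) [Fintype C] (b u : Conv ℕ) : Conv (Multiset (C × Bool)) :=
  ∏ c : C, cellNoise b u c

omit [DecidableEq C] in
theorem messageNoise_pow (b u : Conv ℕ) (n : ℕ) :
    messageNoise C b u ^ n = messageNoise C (b ^ n) (u ^ n) := by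
  simp only [messageNoise, cellNoise, ← Finset.prod_pow, mul_pow, map_pow]

omit [Fintype C] [DecidableEq C] in
theorem cellNoise_close_shift (p : Set.Ioo (0 : ℝ) 1) (u : Conv ℕ) (c : C) (s : Bool) :
    Close (ENNReal.ofReal (p : ℝ)⁻¹) 0 (cellNoise (geo p) u c * Conv.dirac {(c, s)}).law
      (cellNoise (geo p) u c).law := by
  have h := (geo_close_shift p).hom (multiplesHom (Multiset (C × Bool)) {(c, s)})
  rw [map_mul, Conv.hom_dirac] at h
  simp only [multiplesHom_apply, one_smul] at h
  cases s
  · have h' := h.mul_left (Conv.hom (multiplesHom (Multiset (C × Bool)) {(c, true)}) (geo p)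
      * Conv.hom (multiplesHom _ {(c, true), (c, false)}) u)
    convert h' using 2 <;> (rw [cellNoise]; ac_rfl)
  · have h' := h.mul_left (Conv.hom (multiplesHom (Multiset (C × Bool)) {(c, false)}) (geo p)
      * Conv.hom (multiplesHom _ {(c, true), (c, false)}) u)
    convert h' using 2 <;> (rw [cellNoise]; ac_rfl)

-- The shuffler reveals positive and negative counts separately, so negative noise alone cannot hide
-- a positive message. Instead the blanket supplies an extra pair, at additive cost `d`, and the
-- geometric noise then absorbs the negative message of that pair.
omit [Fintype C] [DecidableEq C] in
theorem cellNoise_close_shift' (p : Set.Ioo (0 : ℝ) 1) {u : Conv ℕ} {d : ℝ≥0∞}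
    (hu : Close 1 d u.law (u * Conv.dirac 1).law) (c : C) :
    Close (ENNReal.ofReal (p : ℝ)⁻¹) d (cellNoise (geo p) u c).law
      (cellNoise (geo p) u c * Conv.dirac {(c, true)}).law := by
  have h := (hu.hom (multiplesHom (Multiset (C × Bool)) {(c, true), (c, false)})).mul_left
    (Conv.hom (multiplesHom _ {(c, true)}) (geo p) * Conv.hom (multiplesHom _ {(c, false)}) (geo p))
  rw [map_mul, Conv.hom_dirac, ← mul_assoc] at h
  have h1 : ({(c, true), (c, false)} : Multiset (C × Bool)) = {(c, false)} + {(c, true)} := by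
    rw [add_comm]
    rfl
  simp only [multiplesHom_apply, one_smul] at h
  nth_rw 3 [h1] at h
  rw [Conv.dirac_add, ← mul_assoc] at h
  exact (h.trans ((cellNoise_close_shift p u c false).mul_right (Conv.dirac {(c, true)}))).mono
    (by rw [one_mul]) (by simp)

theorem messageNoise_close (p : Set.Ioo (0 : ℝ) 1) {u : Conv ℕ} {d : ℝ≥0∞}
    (hu : Close 1 d u.law (u * Conv.dirac 1).law) (c₁ c₂ c₁' c₂' : C)
    (r : Multiset (C × Bool)) :
    Close (ENNReal.ofReal (p : ℝ)⁻¹ ^ 4)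
      (ENNReal.ofReal (p : ℝ)⁻¹ ^ 2 * (ENNReal.ofReal (p : ℝ)⁻¹ * d + d))
      (messageNoise C (geo p) u * Conv.dirac ({(c₁, true)} + {(c₂, true)} + r)).law
      (messageNoise C (geo p) u * Conv.dirac ({(c₁', true)} + {(c₂', true)} + r)).law := by
  refine Close.of_two_steps (u := fun e => ∃ c : C, e = {(c, true)}) ?_ ?_
    ⟨_, rfl⟩ ⟨_, rfl⟩ ⟨_, rfl⟩ ⟨_, rfl⟩ r
  · rintro _ ⟨c, rfl⟩
    have h := (cellNoise_close_shift p u c true).mul_left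
      (∏ c' ∈ Finset.univ.erase c, cellNoise (geo p) u c')
    rwa [← mul_assoc, Finset.prod_erase_mul _ _ (Finset.mem_univ c)] at h
  · rintro _ ⟨c, rfl⟩
    have h := (cellNoise_close_shift' p hu c).mul_left
      (∏ c' ∈ Finset.univ.erase c, cellNoise (geo p) u c')
    rwa [← mul_assoc, Finset.prod_erase_mul _ _ (Finset.mem_univ c)] at h

/-- The messages carrying the data of a user. -/
def unitMsg {X : Type} (c₁ c₂ : X → C) (x : X) : Multiset (C × Bool) :=
  {(c₁ x, true)} + {(c₂ x, true)}

/-- The differences of the numbers of positive and negative messages about all cells. -/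
def netCount (C : Type) [DecidableEq C] : Multiset (C × Bool) →+ (C → ℤ) where
  toFun m c := (m.count (c, true) : ℤ) - m.count (c, false)
  map_zero' := by ext c; simp
  map_add' m m' := by ext c; simp; ring

/-- The shuffle protocol in which every user sends data messages and noise messages. -/
abbrev sketchShuffle (b u : Conv ℕ) (pub : PMF W) (c₁ c₂ : W → X → C)
    (dec : W → (C → ℤ) → ℝ) : ShuffleProtocol X where
  Pub := W
  pub := pub
  Msg := C × Bool
  randomizer w x := (messageNoise C b u * Conv.dirac (unitMsg (c₁ w) (c₂ w) x)).law
  analyzer w m := PMF.pure (dec w (netCount C m))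

/-- Convolution commutes, so the noise shares of all users gather into one power and separate from
the data messages. -/
theorem sketchShuffle_shuffled (b u : Conv ℕ) (pub : PMF W) (c₁ c₂ : W → X → C)
    (dec : W → (C → ℤ) → ℝ) (w : W) (l : List X) :
    (sketchShuffle b u pub c₁ c₂ dec).shuffled w l
      = (messageNoise C (b ^ l.length) (u ^ l.length)
          * Conv.dirac (l.map (unitMsg (c₁ w) (c₂ w))).sum).law := by
  rw [← messageNoise_pow]
  induction l with
  | nil =>
    rw [ShuffleProtocol.shuffled.eq_def, List.length_nil, List.map_nil, List.sum_nil, pow_zero,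
      one_mul]
    rfl
  | cons x l ih =>
    rw [ShuffleProtocol.shuffled.eq_def]
    dsimp only
    rw [ih, List.map_cons, List.sum_cons, List.length_cons,
      Conv.dirac_add, pow_succ', mul_mul_mul_comm, Conv.law_mul]
    rfl

/-- A pair has net count zero, so blankets disappear from the analyzer's view, whatever their law,
and exactly the noise of the sketch remains. -/
theorem hom_netCount_messageNoise (p : Set.Ioo (0 : ℝ) 1) (u : Conv ℕ) :
    Conv.hom (netCount C) (messageNoise C (geo p) u) = noise C p := by
  rw [messageNoise, noise, map_prod]
  refine Finset.prod_congr rfl fun c _ => ?_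
  rw [cellNoise, lap, map_mul, map_mul, map_mul, Conv.hom_hom, Conv.hom_hom, Conv.hom_hom,
    Conv.hom_hom, Conv.hom_hom]
  have h0 : (netCount C).comp (multiplesHom _ {(c, true), (c, false)}) = 0 := by
    ext c'
    simp [netCount, Multiset.count_cons, Multiset.count_singleton]
  have h1 : (netCount C).comp (multiplesHom _ {(c, true)})
      = (AddMonoidHom.single (fun _ => ℤ) c).comp (Nat.castAddMonoidHom ℤ) := by
    ext c'
    by_cases h : c' = c <;> simp [netCount, h]
  have h2 : (netCount C).comp (multiplesHom _ {(c, false)})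
      = (AddMonoidHom.single (fun _ => ℤ) c).comp (-Nat.castAddMonoidHom ℤ) := by
    ext c'
    by_cases h : c' = c <;> simp [netCount, h]
  rw [h0, h1, h2, Conv.hom_zero, mul_one]

omit [Fintype C] in
theorem netCount_unitMsg (c₁ c₂ : X → C) (x : X) :
    netCount C (unitMsg c₁ c₂ x) = unitVec c₁ c₂ x := by
  ext c
  simp [netCount, unitMsg, unitVec, Multiset.count_cons, Multiset.count_singleton,
    Pi.single_apply, add_comm]

theorem sketchShuffle_run {p : Set.Ioo (0 : ℝ) 1} {n : ℕ} {b : Conv ℕ} (hb : b ^ n = geo p)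
    (u : Conv ℕ) (pub : PMF W) (c₁ c₂ : W → X → C) (dec : W → (C → ℤ) → ℝ) (S : Fin n → X) :
    (sketchShuffle b u pub c₁ c₂ dec).run S = sketchAnswer p pub c₁ c₂ dec (List.ofFn S) := by
  rw [ShuffleProtocol.run, sketchAnswer]
  congr 1
  funext (w : W)
  have hs := sketchShuffle_shuffled b u pub c₁ c₂ dec w (List.ofFn S)
  rw [List.length_ofFn, hb] at hs
  refine (congrArg (fun r : PMF (Multiset (C × Bool)) =>
    r.bind fun m => PMF.pure (dec w (netCount C m))) hs).trans ?_
  have h : sketch p (c₁ w) (c₂ w) (List.ofFn S) = Conv.hom (netCount C)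
      (messageNoise C (geo p) (u ^ n)
        * Conv.dirac ((List.ofFn S).map (unitMsg (c₁ w) (c₂ w))).sum) := by
    rw [map_mul, hom_netCount_messageNoise, Conv.hom_dirac, map_list_sum, List.map_map, sketch]
    congr 4
    funext x
    exact (netCount_unitMsg _ _ x).symm
  rw [h, Conv.law_hom, PMF.map_comp]
  rfl

theorem exists_blanket (a : ℝ≥0∞) (ha : a ≠ ∞) {δ : ℝ} (hδ : 0 < δ) :
    ∃ L : ℕ, a * (L + 1 : ℝ≥0∞)⁻¹ ≤ ENNReal.ofReal δ := by
  have hδ' : ENNReal.ofReal δ ≠ 0 := by simpa using hδ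
  obtain ⟨L, hL⟩ := ENNReal.exists_nat_gt (ENNReal.div_ne_top ha hδ')
  refine ⟨L, ?_⟩
  rw [← div_eq_mul_inv]
  refine ENNReal.div_le_of_le_mul ?_
  rw [ENNReal.div_lt_iff (Or.inl hδ') (Or.inl ENNReal.ofReal_ne_top)] at hL
  calc a ≤ L * ENNReal.ofReal δ := hL.le
    _ ≤ ENNReal.ofReal δ * (L + 1) := by rw [mul_comm]; gcongr; exact le_self_add

theorem exists_sketch_shuffle {q δ : ℝ} (hδ : 0 < δ) (p : Set.Ioo (0 : ℝ) 1)
    (hp : (p : ℝ) = Real.exp (-q)) {n : ℕ} (hn : n ≠ 0) (pub : PMF W) (c₁ c₂ : W → X → C)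
    (dec : W → (C → ℤ) → ℝ) :
    ∃ P : ShuffleProtocol X, P.IsShuffleDP n (4 * q) δ ∧
      ∀ S : Fin n → X, P.run S = sketchAnswer p pub c₁ c₂ dec (List.ofFn S) := by
  obtain ⟨b, hb⟩ := exists_geo_root p hn
  set a := ENNReal.ofReal (p : ℝ)⁻¹ with ha
  -- The factor is the coefficient of the blanket error in `messageNoise_close`.
  obtain ⟨L, hL⟩ := exists_blanket (a ^ 2 * (a + 1))
    (ENNReal.mul_ne_top (ENNReal.pow_ne_top ENNReal.ofReal_ne_top)
      (ENNReal.add_ne_top.2 ⟨ENNReal.ofReal_ne_top, ENNReal.one_ne_top⟩)) hδ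
  refine ⟨sketchShuffle b (blanket L) pub c₁ c₂ dec, fun w S S' h E => ?_, fun S =>
    sketchShuffle_run hb _ pub c₁ c₂ dec S⟩
  -- All users add blankets, but one of them already hides a pair; the other factors are carried
  -- along.
  have hu : Close 1 (L + 1 : ℝ≥0∞)⁻¹ (blanket L ^ n).law (blanket L ^ n * Conv.dirac 1).law := by
    obtain ⟨m, rfl⟩ := Nat.exists_eq_succ_of_ne_zero hn
    rw [pow_succ, mul_assoc]
    exact (blanket_close_shift L).mul_left _
  obtain ⟨i, r, h1, h2⟩ := exists_sum_ofFn_eq h (unitMsg (c₁ w) (c₂ w))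
  have hc := (messageNoise_close p hu (c₁ w (S i)) (c₂ w (S i)) (c₁ w (S' i))
    (c₂ w (S' i)) r).mono (b := ENNReal.ofReal (Real.exp (4 * q))) (e := ENNReal.ofReal δ)
    (by rw [hp, ofReal_inv_exp_pow_four]) (le_trans (le_of_eq (by rw [ha]; ring)) hL)
  have hs := sketchShuffle_shuffled b (blanket L) pub c₁ c₂ dec w
  have hS := hs (List.ofFn S)
  have hS' := hs (List.ofFn S')
  rw [List.length_ofFn, hb, h1] at hS
  rw [List.length_ofFn, hb, h2] at hS'
  have h' := hc E
  rw [unitMsg] at hS hS'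
  rw [← hS, ← hS'] at h'
  exact h'

end Sketch

end

section

/-! ### Distance of anonymized histograms -/

/-- The number of elements of `[k]` that occur at least `v` times in the dataset. -/
def tailCount {k n : ℕ} (S : Fin n → Fin k) (v : ℕ) : ℕ :=
  (Finset.univ.filter fun j => v ≤ histogram S j).card

/-- The distance between the anonymized histograms of two datasets. -/
def anonDist {k n : ℕ} (S S' : Fin n → Fin k) : ℝ :=
  ∑ v ∈ Finset.range n, |(tailCount S (v + 1) : ℝ) - tailCount S' (v + 1)|

variable {k n : ℕ}

theorem sum_histogram (S : Fin n → Fin k) : ∑ j, histogram S j = n := by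
  have := Finset.card_eq_sum_card_fiberwise (f := S) (s := Finset.univ) (t := Finset.univ)
    (fun _ _ => Finset.mem_univ _)
  simpa [histogram] using this.symm

theorem histogram_le (S : Fin n → Fin k) (j : Fin k) : histogram S j ≤ n := by
  have := Finset.card_le_univ (Finset.univ.filter fun i => S i = j)
  simpa [histogram] using this

theorem histogram_update (S : Fin n → Fin k) (i : Fin n) (l x : Fin k) :
    histogram (Function.update S i l) x + (if S i = x then 1 else 0)
      = histogram S x + if l = x then 1 else 0 := by
  simp only [histogram, Finset.card_filter]
  rw [← Finset.add_sum_erase _ _ (Finset.mem_univ i),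
    ← Finset.add_sum_erase (Finset.univ) (fun j => if S j = x then 1 else 0) (Finset.mem_univ i),
    Function.update_self, Finset.sum_congr (s₁ := Finset.univ.erase i) rfl fun j hj => by
      rw [Function.update_of_ne (Finset.ne_of_mem_erase hj)]]
  ring

theorem histogram_comp_perm (S : Fin n → Fin k) (σ : Equiv.Perm (Fin k)) (j : Fin k) :
    histogram (σ.symm ∘ S) j = histogram S (σ j) := by
  simp only [histogram, Function.comp_apply, Equiv.symm_apply_eq]

theorem anonHistogram_comp_perm (S : Fin n → Fin k) (σ : Equiv.Perm (Fin k)) :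
    anonHistogram (σ.symm ∘ S) = anonHistogram S := by
  have h : histogram (σ.symm ∘ S) = histogram S ∘ σ := funext (histogram_comp_perm S σ)
  rw [anonHistogram, anonHistogram, h, ← Multiset.map_map, Multiset.map_univ_val_equiv]

theorem tailCount_comp_perm (S : Fin n → Fin k) (σ : Equiv.Perm (Fin k)) (v : ℕ) :
    tailCount (σ.symm ∘ S) v = tailCount S v := by
  simp only [tailCount, histogram_comp_perm]
  rw [← Fintype.card_subtype, ← Fintype.card_subtype]
  exact Fintype.card_congr (σ.subtypeEquiv fun _ => Iff.rfl)

theorem Estimator.abs_sub_le_sensitivity (g : Estimator k) {S S' : Fin n → Fin k}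
    (h : Neighboring S S') : |g n S - g n S'| ≤ g.sensitivity n := by
  refine le_csInf ⟨∑ T, ∑ T', |g n T - g n T'|, by positivity, fun T T' _ => ?_⟩
    fun Δ hΔ => hΔ.2 S S' h
  exact (Finset.single_le_sum (f := fun T' => |g n T - g n T'|) (fun _ _ => abs_nonneg _)
    (Finset.mem_univ T')).trans (Finset.single_le_sum (f := fun T => ∑ T', |g n T - g n T'|)
    (fun _ _ => by positivity) (Finset.mem_univ T))

theorem Estimator.sensitivity_nonneg (g : Estimator k) (n : ℕ) : 0 ≤ g.sensitivity n :=
  Real.sInf_nonneg fun _ h => h.1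

/-- The truncated differences add up to the surplus of `S` over `S'`, the number of points that must
be relabeled. As the totals agree, a surplus at some `j` forces a deficit at some `l`; changing one
point from `j` to `l` lowers the surplus by one and costs one sensitivity. -/
theorem Estimator.abs_sub_le_of_histogram (g : Estimator k) (hg : g.IsSymmetric) (N : ℕ) :
    ∀ S S' : Fin n → Fin k, ∑ j, (histogram S j - histogram S' j) = N →
      |g n S - g n S'| ≤ g.sensitivity n * N := by
  induction N with
  | zero =>
    intro S S' h
    have hle : ∀ j ∈ Finset.univ, histogram S j ≤ histogram S' j := fun j hj =>
      Nat.sub_eq_zero_iff_le.1 ((Finset.sum_eq_zero_iff.1 h) j hj)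
    have heq := (Finset.sum_eq_sum_iff_of_le hle).1 ((sum_histogram S).trans (sum_histogram S').symm)
    have : anonHistogram S = anonHistogram S' := by
      rw [anonHistogram, anonHistogram, funext fun j => heq j (Finset.mem_univ j)]
    rw [hg n S S' this]
    simp
  | succ N ih =>
    intro S S' h
    obtain ⟨j, hj⟩ : ∃ j, histogram S' j < histogram S j := by
      by_contra! hcon
      rw [Finset.sum_eq_zero fun j _ => Nat.sub_eq_zero_of_le (hcon j)] at h
      omega
    obtain ⟨l, hl⟩ : ∃ l, histogram S l < histogram S' l := by
      by_contra! hcon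
      have := Finset.sum_lt_sum (fun l (_ : l ∈ Finset.univ) => hcon l) ⟨j, Finset.mem_univ j, hj⟩
      rw [sum_histogram, sum_histogram] at this
      omega
    obtain ⟨i, hi⟩ : ∃ i, S i = j := by
      have : 0 < (Finset.univ.filter fun i => S i = j).card := by
        change 0 < histogram S j
        omega
      obtain ⟨i, hi⟩ := Finset.card_pos.1 this
      exact ⟨i, (Finset.mem_filter.1 hi).2⟩
    have hjl : j ≠ l := by
      rintro rfl
      omega
    have hstep : ∀ x, (histogram (Function.update S i l) x - histogram S' x)
        + (if j = x then 1 else 0) = histogram S x - histogram S' x := by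
      intro x
      have := histogram_update S i l x
      rw [hi] at this
      by_cases h1 : j = x
      · subst h1
        rw [if_pos rfl, if_neg hjl.symm] at this
        rw [if_pos rfl]
        omega
      · by_cases h2 : l = x
        · subst h2
          rw [if_neg h1, if_pos rfl] at this
          rw [if_neg h1]
          omega
        · rw [if_neg h1, if_neg h2] at this
          rw [if_neg h1]
          omega
    have hN : ∑ x, (histogram (Function.update S i l) x - histogram S' x) = N := by
      have := Finset.sum_congr rfl fun x (_ : x ∈ Finset.univ) => hstep x
      rw [Finset.sum_add_distrib, h] at this
      simpa using this
    have h1 : |g n S - g n (Function.update S i l)| ≤ g.sensitivity n :=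
      g.abs_sub_le_sensitivity ⟨i, fun x hx => (Function.update_of_ne hx _ _).symm⟩
    have h2 := ih _ _ hN
    calc |g n S - g n S'| ≤ |g n S - g n (Function.update S i l)|
          + |g n (Function.update S i l) - g n S'| := abs_sub_le _ _ _
      _ ≤ g.sensitivity n + g.sensitivity n * N := add_le_add h1 h2
      _ = _ := by push_cast; ring

/-- Count the pairs `(j, v)` with `b j ≤ v < a j` level by level. For monotone sequences superlevel
sets are final segments, hence nested, so each level contributes at most the truncated difference of
their sizes. Sorting thus realizes the transport cost given by the tail counts. -/
theorem sum_sub_le_of_monotone {a b : Fin k → ℕ} (ha : Monotone a) (hb : Monotone b)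
    (han : ∀ j, a j ≤ n) :
    ∑ j, (a j - b j) ≤ ∑ v ∈ Finset.range n,
      ((Finset.univ.filter fun j => v + 1 ≤ a j).card
        - (Finset.univ.filter fun j => v + 1 ≤ b j).card) := by
  have h1 : ∀ j, a j - b j = ∑ v ∈ Finset.range n, if b j ≤ v ∧ v < a j then 1 else 0 := by
    intro j
    rw [← Finset.card_filter, ← Nat.card_Ico]
    congr 1
    ext v
    have := han j
    simp only [Finset.mem_Ico, Finset.mem_filter, Finset.mem_range]
    omega
  rw [Finset.sum_congr rfl fun j _ => h1 j, Finset.sum_comm]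
  refine Finset.sum_le_sum fun v _ => ?_
  rw [← Finset.card_filter]
  by_cases hsub : ∀ j, v + 1 ≤ b j → v + 1 ≤ a j
  · rw [← Finset.card_sdiff_of_subset fun j => by simpa using hsub j]
    refine Finset.card_le_card fun j => ?_
    simp only [Finset.mem_filter, Finset.mem_univ, true_and, Finset.mem_sdiff]
    omega
  · push Not at hsub
    obtain ⟨j₀, hj₀, hj₀'⟩ := hsub
    rw [Finset.card_eq_zero.2]
    · exact Nat.zero_le _
    · refine Finset.filter_eq_empty_iff.2 fun j _ hj => ?_
      rcases le_total j j₀ with h | h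
      · have := ha h
        omega
      · have := hb h
        omega

theorem Estimator.abs_sub_le_anonDist (g : Estimator k) (hg : g.IsSymmetric)
    (S S' : Fin n → Fin k) : |g n S - g n S'| ≤ g.sensitivity n * anonDist S S' := by
  set σ := Tuple.sort (histogram S) with hσ
  set σ' := Tuple.sort (histogram S') with hσ'
  -- Symmetry allows each dataset to be relabeled separately so that its histogram is sorted.
  rw [← hg n _ _ (anonHistogram_comp_perm S σ), ← hg n _ _ (anonHistogram_comp_perm S' σ')]
  refine (g.abs_sub_le_of_histogram hg _ _ _ rfl).trans ?_
  refine mul_le_mul_of_nonneg_left ?_ (g.sensitivity_nonneg n)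
  have hmono : ∀ T : Fin n → Fin k, Monotone
      (histogram ((Tuple.sort (histogram T)).symm ∘ T)) := fun T => by
    rw [show histogram ((Tuple.sort (histogram T)).symm ∘ T)
      = histogram T ∘ Tuple.sort (histogram T) from funext (histogram_comp_perm T _)]
    exact Tuple.monotone_sort _
  have h := sum_sub_le_of_monotone (hmono S) (hmono S') (histogram_le _)
  refine (Nat.cast_le.2 h).trans ?_
  rw [Nat.cast_sum, anonDist]
  refine Finset.sum_le_sum fun v _ => ?_
  change ((tailCount (σ.symm ∘ S) (v + 1) - tailCount (σ'.symm ∘ S') (v + 1) : ℕ) : ℝ) ≤ _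
  rw [tailCount_comp_perm, tailCount_comp_perm]
  rcases le_total (tailCount S (v + 1)) (tailCount S' (v + 1)) with h | h
  · rw [Nat.sub_eq_zero_of_le h]
    simp
  · rw [Nat.cast_sub h]
    exact le_abs_self _

theorem sum_tailCount (S : Fin n → Fin k) :
    ∑ v ∈ Finset.range n, tailCount S (v + 1) = n := by
  have h : ∀ j, histogram S j = ∑ v ∈ Finset.range n, if v + 1 ≤ histogram S j then 1 else 0 := by
    intro j
    rw [← Finset.card_filter]
    nth_rw 1 [← Finset.card_range (histogram S j)]
    congr 1
    ext v
    have := histogram_le S j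
    simp only [Finset.mem_filter, Finset.mem_range]
    omega
  refine Eq.trans ?_ (sum_histogram S)
  rw [Finset.sum_congr rfl fun j _ => h j, Finset.sum_comm]
  simp only [tailCount, Finset.card_filter]

/-- For a single point the only tail count equals 1. This case matters because `errBound` vanishes
for `n ≤ 1`, so the sensitivity is not controlled there. -/
theorem anonDist_eq_zero_of_le_one (hn : n ≤ 1) (S S' : Fin n → Fin k) : anonDist S S' = 0 := by
  have h := sum_tailCount S
  have h' := sum_tailCount S'
  interval_cases n
  · simp [anonDist]
  · simp only [Finset.sum_range_one] at h h'
    simp [anonDist, h, h']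

end

section

open MeasureTheory ProbabilityTheory

/-! ### The noise as a measure -/

theorem Conv.toMeasure_mul {M : Type*} [AddCommMonoid M] [MeasurableSpace M] [Countable M]
    [MeasurableSingletonClass M] (p q : Conv M) :
    (p * q).law.toMeasure = (p.law.toMeasure.prod q.law.toMeasure).map fun x => x.1 + x.2 := by
  ext E hE
  rw [Measure.map_apply Measurable.of_discrete hE, Measure.prod_apply (Measurable.of_discrete hE),
    lintegral_countable', Conv.law_mul, PMF.toMeasure_bind_apply _ _ _ hE]
  refine tsum_congr fun a => ?_
  rw [PMF.toMeasure_apply_singleton _ _ (measurableSet_singleton a), mul_comm]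
  congr 1
  change (q.law.map fun b => a + b).toMeasure E = _
  rw [PMF.toMeasure_map_apply _ _ _ Measurable.of_discrete hE]
  rfl

theorem Conv.toMeasure_hom {M N : Type*} [AddCommMonoid M] [AddCommMonoid N]
    [MeasurableSpace M] [MeasurableSpace N] [Countable M] [MeasurableSingletonClass M]
    (f : M →+ N) (p : Conv M) : (Conv.hom f p).law.toMeasure = p.law.toMeasure.map f :=
  (PMF.toMeasure_map (f := f) p.law Measurable.of_discrete).symm

/-- Used with `s` the set of all cells, it identifies the convolution of one-cell noises with the
product law; the condition off `s` is for the induction. -/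
theorem prod_hom_single_law_apply {C : Type} [Fintype C] [DecidableEq C] (q : C → Conv ℤ)
    (s : Finset C) (y : C → ℤ) :
    (∏ c ∈ s, Conv.hom (AddMonoidHom.single (fun _ => ℤ) c) (q c)).law y
      = if ∀ c ∉ s, y c = 0 then ∏ c ∈ s, (q c).law (y c) else 0 := by
  induction s using Finset.induction_on generalizing y with
  | empty =>
    simp [Conv.law_one, PMF.pure_apply, funext_iff]
  | insert c s hc ih =>
    rw [Finset.prod_insert hc, Conv.law_mul, Conv.law_hom, PMF.bind_map, PMF.bind_apply]
    have h1 : ∀ t : ℤ, ((fun a => PMF.bind (∏ c ∈ s, Conv.hom (AddMonoidHom.single (fun _ => ℤ) c)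
        (q c)).law fun b => PMF.pure (a + b)) ∘ (AddMonoidHom.single (fun _ => ℤ) c)) t y
        = if ∀ c' ∉ s, (y - Pi.single c t : C → ℤ) c' = 0 then ∏ c ∈ s, (q c).law (y c) else 0 := by
      intro t
      rw [Function.comp_apply, PMF.bind_apply,
        tsum_eq_single (y - Pi.single c t) fun b hb => by
          rw [PMF.pure_apply, if_neg, mul_zero]
          rintro rfl
          apply hb
          simp, ih]
      have h2 : ∏ c' ∈ s, (q c').law ((y - Pi.single c t : C → ℤ) c') = ∏ c ∈ s, (q c).law (y c) :=
        Finset.prod_congr rfl fun c' hc' => by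
          have : c' ≠ c := fun h => hc (h ▸ hc')
          simp [this]
      rw [h2]
      simp [PMF.pure_apply]
    rw [tsum_eq_single (y c) fun t ht => by
      rw [h1, if_neg, mul_zero]
      intro h
      have := h c hc
      simp at this
      omega]
    rw [h1, Finset.prod_insert hc, mul_ite, mul_zero]
    congr 1
    apply propext
    constructor
    · intro h c' hc'
      rw [Finset.mem_insert, not_or] at hc'
      simpa [hc'.1] using h c' hc'.2
    · intro h c' hc'
      by_cases hcc : c' = c
      · subst hcc
        simp
      · simpa [hcc] using h c' (by simp [hcc, hc'])

/-- The two-sided geometric law as a measure. -/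
abbrev lapMeasure (p : Set.Ioo (0 : ℝ) 1) : Measure ℤ := (lap p).law.toMeasure

theorem noise_toMeasure (C : Type) [Fintype C] [DecidableEq C] (p : Set.Ioo (0 : ℝ) 1) :
    (noise C p).law.toMeasure = Measure.pi fun _ => lapMeasure p := by
  refine Measure.ext_of_singleton fun y => ?_
  rw [PMF.toMeasure_apply_singleton _ _ (measurableSet_singleton y), ← Set.univ_pi_singleton,
    Measure.pi_pi, noise, prod_hom_single_law_apply]
  simp [PMF.toMeasure_apply_singleton]

theorem integrable_of_norm_le {α E : Type*} [MeasurableSpace α] [Countable α]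
    [MeasurableSingletonClass α] [NormedAddCommGroup E] {μ : Measure α} [IsFiniteMeasure μ]
    {F : α → E} {B : ℝ} (hF : ∀ x, ‖F x‖ ≤ B) : Integrable F μ :=
  Integrable.of_bound StronglyMeasurable.of_discrete.aestronglyMeasurable B (ae_of_all _ hF)

/-! ### Deconvolution of the two-sided geometric law -/

theorem geo_toMeasure (p : Set.Ioo (0 : ℝ) 1) :
    (geo p).law.toMeasure = ENNReal.ofReal (1 - p) • Measure.dirac 0
      + ENNReal.ofReal p • (geo p).law.toMeasure.map (· + 1) := by
  refine Measure.ext_of_singleton fun k => ?_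
  have hp := p.2.1
  have hp' := p.2.2
  rw [Measure.add_apply, Measure.smul_apply, Measure.smul_apply,
    Measure.map_apply Measurable.of_discrete (measurableSet_singleton k),
    PMF.toMeasure_apply_singleton _ _ (measurableSet_singleton k), geo_law_apply]
  cases k with
  | zero =>
    have : (fun x : ℕ => x + 1) ⁻¹' {0} = ∅ := by ext; simp
    simp [this]
  | succ k =>
    have : (fun x : ℕ => x + 1) ⁻¹' {k + 1} = {k} := by ext; simp
    rw [this, PMF.toMeasure_apply_singleton _ _ (measurableSet_singleton k), geo_law_apply]
    simp only [smul_eq_mul]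
    rw [← ENNReal.ofReal_mul hp.le]
    simp
    congr 1
    ring

theorem integral_geo (p : Set.Ioo (0 : ℝ) 1) {F : ℕ → ℂ} {B : ℝ} (hF : ∀ x, ‖F x‖ ≤ B) :
    ∫ g, F g ∂(geo p).law.toMeasure
      = (1 - p) * F 0 + p * ∫ g, F (g + 1) ∂(geo p).law.toMeasure := by
  have hp := p.2.1
  have hp' := p.2.2
  conv_lhs => rw [geo_toMeasure]
  rw [integral_add_measure, integral_smul_measure, integral_smul_measure, integral_dirac,
    integral_map Measurable.of_discrete.aemeasurable
      StronglyMeasurable.of_discrete.aestronglyMeasurable,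
    ENNReal.toReal_ofReal (by linarith), ENNReal.toReal_ofReal hp.le]
  · simp
  · exact (integrable_of_norm_le hF).smul_measure ENNReal.ofReal_ne_top
  · have : IsFiniteMeasure ((geo p).law.toMeasure.map (· + 1)) := inferInstance
    exact (integrable_of_norm_le hF).smul_measure ENNReal.ofReal_ne_top

theorem lapMeasure_eq (p : Set.Ioo (0 : ℝ) 1) :
    lapMeasure p = ((geo p).law.toMeasure.prod (geo p).law.toMeasure).map
      fun x => (x.1 : ℤ) - x.2 := by
  rw [lapMeasure, lap, Conv.toMeasure_mul, Conv.toMeasure_hom, Conv.toMeasure_hom,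
    Measure.map_prod_map _ _ Measurable.of_discrete Measurable.of_discrete,
    Measure.map_map Measurable.of_discrete Measurable.of_discrete]
  congr 1

theorem integral_lap_eq (p : Set.Ioo (0 : ℝ) 1) {F : ℤ → ℂ} {B : ℝ} (hF : ∀ x, ‖F x‖ ≤ B) :
    ∫ t, F t ∂lapMeasure p
      = ∫ b, ∫ a, F ((a : ℤ) - b) ∂(geo p).law.toMeasure ∂(geo p).law.toMeasure := by
  rw [lapMeasure_eq, integral_map Measurable.of_discrete.aemeasurable
    StronglyMeasurable.of_discrete.aestronglyMeasurable, integral_prod_symm]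
  exact integrable_of_norm_le fun x => hF _

/-- The variance parameter `p / (1 - p) ^ 2` of the two-sided geometric law. -/
def kap (p : Set.Ioo (0 : ℝ) 1) : ℝ := p / (1 - p) ^ 2

/-- Averaging over the noise is inverted by `1 - κ Δ`, where `Δ` is the second difference and `κ =
kap p`. Each geometric law satisfies a first-order recursion, being 0 with probability `1 - p` and
otherwise one more than a copy of itself; composing the recursions of the two signs gives a
second-order equation. -/
theorem integral_lap_deconv (p : Set.Ioo (0 : ℝ) 1) {F : ℤ → ℂ} {B : ℝ} (hF : ∀ x, ‖F x‖ ≤ B)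
    (x : ℤ) :
    ∫ t, (F (x + t) - kap p * (F (x + t + 1) - 2 * F (x + t) + F (x + t - 1))) ∂lapMeasure p
      = F x := by
  have hp := p.2.1
  have hp' := p.2.2
  set G := (geo p).law.toMeasure
  set A : ℤ → ℂ := fun x => ∫ a : ℕ, F (x + a) ∂G with hA
  set Φ : ℤ → ℂ := fun x => ∫ t, F (x + t) ∂lapMeasure p with hΦ
  have hAB : ∀ x, ‖A x‖ ≤ B := fun x => by
    refine (norm_integral_le_of_norm_le_const (ae_of_all _ fun a => hF _)).trans ?_
    simp
  have hA1 : ∀ x, A x = (1 - p) * F x + p * A (x + 1) := fun x => by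
    have := integral_geo p (F := fun a => F (x + a)) fun a => hF _
    simp only [hA]
    refine this.trans ?_
    simp [G, add_comm, add_left_comm]
  have hΦA : ∀ x, Φ x = ∫ b : ℕ, A (x - b) ∂G := fun x => by
    simp only [hΦ, hA]
    rw [integral_lap_eq p (F := fun t => F (x + t)) fun a => hF _]
    congr! 5 with b a
    ring
  have hΦ1 : ∀ x, Φ x = (1 - p) * A x + p * Φ (x - 1) := fun x => by
    rw [hΦA, hΦA]
    have := integral_geo p (F := fun b => A (x - b)) fun a => hAB _
    refine this.trans ?_
    simp [G, sub_sub, add_comm]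
  -- Since `1 + p ^ 2 = (1 - p) ^ 2 + 2 p`, dividing by `(1 - p) ^ 2` turns this into `Φ - κ Δ Φ =
  -- F`.
  have hmain : (1 + (p : ℂ) ^ 2) * Φ x - p * (Φ (x + 1) + Φ (x - 1)) = (1 - p) ^ 2 * F x := by
    have e1 := hΦ1 x
    have e2 := hΦ1 (x + 1)
    rw [add_sub_cancel_right] at e2
    have e3 := hA1 x
    linear_combination e1 - p * e2 + (1 - (p : ℂ)) * e3
  have hint : ∀ y : ℤ, Integrable (fun t => F (y + t)) (lapMeasure p) := fun y =>
    integrable_of_norm_le fun t => hF _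
  have hsplit : ∫ t, (F (x + t) - kap p * (F (x + t + 1) - 2 * F (x + t) + F (x + t - 1)))
      ∂lapMeasure p = Φ x - kap p * (Φ (x + 1) - 2 * Φ x + Φ (x - 1)) := by
    have h1 : ∀ t, F (x + t + 1) = F (x + 1 + t) := fun t => by congr 1; ring
    have h2 : ∀ t, F (x + t - 1) = F (x - 1 + t) := fun t => by congr 1; ring
    simp only [h1, h2]
    have i1 : Integrable (fun t => F (x + 1 + t) - 2 * F (x + t)) (lapMeasure p) :=
      (hint _).sub ((hint x).const_mul 2)
    have i2 : Integrable (fun t => F (x + 1 + t) - 2 * F (x + t) + F (x - 1 + t)) (lapMeasure p) :=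
      i1.add (hint _)
    rw [integral_sub (hint x) (i2.const_mul _), integral_const_mul, integral_add i1 (hint _),
      integral_sub (hint _) ((hint x).const_mul 2), integral_const_mul]
  rw [hsplit, kap]
  have hne : (1 - (p : ℂ)) ≠ 0 := by
    rw [← Complex.ofReal_one, ← Complex.ofReal_sub, Complex.ofReal_ne_zero]
    linarith
  push_cast
  field_simp
  linear_combination hmain

theorem kap_nonneg (p : Set.Ioo (0 : ℝ) 1) : 0 ≤ kap p := by
  have hp := p.2.1
  rw [kap]
  positivity

/-- Here `κ = 1 / (4 sinh² (q / 2))`, and `sinh x ≥ x` for `x ≥ 0`. -/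
theorem kap_le {q : ℝ} (hq : 0 < q) (p : Set.Ioo (0 : ℝ) 1) (hp : (p : ℝ) = Real.exp (-q)) :
    kap p ≤ 1 / q ^ 2 := by
  have h1 : 0 < 1 - (p : ℝ) := by linarith [p.2.2]
  have h0 := p.2.1
  rw [kap, div_le_div_iff₀ (by positivity) (by positivity)]
  have hs : Real.exp (-q / 2) ^ 2 = p := by rw [hp, ← Real.exp_nat_mul]; congr 1; push_cast; ring
  have h2 : q * Real.exp (-q / 2) ≤ 1 - p := by
    have h3 : q ≤ Real.exp (q / 2) - Real.exp (-q / 2) := by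
      have := Real.self_le_sinh_iff.2 (by linarith : 0 ≤ q / 2)
      rw [Real.sinh_eq, ← neg_div] at this
      linarith
    have h4 : Real.exp (q / 2) * Real.exp (-q / 2) = 1 := by
      rw [← Real.exp_add]; ring_nf; exact Real.exp_zero
    nlinarith [Real.exp_pos (-q / 2)]
  calc (p : ℝ) * q ^ 2 = (q * Real.exp (-q / 2)) ^ 2 := by rw [mul_pow, hs]; ring
    _ ≤ (1 - (p : ℝ)) ^ 2 := by gcongr
    _ = _ := (one_mul _).symm

/-- With `s = exp (-q / 2)` the integral is `∑ (1 - s ^ 2) s ^ g = 1 + s`. Half of the decay rate is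
kept, so the bound does not depend on `q`. -/
theorem lintegral_geo_exp {q : ℝ} (p : Set.Ioo (0 : ℝ) 1) (hp : (p : ℝ) = Real.exp (-q)) :
    ∫⁻ g : ℕ, ENNReal.ofReal (Real.exp (q / 2 * g)) ∂(geo p).law.toMeasure ≤ 2 := by
  have hq : 0 < q := by
    have := p.2.2
    rw [hp, Real.exp_lt_one_iff] at this
    linarith
  set s := Real.exp (-q / 2) with hs
  have hs1 : s < 1 := by rw [hs, Real.exp_lt_one_iff]; linarith
  have hs0 : 0 < s := Real.exp_pos _
  have hps : (p : ℝ) = s ^ 2 := by rw [hp, hs, ← Real.exp_nat_mul]; congr 1; push_cast; ring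
  have hterm : ∀ g : ℕ, ENNReal.ofReal (Real.exp (q / 2 * g)) * (geo p).law.toMeasure {g}
      = ENNReal.ofReal ((1 - s ^ 2) * s ^ g) := fun g => by
    rw [PMF.toMeasure_apply_singleton _ _ (measurableSet_singleton g), geo_law_apply,
      ← ENNReal.ofReal_mul (Real.exp_pos _).le]
    congr 1
    have : Real.exp (q / 2 * g) * (p : ℝ) ^ g = s ^ g := by
      rw [hps, hs, ← Real.exp_nat_mul, ← Real.exp_nat_mul, ← Real.exp_nat_mul, ← Real.exp_add]
      congr 1
      push_cast
      ring
    rw [← this, hps]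
    ring
  rw [lintegral_countable', tsum_congr hterm, ← ENNReal.ofReal_tsum_of_nonneg
    (fun g => mul_nonneg (by nlinarith) (by positivity))
    ((summable_geometric_of_lt_one hs0.le hs1).mul_left _), tsum_mul_left,
    tsum_geometric_of_lt_one hs0.le hs1]
  refine ENNReal.ofReal_le_of_le_toReal ?_
  rw [← div_eq_mul_inv, div_le_iff₀ (by linarith)]
  simp only [ENNReal.toReal_ofNat]
  nlinarith

theorem lintegral_lap_exp {q : ℝ} (p : Set.Ioo (0 : ℝ) 1) (hp : (p : ℝ) = Real.exp (-q)) :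
    ∫⁻ t : ℤ, ENNReal.ofReal (Real.exp (q / 2 * |(t : ℝ)|)) ∂lapMeasure p ≤ 4 := by
  have hq : 0 < q := by
    have := p.2.2
    rw [hp, Real.exp_lt_one_iff] at this
    linarith
  rw [lapMeasure_eq, lintegral_map Measurable.of_discrete Measurable.of_discrete]
  calc _ ≤ ∫⁻ x : ℕ × ℕ, ENNReal.ofReal (Real.exp (q / 2 * x.1))
        * ENNReal.ofReal (Real.exp (q / 2 * x.2))
        ∂((geo p).law.toMeasure.prod (geo p).law.toMeasure) := by
        refine lintegral_mono fun x => ?_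
        rw [← ENNReal.ofReal_mul (Real.exp_pos _).le, ← Real.exp_add, ← mul_add]
        refine ENNReal.ofReal_le_ofReal (Real.exp_le_exp.2 ?_)
        refine mul_le_mul_of_nonneg_left ?_ (by linarith)
        push_cast
        refine (abs_sub _ _).trans ?_
        rw [Nat.abs_cast, Nat.abs_cast]
    _ = (∫⁻ g : ℕ, ENNReal.ofReal (Real.exp (q / 2 * g)) ∂(geo p).law.toMeasure)
        * ∫⁻ g : ℕ, ENNReal.ofReal (Real.exp (q / 2 * g)) ∂(geo p).law.toMeasure :=
        lintegral_prod_mul (f := fun g : ℕ => ENNReal.ofReal (Real.exp (q / 2 * g)))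
          (g := fun g : ℕ => ENNReal.ofReal (Real.exp (q / 2 * g)))
          Measurable.of_discrete.aemeasurable Measurable.of_discrete.aemeasurable
    _ ≤ 2 * 2 := by gcongr <;> exact lintegral_geo_exp p hp
    _ = 4 := by norm_num

/-- Variances of independent centered variables add: mixed terms factor and vanish. -/
theorem integral_norm_sq_sum_pi {C : Type} [Fintype C] [DecidableEq C] (μ : Measure ℤ)
    [IsProbabilityMeasure μ] {u : C → ℤ → ℂ} {B : ℝ} (hB : ∀ c t, ‖u c t‖ ≤ B)
    (h0 : ∀ c, ∫ t, u c t ∂μ = 0) :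
    ∫ y, ‖∑ c, u c (y c)‖ ^ 2 ∂(Measure.pi fun _ : C => μ) = ∑ c, ∫ t, ‖u c t‖ ^ 2 ∂μ := by
  set P := Measure.pi fun _ : C => μ
  have hoff : ∀ c c', c' ≠ c →
      ∫ y, u c (y c) * (starRingEnd ℂ) (u c' (y c')) ∂P = 0 := by
    intro c c' hcc
    have hind := (iIndepFun_pi (μ := fun _ : C => μ) (X := fun c t => u c t) fun c =>
      Measurable.of_discrete.aemeasurable).indepFun hcc.symm
    have hind' := hind.comp (φ := id) (ψ := starRingEnd ℂ) measurable_id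
      Complex.continuous_conj.measurable
    have := hind'.integral_fun_mul_eq_mul_integral
      StronglyMeasurable.of_discrete.aestronglyMeasurable
      StronglyMeasurable.of_discrete.aestronglyMeasurable
    simp only [Function.comp_apply, id_eq] at this
    refine this.trans ?_
    rw [integral_comp_eval (μ := fun _ : C => μ) (i := c) (f := u c)
      StronglyMeasurable.of_discrete.aestronglyMeasurable, h0, zero_mul]
  have hdiag : ∀ c, ∫ y, u c (y c) * (starRingEnd ℂ) (u c (y c)) ∂P
      = ((∫ t, ‖u c t‖ ^ 2 ∂μ : ℝ) : ℂ) := by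
    intro c
    rw [← integral_complex_ofReal]
    rw [integral_comp_eval (μ := fun _ : C => μ) (i := c)
      (f := fun t => u c t * (starRingEnd ℂ) (u c t))
      StronglyMeasurable.of_discrete.aestronglyMeasurable]
    simp only [Complex.mul_conj']
    push_cast
    rfl
  have hcomplex : ((∫ y, ‖∑ c, u c (y c)‖ ^ 2 ∂P : ℝ) : ℂ)
      = ((∑ c, ∫ t, ‖u c t‖ ^ 2 ∂μ : ℝ) : ℂ) := by
    rw [← integral_complex_ofReal]
    have : ∀ y : C → ℤ, ((‖∑ c, u c (y c)‖ ^ 2 : ℝ) : ℂ)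
        = ∑ c, ∑ c', u c (y c) * (starRingEnd ℂ) (u c' (y c')) := fun y => by
      push_cast
      rw [← Complex.mul_conj', map_sum, Finset.sum_mul_sum]
    have hi : ∀ c c', Integrable (fun y : C → ℤ => u c (y c) * (starRingEnd ℂ) (u c' (y c'))) P :=
      fun c c' => integrable_of_norm_le (B := B * B) fun y => by
        rw [norm_mul, RCLike.norm_conj]
        exact mul_le_mul (hB _ _) (hB _ _) (norm_nonneg _) ((norm_nonneg _).trans (hB c (y c)))
    simp only [this]
    rw [integral_finsetSum _ fun c _ => integrable_finsetSum _ fun c' _ => hi c c']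
    push_cast
    refine Finset.sum_congr rfl fun c _ => ?_
    rw [integral_finsetSum _ fun c' _ => hi c c',
      Finset.sum_eq_single_of_mem c (Finset.mem_univ c) fun c' _ hcc => hoff c c' hcc, hdiag]
  exact_mod_cast hcomplex

end

section

open MeasureTheory

/-! ### Fourier analysis on roots of unity -/

/-- The standard primitive `n`-th root of unity. -/
def zeta (n : ℕ) : ℂ := Complex.exp (2 * Real.pi * Complex.I / n)

theorem zeta_primitive {n : ℕ} (hn : n ≠ 0) : IsPrimitiveRoot (zeta n) n :=
  Complex.isPrimitiveRoot_exp n hn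

theorem norm_zeta_pow {n : ℕ} (hn : n ≠ 0) (t : ℕ) : ‖zeta n ^ t‖ = 1 := by
  rw [norm_pow, (zeta_primitive hn).norm'_eq_one hn, one_pow]

theorem parseval {n : ℕ} (hn : n ≠ 0) (b : ℕ → ℂ) :
    ∑ t ∈ Finset.range n, ‖∑ v ∈ Finset.range n, b v * (zeta n ^ t) ^ v‖ ^ 2
      = n * ∑ v ∈ Finset.range n, ‖b v‖ ^ 2 := by
  have hz := zeta_primitive hn
  have hz0 : zeta n ≠ 0 := hz.ne_zero hn
  have hconj : (starRingEnd ℂ) (zeta n) = (zeta n)⁻¹ :=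
    (Complex.inv_eq_conj (hz.norm'_eq_one hn)).symm
  have horth : ∀ v ∈ Finset.range n, ∀ v' ∈ Finset.range n, v' ≠ v →
      ∑ t ∈ Finset.range n, (zeta n ^ v * ((zeta n)⁻¹) ^ v') ^ t = 0 := by
    intro v hv v' hv' hne
    set w := zeta n ^ v * ((zeta n)⁻¹) ^ v' with hw
    have hw1 : w ≠ 1 := by
      intro h
      rw [hw, inv_pow, ← div_eq_mul_inv, div_eq_one_iff_eq (pow_ne_zero _ hz0)] at h
      exact hne (hz.pow_inj (Finset.mem_range.1 hv) (Finset.mem_range.1 hv') h).symm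
    have hwn : w ^ n = 1 := by
      rw [hw, mul_pow, ← pow_mul, ← pow_mul, mul_comm v, mul_comm v', pow_mul, pow_mul, inv_pow,
        hz.pow_eq_one]
      simp
    rw [geom_sum_eq hw1, hwn, sub_self, zero_div]
  have key : (∑ t ∈ Finset.range n, ((‖∑ v ∈ Finset.range n, b v * (zeta n ^ t) ^ v‖ ^ 2 : ℝ) : ℂ))
      = n * ∑ v ∈ Finset.range n, ((‖b v‖ ^ 2 : ℝ) : ℂ) := by
    have h1 : ∀ t, ((‖∑ v ∈ Finset.range n, b v * (zeta n ^ t) ^ v‖ ^ 2 : ℝ) : ℂ)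
        = ∑ v ∈ Finset.range n, ∑ v' ∈ Finset.range n,
            b v * (starRingEnd ℂ) (b v') * (zeta n ^ v * ((zeta n)⁻¹) ^ v') ^ t := by
      intro t
      push_cast
      rw [← Complex.mul_conj', map_sum, Finset.sum_mul_sum]
      refine Finset.sum_congr rfl fun v _ => Finset.sum_congr rfl fun v' _ => ?_
      rw [map_mul, map_pow, map_pow, hconj]
      ring
    rw [Finset.sum_congr rfl fun t _ => h1 t, Finset.sum_comm, Finset.mul_sum]
    refine Finset.sum_congr rfl fun v hv => ?_
    rw [Finset.sum_comm, Finset.sum_eq_single_of_mem v hv fun v' hv' hne => by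
      rw [← Finset.mul_sum, horth v hv v' hv' hne, mul_zero], ← Finset.mul_sum, ← mul_pow,
      mul_inv_cancel₀ hz0]
    rw [Complex.mul_conj']
    simp
    ring
  exact_mod_cast key

/-- The quotient `(z ^ x - 1) / (z - 1)` is the Fourier transform of the indicator of `{0, …, x -
1}`, so this is Parseval. The term at `z = 1` is 0 by the convention for division, hence an
inequality. -/
theorem sum_norm_pow_sub_one_div_le {n : ℕ} (hn : n ≠ 0) {x : ℕ} (hx : x ≤ n) :
    ∑ t ∈ Finset.range n, ‖(zeta n ^ t) ^ x - 1‖ ^ 2 / ‖zeta n ^ t - 1‖ ^ 2 ≤ n * x := by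
  have h := parseval hn fun v => if v < x then 1 else 0
  have hsub : ∀ f : ℕ → ℂ, ∑ v ∈ Finset.range n, (if v < x then 1 else 0) * f v
      = ∑ v ∈ Finset.range x, f v := by
    intro f
    simp only [ite_mul, one_mul, zero_mul]
    rw [← Finset.sum_filter]
    congr 1
    ext v
    simp only [Finset.mem_filter, Finset.mem_range]
    omega
  have hcard : ∑ v ∈ Finset.range n, ‖(if v < x then 1 else 0 : ℂ)‖ ^ 2 = x := by
    have : ∀ v, ‖(if v < x then 1 else 0 : ℂ)‖ ^ 2 = if v < x then 1 else 0 := fun v => by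
      split_ifs <;> simp
    simp only [this]
    rw [Finset.sum_boole, show (Finset.range n).filter (fun v => v < x) = Finset.range x by
      ext v; simp only [Finset.mem_filter, Finset.mem_range]; omega, Finset.card_range]
  rw [hcard] at h
  rw [← h]
  refine Finset.sum_le_sum fun t _ => ?_
  rw [hsub]
  by_cases hz : zeta n ^ t = 1
  · rw [hz]
    simp
  · rw [geom_sum_eq hz, norm_div, div_pow]

/-! ### The light part of the histogram -/

theorem norm_prod_sub_prod_le {ι : Type*} (s : Finset ι) (f g : ι → ℂ) (hf : ∀ i, ‖f i‖ ≤ 1)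
    (hg : ∀ i, ‖g i‖ ≤ 1) : ‖∏ i ∈ s, f i - ∏ i ∈ s, g i‖ ≤ ∑ i ∈ s, ‖f i - g i‖ := by
  classical
  induction s using Finset.induction_on with
  | empty => simp
  | insert i s hi ih =>
    rw [Finset.prod_insert hi, Finset.prod_insert hi, Finset.sum_insert hi]
    have h1 : f i * ∏ i ∈ s, f i - g i * ∏ i ∈ s, g i
        = (f i - g i) * ∏ i ∈ s, f i + g i * (∏ i ∈ s, f i - ∏ i ∈ s, g i) := by ring
    rw [h1]
    refine (norm_add_le _ _).trans (add_le_add ?_ ?_)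
    · rw [norm_mul, norm_prod]
      exact mul_le_of_le_one_right (norm_nonneg _)
        (Finset.prod_le_one (fun _ _ => norm_nonneg _) fun i _ => hf i)
    · rw [norm_mul]
      exact (mul_le_of_le_one_left (norm_nonneg _) (hg i)).trans ih

/-- If every `1 + a i` and every `exp (a i)` is in the unit disc, then the product of the `1 + a i`
is close to the exponential of the sum. -/
theorem norm_prod_one_add_sub_exp_le {ι : Type*} (s : Finset ι) (a : ι → ℂ)
    (h1 : ∀ i, ‖1 + a i‖ ≤ 1) (hre : ∀ i, (a i).re ≤ 0) (ha : ∀ i, ‖a i‖ ≤ 1) :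
    ‖∏ i ∈ s, (1 + a i) - Complex.exp (∑ i ∈ s, a i)‖ ≤ ∑ i ∈ s, ‖a i‖ ^ 2 := by
  rw [Complex.exp_sum]
  refine (norm_prod_sub_prod_le s _ _ h1 fun i => ?_).trans (Finset.sum_le_sum fun i _ => ?_)
  · rw [Complex.norm_exp]
    exact Real.exp_le_one_iff.2 (hre i)
  · rw [norm_sub_rev, ← sub_sub]
    exact Complex.norm_exp_sub_one_sub_id_le (ha i)

/-- The values of a uniformly random hash function are independent. -/
theorem average_prod {k m : ℕ} (f : Fin k → Fin m → ℂ) :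
    ((m : ℂ) ^ k)⁻¹ * ∑ h : Fin k → Fin m, ∏ j, f j (h j) = ∏ j, ((m : ℂ)⁻¹ * ∑ c, f j c) := by
  have := Finset.prod_univ_sum (fun _ : Fin k => (Finset.univ : Finset (Fin m))) fun j c => f j c
  simp only [Fintype.piFinset_univ] at this
  rw [Finset.prod_mul_distrib, this]
  simp

/-- The number of data points hashed to the cell `c`. -/
def load {k n m : ℕ} (h : Fin k → Fin m) (S : Fin n → Fin k) (c : Fin m) : ℕ :=
  (Finset.univ.filter fun i => h (S i) = c).card

variable {k n m : ℕ}

theorem load_eq (h : Fin k → Fin m) (S : Fin n → Fin k) (c : Fin m) :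
    load h S c = ∑ j, if h j = c then histogram S j else 0 := by
  rw [load, Finset.card_eq_sum_card_fiberwise (f := S) (t := Finset.univ)
    (fun _ _ => Finset.mem_univ _)]
  refine Finset.sum_congr rfl fun j _ => ?_
  rw [Finset.filter_filter, histogram]
  split_ifs with hj
  · congr 1
    ext i
    simp only [Finset.mem_filter, Finset.mem_univ, true_and, and_iff_right_iff_imp]
    rintro rfl
    exact hj
  · refine Finset.card_eq_zero.2 (Finset.filter_eq_empty_iff.2 fun i _ hi => hj ?_)
    rw [← hi.2]
    exact hi.1

theorem pow_load (z : ℂ) (h : Fin k → Fin m) (S : Fin n → Fin k) (c : Fin m) :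
    z ^ load h S c = ∏ j, if h j = c then z ^ histogram S j else 1 := by
  rw [load_eq, ← Finset.prod_pow_eq_pow_sum]
  refine Finset.prod_congr rfl fun j _ => ?_
  split_ifs <;> simp

/-- The exponent of the characteristic function of the load of a cell. -/
def expo (m : ℕ) (S : Fin n → Fin k) (z : ℂ) : ℂ := ∑ j, (z ^ histogram S j - 1) / m

/-- The energy `∑ |z ^ c - 1| ^ 2 / m ^ 2` over the multiplicities `c`. -/
def energy (m : ℕ) (S : Fin n → Fin k) (z : ℂ) : ℝ :=
  ∑ j, ‖z ^ histogram S j - 1‖ ^ 2 / (m : ℝ) ^ 2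

theorem average_pow_load (hm : m ≠ 0) (z : ℂ) (S : Fin n → Fin k) (c : Fin m) :
    ((m : ℂ) ^ k)⁻¹ * ∑ h : Fin k → Fin m, z ^ load h S c
      = ∏ j, (1 + (z ^ histogram S j - 1) / m) := by
  have hm' : (m : ℂ) ≠ 0 := Nat.cast_ne_zero.2 hm
  simp only [pow_load]
  rw [average_prod fun j c' => if c' = c then z ^ histogram S j else 1]
  refine Finset.prod_congr rfl fun j _ => ?_
  have h1 : ∀ c', (if c' = c then z ^ histogram S j else 1)
      = 1 + if c' = c then z ^ histogram S j - 1 else 0 := fun c' => by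
    split_ifs <;> ring
  simp only [h1]
  rw [Finset.sum_add_distrib, Finset.sum_ite_eq' Finset.univ c]
  simp
  field_simp

theorem norm_pow_sub_one_sq {z : ℂ} (hz : ‖z‖ = 1) (x : ℕ) :
    ‖z ^ x - 1‖ ^ 2 = 2 - 2 * (z ^ x).re := by
  have h1 : ‖z ^ x‖ = 1 := by rw [norm_pow, hz, one_pow]
  rw [Complex.sq_norm, Complex.normSq_sub, Complex.normSq_eq_norm_sq, h1]
  simp
  ring

/-- An element falls into `c`, into `c'`, or into neither, so its factor is `1 + (z ^ x + conj (z ^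
x) - 2) / m`, which is real. -/
theorem average_pow_load_mul_conj (hm : m ≠ 0) {z : ℂ} (hz : ‖z‖ = 1) (S : Fin n → Fin k)
    {c c' : Fin m} (hc : c ≠ c') :
    ((m : ℂ) ^ k)⁻¹ * ∑ h : Fin k → Fin m, z ^ load h S c * (starRingEnd ℂ) (z ^ load h S c')
      = ∏ j, (1 + ((-(‖z ^ histogram S j - 1‖ ^ 2 / m) : ℝ) : ℂ)) := by
  have hm' : (m : ℂ) ≠ 0 := Nat.cast_ne_zero.2 hm
  simp only [pow_load, map_prod, ← Finset.prod_mul_distrib]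
  rw [average_prod fun j d => (if d = c then z ^ histogram S j else 1)
    * (starRingEnd ℂ) (if d = c' then z ^ histogram S j else 1)]
  refine Finset.prod_congr rfl fun j _ => ?_
  have h1 : ∀ d, (if d = c then z ^ histogram S j else 1)
      * (starRingEnd ℂ) (if d = c' then z ^ histogram S j else 1)
      = 1 + (if d = c then z ^ histogram S j - 1 else 0)
        + (if d = c' then (starRingEnd ℂ) (z ^ histogram S j) - 1 else 0) := fun d => by
    by_cases h1 : d = c
    · have h2 : d ≠ c' := fun h => hc (h1.symm.trans h)
      simp [h1, hc]
    · by_cases h2 : d = c' <;> simp [h1, h2, hc.symm]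
  simp only [h1]
  rw [Finset.sum_add_distrib, Finset.sum_add_distrib, Finset.sum_ite_eq' Finset.univ c,
    Finset.sum_ite_eq' Finset.univ c', norm_pow_sub_one_sq hz]
  have h2 : z ^ histogram S j + (starRingEnd ℂ) (z ^ histogram S j)
      = 2 * ((z ^ histogram S j).re : ℂ) := by
    rw [Complex.add_conj]
    push_cast
    rfl
  simp only [Finset.mem_univ, if_true, Finset.sum_const, Finset.card_univ, Fintype.card_fin,
    nsmul_eq_mul, mul_one]
  push_cast
  field_simp
  linear_combination h2

theorem norm_pow_sub_one_le_two {z : ℂ} (hz : ‖z‖ = 1) (x : ℕ) : ‖z ^ x - 1‖ ≤ 2 := by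
  refine (norm_sub_le _ _).trans ?_
  rw [norm_pow, hz, one_pow, norm_one]
  norm_num

theorem expo_re_eq {z : ℂ} (hz : ‖z‖ = 1) (S : Fin n → Fin k) :
    2 * (expo m S z).re = ∑ j, -(‖z ^ histogram S j - 1‖ ^ 2 / m) := by
  rw [expo, Complex.re_sum, Finset.mul_sum]
  refine Finset.sum_congr rfl fun j _ => ?_
  rw [norm_pow_sub_one_sq hz, Complex.div_natCast_re]
  simp
  ring

theorem norm_sub_sq_eq (w e : ℂ) :
    ‖w - e‖ ^ 2 = (w * (starRingEnd ℂ) w).re - 2 * (w * (starRingEnd ℂ) e).re + ‖e‖ ^ 2 := by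
  rw [Complex.sq_norm, Complex.sq_norm, Complex.normSq_sub, Complex.mul_conj]
  simp
  ring

/-- Over a random hash function, the empirical characteristic function of the loads concentrates
around the exponential of `expo`. -/
theorem average_norm_sub_exp_sq_le (hm : 4 ≤ m) {z : ℂ} (hz : ‖z‖ = 1) (S : Fin n → Fin k) :
    ((m : ℝ) ^ k)⁻¹ * ∑ h : Fin k → Fin m,
      ‖(m : ℂ)⁻¹ * ∑ c, z ^ load h S c - Complex.exp (expo m S z)‖ ^ 2 ≤ 7 * energy m S z := by
  have hm0 : m ≠ 0 := by omega
  have hmR : (4 : ℝ) ≤ m := by exact_mod_cast hm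
  have hmC : (m : ℂ) ≠ 0 := Nat.cast_ne_zero.2 hm0
  set e := Complex.exp (expo m S z) with he
  set G := ∏ j, (1 + (z ^ histogram S j - 1) / (m : ℂ)) with hG
  set H := ∏ j, (1 + ((-(‖z ^ histogram S j - 1‖ ^ 2 / m) : ℝ) : ℂ)) with hH
  have havg1 : ((m : ℂ) ^ k)⁻¹ * ∑ h : Fin k → Fin m, (m : ℂ)⁻¹ * ∑ c, z ^ load h S c = G := by
    rw [← Finset.mul_sum, Finset.sum_comm, mul_left_comm, Finset.mul_sum,
      Finset.sum_congr rfl fun c _ => average_pow_load hm0 z S c]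
    simp [hmC, hG]
  have havg2 : ((m : ℂ) ^ k)⁻¹ * ∑ h : Fin k → Fin m, ((m : ℂ)⁻¹ * ∑ c, z ^ load h S c)
      * (starRingEnd ℂ) ((m : ℂ)⁻¹ * ∑ c, z ^ load h S c)
      = (m : ℂ)⁻¹ + (1 - (m : ℂ)⁻¹) * H := by
    have h1 : ∀ h : Fin k → Fin m, ((m : ℂ)⁻¹ * ∑ c, z ^ load h S c)
        * (starRingEnd ℂ) ((m : ℂ)⁻¹ * ∑ c, z ^ load h S c)
        = (m : ℂ)⁻¹ * (m : ℂ)⁻¹ * ∑ c, ∑ c', z ^ load h S c * (starRingEnd ℂ) (z ^ load h S c') := by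
      intro h
      rw [map_mul, map_inv₀, Complex.conj_natCast, map_sum, ← Finset.sum_mul_sum]
      ring
    simp only [h1]
    rw [← Finset.mul_sum, Finset.sum_comm, mul_left_comm, Finset.mul_sum]
    have h2 : ∀ c : Fin m, ((m : ℂ) ^ k)⁻¹ * ∑ h : Fin k → Fin m,
        ∑ c', z ^ load h S c * (starRingEnd ℂ) (z ^ load h S c') = 1 + (m - 1) * H := by
      intro c
      rw [Finset.sum_comm, Finset.mul_sum, ← Finset.add_sum_erase _ _ (Finset.mem_univ c),
        Finset.sum_congr rfl fun c' hc' => average_pow_load_mul_conj hm0 hz S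
          (Finset.ne_of_mem_erase hc').symm]
      congr 1
      · have : ∀ h : Fin k → Fin m, z ^ load h S c * (starRingEnd ℂ) (z ^ load h S c) = 1 := by
          intro h
          rw [Complex.mul_conj', norm_pow, hz]
          simp
        rw [Finset.sum_congr rfl fun h _ => this h]
        simp [hmC]
      · rw [Finset.sum_const, Finset.card_erase_of_mem (Finset.mem_univ c), Finset.card_univ,
          Fintype.card_fin, nsmul_eq_mul, Nat.cast_sub (by omega)]
        simp [hH]
    simp only [h2]
    rw [Finset.sum_const, Finset.card_univ, Fintype.card_fin, nsmul_eq_mul]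
    field_simp
  have hcard : ((m : ℝ) ^ k)⁻¹ * ∑ _h : Fin k → Fin m, ‖e‖ ^ 2 = ‖e‖ ^ 2 := by
    have : (m : ℝ) ≠ 0 := by positivity
    simp [this]
  have hexpand : ((m : ℝ) ^ k)⁻¹ * ∑ h : Fin k → Fin m,
      ‖(m : ℂ)⁻¹ * ∑ c, z ^ load h S c - e‖ ^ 2
      = ((m : ℂ)⁻¹ + (1 - (m : ℂ)⁻¹) * H).re - 2 * (G * (starRingEnd ℂ) e).re + ‖e‖ ^ 2 := by
    have hre : ∀ x : ℂ, (((m : ℂ) ^ k)⁻¹ * x).re = ((m : ℝ) ^ k)⁻¹ * x.re := fun x => by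
      rw [← Complex.re_ofReal_mul]
      push_cast
      rfl
    have h1 : ((m : ℝ) ^ k)⁻¹ * ∑ h : Fin k → Fin m,
        (((m : ℂ)⁻¹ * ∑ c, z ^ load h S c) * (starRingEnd ℂ) e).re = (G * (starRingEnd ℂ) e).re := by
      rw [← havg1, mul_assoc, Finset.sum_mul, hre, Complex.re_sum]
    rw [← havg2, hre, Complex.re_sum, ← h1]
    simp only [norm_sub_sq_eq]
    rw [Finset.sum_add_distrib, Finset.sum_sub_distrib, ← Finset.mul_sum, mul_add, mul_sub, hcard,
      mul_left_comm]
  have hxs : ∀ j, ‖z ^ histogram S j - 1‖ ^ 2 ≤ 4 := fun j => by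
    have := norm_pow_sub_one_le_two hz (histogram S j)
    nlinarith [norm_nonneg (z ^ histogram S j - 1)]
  have hGe : ‖G - e‖ ≤ energy m S z := by
    refine (norm_prod_one_add_sub_exp_le Finset.univ
      (fun j => (z ^ histogram S j - 1) / (m : ℂ)) (fun j => ?_) (fun j => ?_) fun j => ?_).trans
      (le_of_eq ?_)
    · have : 1 + (z ^ histogram S j - 1) / (m : ℂ)
          = ((1 - 1 / m : ℝ) : ℂ) + z ^ histogram S j / m := by
        push_cast
        ring
      rw [this]
      refine (norm_add_le _ _).trans (le_of_eq ?_)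
      rw [norm_div, norm_pow, hz, Complex.norm_real, Complex.norm_natCast, Real.norm_eq_abs,
        abs_of_nonneg]
      · ring
      · rw [sub_nonneg, div_le_one (by linarith)]
        linarith
    · rw [Complex.div_natCast_re]
      refine div_nonpos_of_nonpos_of_nonneg ?_ (by positivity)
      have := norm_pow_sub_one_sq hz (histogram S j)
      rw [Complex.sub_re, Complex.one_re]
      nlinarith [sq_nonneg ‖z ^ histogram S j - 1‖]
    · rw [norm_div, Complex.norm_natCast, div_le_one (by linarith)]
      exact (norm_pow_sub_one_le_two hz _).trans (by linarith)
    · rw [energy]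
      refine Finset.sum_congr rfl fun j _ => ?_
      rw [norm_div, Complex.norm_natCast, div_pow]
  have hnorm_e : ‖e‖ ≤ 1 := by
    rw [he, Complex.norm_exp, Real.exp_le_one_iff]
    have h := expo_re_eq (m := m) hz S
    have : ∑ j, -(‖z ^ histogram S j - 1‖ ^ 2 / (m : ℝ)) ≤ 0 :=
      Finset.sum_nonpos fun j _ => by rw [neg_nonpos]; positivity
    linarith
  -- The exponent of the pair correlations is twice the real part of `expo`, so the mean and the
  -- second moment are approximated by the same `e`. This cancellation yields concentration.
  have he2 : ((‖e‖ ^ 2 : ℝ) : ℂ)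
      = Complex.exp (∑ j, ((-(‖z ^ histogram S j - 1‖ ^ 2 / m) : ℝ) : ℂ)) := by
    rw [← Complex.ofReal_sum, ← expo_re_eq hz S, ← Complex.ofReal_exp, he, Complex.norm_exp,
      ← Real.exp_nat_mul]
    norm_num
  have hHe : ‖H - ((‖e‖ ^ 2 : ℝ) : ℂ)‖ ≤ 4 * energy m S z := by
    rw [he2]
    refine (norm_prod_one_add_sub_exp_le Finset.univ
      (fun j => ((-(‖z ^ histogram S j - 1‖ ^ 2 / m) : ℝ) : ℂ)) (fun j => ?_) (fun j => ?_)
      fun j => ?_).trans ?_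
    · have hcast : 1 + ((-(‖z ^ histogram S j - 1‖ ^ 2 / m) : ℝ) : ℂ)
          = ((1 + -(‖z ^ histogram S j - 1‖ ^ 2 / m) : ℝ) : ℂ) := by
        push_cast
        rfl
      rw [hcast, Complex.norm_real, Real.norm_eq_abs, abs_le]
      have : ‖z ^ histogram S j - 1‖ ^ 2 / m ≤ 1 := by
        rw [div_le_one (by linarith)]
        linarith [hxs j]
      have h0 : 0 ≤ ‖z ^ histogram S j - 1‖ ^ 2 / m := by positivity
      constructor <;> linarith
    · rw [Complex.ofReal_re, neg_nonpos]
      positivity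
    · rw [Complex.norm_real, norm_neg, Real.norm_eq_abs, abs_of_nonneg (by positivity),
        div_le_one (by linarith)]
      linarith [hxs j]
    · rw [energy, Finset.mul_sum]
      refine Finset.sum_le_sum fun j _ => ?_
      rw [Complex.norm_real, norm_neg, Real.norm_eq_abs, abs_of_nonneg (by positivity), div_pow,
        ← mul_div_assoc]
      gcongr
      nlinarith [hxs j, sq_nonneg ‖z ^ histogram S j - 1‖]
  have hdiag : 1 - ‖e‖ ^ 2 ≤ m * energy m S z := by
    have h1 := Real.add_one_le_exp (2 * (expo m S z).re)
    have h2 : Real.exp (2 * (expo m S z).re) = ‖e‖ ^ 2 := by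
      rw [he, Complex.norm_exp, ← Real.exp_nat_mul]
      norm_num
    have h3 : ∑ j, -(‖z ^ histogram S j - 1‖ ^ 2 / (m : ℝ)) = -(m * energy m S z) := by
      rw [energy, Finset.mul_sum, ← Finset.sum_neg_distrib]
      refine Finset.sum_congr rfl fun j _ => ?_
      field_simp
    rw [expo_re_eq hz, h3] at h1
    rw [expo_re_eq hz, h3] at h2
    linarith
  -- The constant is `7 = 1 + 4 + 2`: equal cells contribute `(1 - ‖e‖ ^ 2) / m`, pairs of distinct
  -- cells the error of `H`, and the cross term twice the error of `G`.
  rw [hexpand]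
  have hre1 : ((m : ℂ)⁻¹ + (1 - (m : ℂ)⁻¹) * H).re = (m : ℝ)⁻¹ + (1 - (m : ℝ)⁻¹) * H.re := by
    have : (m : ℂ)⁻¹ + (1 - (m : ℂ)⁻¹) * H
        = (((m : ℝ)⁻¹ : ℝ) : ℂ) + ((1 - (m : ℝ)⁻¹ : ℝ) : ℂ) * H := by
      push_cast
      rfl
    rw [this, Complex.add_re, Complex.re_ofReal_mul, Complex.ofReal_re]
  have hHre : H.re - ‖e‖ ^ 2 ≤ 4 * energy m S z := by
    have := (Complex.abs_re_le_norm (H - ((‖e‖ ^ 2 : ℝ) : ℂ))).trans hHe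
    rw [Complex.sub_re, Complex.ofReal_re] at this
    exact (le_abs_self _).trans this
  have hGre : ‖e‖ ^ 2 - (G * (starRingEnd ℂ) e).re ≤ energy m S z := by
    have h1 : ‖e‖ ^ 2 - (G * (starRingEnd ℂ) e).re = -((G - e) * (starRingEnd ℂ) e).re := by
      rw [sub_mul, Complex.sub_re, Complex.mul_conj' e]
      norm_cast
      exact (neg_sub _ _).symm
    rw [h1]
    refine (neg_le_abs _).trans ((Complex.abs_re_le_norm _).trans ?_)
    rw [norm_mul, RCLike.norm_conj]
    exact (mul_le_of_le_one_right (norm_nonneg _) hnorm_e).trans hGe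
  rw [hre1]
  have hminv : (m : ℝ)⁻¹ ≤ 1 := inv_le_one_of_one_le₀ (by linarith)
  have hminv0 : 0 ≤ (m : ℝ)⁻¹ := by positivity
  have t1 : (m : ℝ)⁻¹ * (1 - ‖e‖ ^ 2) ≤ energy m S z := by
    calc (m : ℝ)⁻¹ * (1 - ‖e‖ ^ 2) ≤ (m : ℝ)⁻¹ * (m * energy m S z) := by gcongr
      _ = _ := by field_simp
  have hen : 0 ≤ energy m S z := Finset.sum_nonneg fun j _ => by positivity
  have t2 : (1 - (m : ℝ)⁻¹) * (H.re - ‖e‖ ^ 2) ≤ 4 * energy m S z := by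
    calc (1 - (m : ℝ)⁻¹) * (H.re - ‖e‖ ^ 2) ≤ (1 - (m : ℝ)⁻¹) * (4 * energy m S z) := by
          gcongr
      _ ≤ 1 * (4 * energy m S z) := by gcongr; linarith
      _ = _ := one_mul _
  linear_combination t1 + t2 + 2 * hGre

end

/-! ### Estimating the characteristic function of the loads from noisy cells -/

section

open MeasureTheory

variable {k n m : ℕ}

/-- The unbiased estimate of the empirical characteristic function of the loads, computed from
noisy loads. -/
def charEst (p : Set.Ioo (0 : ℝ) 1) (z : ℂ) (y : Fin m → ℤ) : ℂ :=
  (m : ℂ)⁻¹ * ∑ c, z ^ y c * (1 + kap p * ‖z - 1‖ ^ 2)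

/-- The weighted mean square distance, over the `n`-th roots of unity, between the estimated
characteristic function and the one predicted by a dataset. -/
def lightErr (p : Set.Ioo (0 : ℝ) 1) (S : Fin n → Fin k) (y : Fin m → ℤ) : ℝ :=
  (n : ℝ)⁻¹ * ∑ t ∈ Finset.range n,
    ‖charEst p (zeta n ^ t) y - Complex.exp (expo m S (zeta n ^ t))‖ ^ 2 / ‖zeta n ^ t - 1‖ ^ 2

/-- The function `t ↦ z ^ t` is an eigenfunction of the second difference, with eigenvalue `z + z⁻¹
- 2 = -‖z - 1‖ ^ 2`. -/
theorem integral_zpow_lap (p : Set.Ioo (0 : ℝ) 1) {z : ℂ} (hz : ‖z‖ = 1) :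
    (∫ t : ℤ, z ^ t ∂lapMeasure p) * (1 + kap p * ‖z - 1‖ ^ 2) = 1 := by
  have hz0 : z ≠ 0 := by
    rintro rfl
    simp at hz
  have hb : ∀ t : ℤ, ‖z ^ t‖ ≤ 1 := fun t => by rw [norm_zpow, hz, one_zpow]
  have h := integral_lap_deconv p hb 0
  rw [zpow_zero] at h
  refine Eq.trans ?_ h
  rw [← integral_mul_const]
  congr 1
  funext t
  have hr : ((‖z - 1‖ : ℂ)) ^ 2 = 2 - z - z⁻¹ := by
    rw [← Complex.conj_mul', map_sub, map_one, ← Complex.inv_eq_conj hz]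
    field_simp
    ring
  rw [hr, zero_add, zpow_add_one₀ hz0, zpow_sub_one₀ hz0]
  ring

theorem integral_norm_lap_sub_one_sq (p : Set.Ioo (0 : ℝ) 1) {z : ℂ} (hz : ‖z‖ = 1) :
    ∫ t : ℤ, ‖z ^ t * (1 + kap p * ‖z - 1‖ ^ 2) - 1‖ ^ 2 ∂lapMeasure p
      = (1 + kap p * ‖z - 1‖ ^ 2) ^ 2 - 1 := by
  set a : ℝ := 1 + kap p * ‖z - 1‖ ^ 2 with ha
  have haC : (1 + kap p * ‖z - 1‖ ^ 2 : ℂ) = (a : ℂ) := by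
    rw [ha]
    push_cast
    rfl
  have h := integral_zpow_lap p hz
  rw [haC] at h ⊢
  have hb : ∀ t : ℤ, ‖z ^ t‖ ≤ 1 := fun t => by rw [norm_zpow, hz, one_zpow]
  have hint : Integrable (fun t : ℤ => z ^ t * (a : ℂ)) (lapMeasure p) :=
    (integrable_of_norm_le hb).mul_const _
  have hpt : ∀ t : ℤ, ‖z ^ t * (a : ℂ) - 1‖ ^ 2 = a ^ 2 + 1 - 2 * (z ^ t * (a : ℂ)).re := by
    intro t
    rw [Complex.sq_norm, Complex.normSq_sub, Complex.normSq_eq_norm_sq, norm_mul, norm_zpow, hz]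
    simp
  simp only [hpt]
  have hint' : Integrable (fun t : ℤ => (z ^ t * (a : ℂ)).re) (lapMeasure p) := hint.re
  rw [integral_sub (integrable_const _) (hint'.const_mul 2), integral_const_mul]
  have hre : ∫ t : ℤ, (z ^ t * (a : ℂ)).re ∂lapMeasure p = 1 := by
    have := integral_re hint
    simp only [RCLike.re_to_complex] at this
    rw [this, integral_mul_const, h, Complex.one_re]
  rw [hre]
  simp
  ring

/-- The corrected cell terms are independent and unbiased, so their variances add. The summand `A`
stands for the cells of the other table, which do not enter. -/
theorem integral_charEst_sub_sq {A : Type} [Fintype A] [DecidableEq A] (hm : m ≠ 0)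
    (p : Set.Ioo (0 : ℝ) 1) {z : ℂ} (hz : ‖z‖ = 1) (X : Fin m → ℕ) :
    ∫ y, ‖charEst p z (fun c => X c + y (Sum.inr c)) - (m : ℂ)⁻¹ * ∑ c, z ^ X c‖ ^ 2
        ∂(Measure.pi fun _ : A ⊕ Fin m => lapMeasure p)
      = (m : ℝ)⁻¹ * ((1 + kap p * ‖z - 1‖ ^ 2) ^ 2 - 1) := by
  have hz0 : z ≠ 0 := by
    rintro rfl
    simp at hz
  have hk := kap_nonneg p
  have hm' : (m : ℝ) ≠ 0 := Nat.cast_ne_zero.2 hm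
  set a : ℝ := 1 + kap p * ‖z - 1‖ ^ 2 with ha
  have haC : (1 + kap p * ‖z - 1‖ ^ 2 : ℂ) = (a : ℂ) := by
    rw [ha]
    push_cast
    rfl
  set u : A ⊕ Fin m → ℤ → ℂ := Sum.elim (fun _ _ => 0)
    fun c t => (m : ℂ)⁻¹ * z ^ X c * (z ^ t * (a : ℂ) - 1) with hu
  have hb : ∀ t : ℤ, ‖z ^ t‖ ≤ 1 := fun t => by rw [norm_zpow, hz, one_zpow]
  have hint : Integrable (fun t : ℤ => z ^ t * (a : ℂ)) (lapMeasure p) :=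
    (integrable_of_norm_le hb).mul_const _
  have hnorm : ∀ c t, ‖u (Sum.inr c) t‖ = (m : ℝ)⁻¹ * ‖z ^ t * (a : ℂ) - 1‖ := fun c t => by
    simp only [hu, Sum.elim_inr, norm_mul, norm_inv, norm_pow, hz, Complex.norm_natCast, one_pow,
      mul_one]
  have h := integral_norm_sq_sum_pi (lapMeasure p) (u := u) (B := (m : ℝ)⁻¹ * (|a| + 1))
    (fun c t => by
      rcases c with c | c
      · simp only [hu, Sum.elim_inl, norm_zero]
        positivity
      · rw [hnorm]
        gcongr
        refine (norm_sub_le _ _).trans ?_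
        rw [norm_mul, norm_one, norm_zpow, hz, one_zpow, one_mul, Complex.norm_real,
          Real.norm_eq_abs])
    (fun c => by
      rcases c with c | c
      · simp [hu]
      · simp only [hu, Sum.elim_inr]
        have h1 := integral_zpow_lap p hz
        rw [haC] at h1
        rw [integral_const_mul, integral_sub hint (integrable_const _), integral_mul_const, h1]
        simp)
  have hlhs : ∀ y : A ⊕ Fin m → ℤ,
      charEst p z (fun c => X c + y (Sum.inr c)) - (m : ℂ)⁻¹ * ∑ c, z ^ X c = ∑ c, u c (y c) := by
    intro y
    rw [Fintype.sum_sum_type, charEst, haC, ← mul_sub, ← Finset.sum_sub_distrib, Finset.mul_sum]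
    simp only [hu, Sum.elim_inl, Finset.sum_const_zero, zero_add, Sum.elim_inr]
    refine Finset.sum_congr rfl fun c _ => ?_
    rw [zpow_add₀ hz0, zpow_natCast]
    ring
  simp only [hlhs]
  rw [h, Fintype.sum_sum_type]
  have hinl : ∀ c : A, ∫ t, ‖u (Sum.inl c) t‖ ^ 2 ∂lapMeasure p = 0 := fun c => by simp [hu]
  have hinr : ∀ c : Fin m, ∫ t, ‖u (Sum.inr c) t‖ ^ 2 ∂lapMeasure p
      = (m : ℝ)⁻¹ ^ 2 * (a ^ 2 - 1) := fun c => by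
    simp only [hnorm, mul_pow]
    rw [integral_const_mul]
    have h2 := integral_norm_lap_sub_one_sq p hz
    rw [haC] at h2
    rw [h2]
  simp only [hinl, hinr, Finset.sum_const_zero, zero_add, Finset.sum_const, Finset.card_univ,
    Fintype.card_fin, nsmul_eq_mul]
  field_simp

theorem norm_charEst_le (p : Set.Ioo (0 : ℝ) 1) {z : ℂ} (hz : ‖z‖ = 1) (hm : m ≠ 0)
    (y : Fin m → ℤ) : ‖charEst p z y‖ ≤ ‖(1 + kap p * ‖z - 1‖ ^ 2 : ℂ)‖ := by
  have hm' : (m : ℝ) ≠ 0 := Nat.cast_ne_zero.2 hm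
  rw [charEst, norm_mul, norm_inv, Complex.norm_natCast]
  have : ‖∑ c, z ^ y c * (1 + kap p * ‖z - 1‖ ^ 2 : ℂ)‖
      ≤ m * ‖(1 + kap p * ‖z - 1‖ ^ 2 : ℂ)‖ := by
    refine (norm_sum_le _ _).trans (le_of_eq ?_)
    simp [norm_zpow, hz]
  calc _ ≤ (m : ℝ)⁻¹ * (m * ‖(1 + kap p * ‖z - 1‖ ^ 2 : ℂ)‖) := by gcongr
    _ = _ := by field_simp

theorem lightErr_nonneg (p : Set.Ioo (0 : ℝ) 1) (S : Fin n → Fin k) (y : Fin m → ℤ) :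
    0 ≤ lightErr p S y := by
  rw [lightErr]
  positivity

theorem integrable_lightErr {C : Type} [Fintype C] (p : Set.Ioo (0 : ℝ) 1) (hm : m ≠ 0)
    (hn : n ≠ 0) (S : Fin n → Fin k) (μ : Measure (C → ℤ)) [IsFiniteMeasure μ]
    (Y : (C → ℤ) → Fin m → ℤ) : Integrable (fun y => lightErr p S (Y y)) μ := by
  unfold lightErr
  refine (integrable_finsetSum _ fun t _ => Integrable.div_const ?_ _).const_mul _
  refine integrable_of_norm_le (B := (‖(1 + kap p * ‖zeta n ^ t - 1‖ ^ 2 : ℂ)‖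
    + ‖Complex.exp (expo m S (zeta n ^ t))‖) ^ 2) fun y => ?_
  rw [norm_pow, norm_norm]
  gcongr
  exact (norm_sub_le _ _).trans
    (add_le_add (norm_charEst_le p (norm_zeta_pow hn t) hm _) le_rfl)

/-- The noise variance vanishes to order `‖z - 1‖ ^ 2` at `z = 1`, so it survives the weight: with
`‖z - 1‖ ≤ 2` the quotient is at most `2 κ + 4 κ ^ 2`, uniformly in `z`. -/
theorem integral_lightErr_le {A : Type} [Fintype A] [DecidableEq A] (hm : m ≠ 0) (hn : n ≠ 0)
    (p : Set.Ioo (0 : ℝ) 1) (S : Fin n → Fin k) (X : Fin m → ℕ) :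
    ∫ y, lightErr p S (fun c => X c + y (Sum.inr c))
        ∂(Measure.pi fun _ : A ⊕ Fin m => lapMeasure p)
      ≤ (n : ℝ)⁻¹ * ∑ t ∈ Finset.range n, (2 * ((m : ℝ)⁻¹ * (2 * kap p + 4 * kap p ^ 2))
        + 2 * ‖(m : ℂ)⁻¹ * ∑ c, (zeta n ^ t) ^ X c - Complex.exp (expo m S (zeta n ^ t))‖ ^ 2
          / ‖zeta n ^ t - 1‖ ^ 2) := by
  have hk := kap_nonneg p
  set P := Measure.pi fun _ : A ⊕ Fin m => lapMeasure p
  unfold lightErr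
  have hb : ∀ t, ∀ e : ℂ, Integrable (fun y : A ⊕ Fin m → ℤ =>
      ‖charEst p (zeta n ^ t) (fun c => X c + y (Sum.inr c)) - e‖ ^ 2) P := fun t e => by
    refine integrable_of_norm_le (B := (‖(1 + kap p * ‖zeta n ^ t - 1‖ ^ 2 : ℂ)‖ + ‖e‖) ^ 2)
      fun y => ?_
    rw [norm_pow, norm_norm]
    gcongr
    exact (norm_sub_le _ _).trans
      (add_le_add (norm_charEst_le p (norm_zeta_pow hn t) hm _) le_rfl)
  rw [integral_const_mul, integral_finsetSum _ fun t _ => (hb t _).div_const _]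
  refine mul_le_mul_of_nonneg_left (Finset.sum_le_sum fun t _ => ?_) (by positivity)
  rw [integral_div]
  set z := zeta n ^ t with hzdef
  have hz : ‖z‖ = 1 := norm_zeta_pow hn t
  set e := Complex.exp (expo m S z)
  set w := (m : ℂ)⁻¹ * ∑ c, z ^ X c
  have h1 : ∫ y : A ⊕ Fin m → ℤ, ‖charEst p z (fun c => X c + y (Sum.inr c)) - e‖ ^ 2 ∂P
      ≤ 2 * ((m : ℝ)⁻¹ * ((1 + kap p * ‖z - 1‖ ^ 2) ^ 2 - 1)) + 2 * ‖w - e‖ ^ 2 := by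
    rw [← integral_charEst_sub_sq (A := A) hm p hz X, ← integral_const_mul]
    have hc : 2 * ‖w - e‖ ^ 2 = ∫ _y : A ⊕ Fin m → ℤ, 2 * ‖w - e‖ ^ 2 ∂P := by simp
    rw [hc, ← integral_add ((hb t w).const_mul 2) (integrable_const _)]
    refine integral_mono (hb t e) (((hb t w).const_mul 2).add (integrable_const _)) fun y => ?_
    simp only
    have h2 := norm_add_le (charEst p z (fun c => X c + y (Sum.inr c)) - w) (w - e)
    rw [sub_add_sub_cancel] at h2
    nlinarith [norm_nonneg (charEst p z (fun c => X c + y (Sum.inr c)) - e),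
      sq_nonneg (‖charEst p z (fun c => X c + y (Sum.inr c)) - w‖ - ‖w - e‖)]
  rcases eq_or_ne z 1 with h0 | h0
  · rw [h0]
    simp
    positivity
  · have hr : 0 < ‖z - 1‖ ^ 2 := by
      have := norm_pos_iff.2 (sub_ne_zero.2 h0)
      positivity
    have hr4 : ‖z - 1‖ ^ 2 ≤ 4 := by
      have := norm_pow_sub_one_le_two hz 1
      rw [pow_one] at this
      nlinarith [norm_nonneg (z - 1)]
    refine (div_le_div_of_nonneg_right h1 hr.le).trans ?_
    rw [add_div]
    refine add_le_add ?_ le_rfl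
    rw [div_le_iff₀ hr]
    have : (1 + kap p * ‖z - 1‖ ^ 2) ^ 2 - 1 ≤ (2 * kap p + 4 * kap p ^ 2) * ‖z - 1‖ ^ 2 := by
      have h3 : kap p ^ 2 * (‖z - 1‖ ^ 2 * ‖z - 1‖ ^ 2) ≤ kap p ^ 2 * (4 * ‖z - 1‖ ^ 2) := by
        gcongr
      linear_combination h3
    calc 2 * ((m : ℝ)⁻¹ * ((1 + kap p * ‖z - 1‖ ^ 2) ^ 2 - 1))
        ≤ 2 * ((m : ℝ)⁻¹ * ((2 * kap p + 4 * kap p ^ 2) * ‖z - 1‖ ^ 2)) := by gcongr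
      _ = _ := by ring

theorem sum_energy_div_le (hn : n ≠ 0) (S : Fin n → Fin k) :
    ∑ t ∈ Finset.range n, energy m S (zeta n ^ t) / ‖zeta n ^ t - 1‖ ^ 2
      ≤ (n : ℝ) ^ 2 / (m : ℝ) ^ 2 := by
  simp only [energy, Finset.sum_div]
  rw [Finset.sum_comm]
  have h : ∀ j, ∑ t ∈ Finset.range n,
      ‖(zeta n ^ t) ^ histogram S j - 1‖ ^ 2 / (m : ℝ) ^ 2 / ‖zeta n ^ t - 1‖ ^ 2
      ≤ n * histogram S j / (m : ℝ) ^ 2 := fun j => by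
    simp only [div_right_comm _ ((m : ℝ) ^ 2)]
    rw [← Finset.sum_div]
    exact div_le_div_of_nonneg_right (sum_norm_pow_sub_one_div_le hn (histogram_le S j))
      (by positivity)
  refine (Finset.sum_le_sum fun j _ => h j).trans (le_of_eq ?_)
  rw [← Finset.sum_div, ← Finset.mul_sum, ← Nat.cast_sum, sum_histogram]
  ring

/-- The expectation of `lightErr` over a random hash function and the noise. -/
theorem average_integral_lightErr_le {A : Type} [Fintype A] [DecidableEq A] (hm : 4 ≤ m)
    (hn : n ≠ 0) (p : Set.Ioo (0 : ℝ) 1) (S : Fin n → Fin k) :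
    ((m : ℝ) ^ k)⁻¹ * ∑ h : Fin k → Fin m,
      ∫ y, lightErr p S (fun c => load h S c + y (Sum.inr c))
        ∂(Measure.pi fun _ : A ⊕ Fin m => lapMeasure p)
      ≤ 2 * ((m : ℝ)⁻¹ * (2 * kap p + 4 * kap p ^ 2)) + 14 * (n / (m : ℝ) ^ 2) := by
  have hm0 : m ≠ 0 := by omega
  have hmR : (m : ℝ) ≠ 0 := Nat.cast_ne_zero.2 hm0
  have hnR : (n : ℝ) ≠ 0 := Nat.cast_ne_zero.2 hn
  obtain ⟨a, ha⟩ : ∃ a, a = 2 * ((m : ℝ)⁻¹ * (2 * kap p + 4 * kap p ^ 2)) := ⟨_, rfl⟩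
  rw [← ha]
  calc _ ≤ ((m : ℝ) ^ k)⁻¹ * ∑ h : Fin k → Fin m, (n : ℝ)⁻¹ * ∑ t ∈ Finset.range n,
        (a + 2 * ‖(m : ℂ)⁻¹ * ∑ c, (zeta n ^ t) ^ load h S c
          - Complex.exp (expo m S (zeta n ^ t))‖ ^ 2 / ‖zeta n ^ t - 1‖ ^ 2) := by
        refine mul_le_mul_of_nonneg_left (Finset.sum_le_sum fun h _ => ?_) (by positivity)
        rw [ha]
        exact integral_lightErr_le hm0 hn p S _
    _ = (n : ℝ)⁻¹ * ∑ t ∈ Finset.range n, (a + 2 * (((m : ℝ) ^ k)⁻¹ * ∑ h : Fin k → Fin m,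
        ‖(m : ℂ)⁻¹ * ∑ c, (zeta n ^ t) ^ load h S c
          - Complex.exp (expo m S (zeta n ^ t))‖ ^ 2) / ‖zeta n ^ t - 1‖ ^ 2) := by
        rw [← Finset.mul_sum, Finset.sum_comm, mul_left_comm, Finset.mul_sum]
        congr 1
        refine Finset.sum_congr rfl fun t _ => ?_
        rw [Finset.sum_add_distrib, mul_add]
        congr 1
        · simp [hmR]
        · rw [← Finset.sum_div, ← Finset.mul_sum]
          ring
    _ ≤ (n : ℝ)⁻¹ * ∑ t ∈ Finset.range n,
        (a + 14 * (energy m S (zeta n ^ t) / ‖zeta n ^ t - 1‖ ^ 2)) := by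
        refine mul_le_mul_of_nonneg_left (Finset.sum_le_sum fun t _ => ?_) (by positivity)
        refine add_le_add le_rfl ?_
        rw [← mul_div_assoc]
        refine div_le_div_of_nonneg_right ?_ (by positivity)
        have := average_norm_sub_exp_sq_le hm (norm_zeta_pow hn t) S
        linarith
    _ ≤ (n : ℝ)⁻¹ * (n * a + 14 * ((n : ℝ) ^ 2 / (m : ℝ) ^ 2)) := by
        rw [Finset.sum_add_distrib, ← Finset.mul_sum]
        have := sum_energy_div_le (m := m) hn S
        simp only [Finset.sum_const, Finset.card_range, nsmul_eq_mul]
        exact mul_le_mul_of_nonneg_left (add_le_add le_rfl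
          (mul_le_mul_of_nonneg_left this (by norm_num))) (by positivity)
    _ = _ := by field_simp

/-! ### Stability -/

/-- Each element contributes the geometric sum of `z ^ v` below its multiplicity. This turns
exponents of characteristic functions into Fourier transforms of tail counts. -/
theorem sum_tailCount_mul_pow (S : Fin n → Fin k) {z : ℂ} (hz : z ≠ 1) :
    ∑ v ∈ Finset.range n, (tailCount S (v + 1) : ℂ) * z ^ v
      = (∑ j, (z ^ histogram S j - 1)) / (z - 1) := by
  have h1 : ∀ v, (tailCount S (v + 1) : ℂ) = ∑ j, if v + 1 ≤ histogram S j then (1 : ℂ) else 0 :=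
    fun v => by rw [Finset.sum_boole, tailCount]
  simp only [h1, Finset.sum_mul, ite_mul, one_mul, zero_mul]
  rw [Finset.sum_comm, Finset.sum_div]
  refine Finset.sum_congr rfl fun j _ => ?_
  rw [← geom_sum_eq hz, ← Finset.sum_filter]
  congr 1
  ext v
  have := histogram_le S j
  simp only [Finset.mem_filter, Finset.mem_range]
  omega

/-- Near 0 the exponential has a Lipschitz inverse. This is what allows passing from characteristic
functions to their exponents without ambiguity of the logarithm. -/
theorem norm_sub_le_two_mul_norm_exp_sub {a b : ℂ} (ha : ‖a‖ ≤ 1 / 8) (hb : ‖b‖ ≤ 1 / 8) :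
    ‖a - b‖ ≤ 2 * ‖Complex.exp a - Complex.exp b‖ := by
  have hw : ‖a - b‖ ≤ 1 / 4 := (norm_sub_le _ _).trans (by linarith)
  have h1 : Complex.exp a - Complex.exp b = Complex.exp b * (Complex.exp (a - b) - 1) := by
    rw [mul_sub, ← Complex.exp_add, add_sub_cancel, mul_one]
  have h2 := Complex.norm_exp_sub_one_sub_id_le (x := a - b) (by linarith)
  have h3 : ‖a - b‖ ≤ ‖Complex.exp (a - b) - 1‖ + ‖Complex.exp (a - b) - 1 - (a - b)‖ := by
    have := norm_sub_le (Complex.exp (a - b) - 1) (Complex.exp (a - b) - 1 - (a - b))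
    rwa [sub_sub_cancel] at this
  have h4 : 7 / 8 ≤ ‖Complex.exp b‖ := by
    rw [Complex.norm_exp]
    have := Real.add_one_le_exp b.re
    have := (abs_le.1 (Complex.abs_re_le_norm b)).1
    linarith
  rw [h1, norm_mul]
  nlinarith [norm_nonneg (a - b), norm_nonneg (Complex.exp (a - b) - 1)]

theorem norm_pow_sub_one_le {z : ℂ} (hz : ‖z‖ = 1) (x : ℕ) : ‖z ^ x - 1‖ ≤ 2 * x := by
  cases x with
  | zero => simp
  | succ x =>
    refine (norm_pow_sub_one_le_two hz _).trans ?_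
    push_cast
    linarith [(Nat.cast_nonneg x : (0 : ℝ) ≤ x)]

theorem norm_expo_le {z : ℂ} (hz : ‖z‖ = 1) (S : Fin n → Fin k) :
    ‖expo m S z‖ ≤ 2 * n / m := by
  rw [expo]
  refine (norm_sum_le _ _).trans ?_
  calc _ ≤ ∑ j, 2 * (histogram S j : ℝ) / m := by
        refine Finset.sum_le_sum fun j _ => ?_
        rw [norm_div, Complex.norm_natCast]
        exact div_le_div_of_nonneg_right (norm_pow_sub_one_le hz _) (by positivity)
    _ = _ := by rw [← Finset.sum_div, ← Finset.mul_sum, ← Nat.cast_sum, sum_histogram]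

/-- Two datasets that both fit a noisy sketch have close anonymized histograms in mean square. -/
theorem sum_sq_tailCount_sub_le (hn : n ≠ 0) (hm : 16 * n ≤ m) (p : Set.Ioo (0 : ℝ) 1)
    {S S' : Fin n → Fin k} {y : Fin m → ℤ} {θ : ℝ} (hS : lightErr p S y ≤ θ)
    (hS' : lightErr p S' y ≤ θ) :
    ∑ v ∈ Finset.range n, ((tailCount S (v + 1) : ℝ) - tailCount S' (v + 1)) ^ 2
      ≤ 16 * (m : ℝ) ^ 2 * θ := by
  have hnR : (0 : ℝ) < n := by positivity
  have hmn : (16 : ℝ) * n ≤ m := by exact_mod_cast hm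
  have hm0 : (0 : ℝ) < m := by linarith
  have hmC : (m : ℂ) ≠ 0 := by exact_mod_cast hm0.ne'
  have hP := parseval hn fun v => ((tailCount S (v + 1) : ℂ) - tailCount S' (v + 1))
  have hcoef : ∀ v, ‖(tailCount S (v + 1) : ℂ) - tailCount S' (v + 1)‖ ^ 2
      = ((tailCount S (v + 1) : ℝ) - tailCount S' (v + 1)) ^ 2 := fun v => by
    have : (tailCount S (v + 1) : ℂ) - tailCount S' (v + 1)
        = (((tailCount S (v + 1) : ℝ) - tailCount S' (v + 1) : ℝ) : ℂ) := by push_cast; rfl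
    rw [this, Complex.norm_real, Real.norm_eq_abs, sq_abs]
  simp only [hcoef] at hP
  have hterm : ∀ t, ‖∑ v ∈ Finset.range n,
      ((tailCount S (v + 1) : ℂ) - tailCount S' (v + 1)) * (zeta n ^ t) ^ v‖ ^ 2
      ≤ 8 * (m : ℝ) ^ 2 * (‖charEst p (zeta n ^ t) y - Complex.exp (expo m S (zeta n ^ t))‖ ^ 2
          / ‖zeta n ^ t - 1‖ ^ 2)
        + 8 * (m : ℝ) ^ 2 * (‖charEst p (zeta n ^ t) y - Complex.exp (expo m S' (zeta n ^ t))‖ ^ 2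
          / ‖zeta n ^ t - 1‖ ^ 2) := by
    intro t
    set z := zeta n ^ t
    have hz : ‖z‖ = 1 := norm_zeta_pow hn t
    -- Nothing is measured at `z = 1`, where the weight is 0, and nothing is needed there: both
    -- families of tail counts sum to `n`.
    rcases eq_or_ne z 1 with h0 | h0
    · rw [h0]
      have h1 : ∑ v ∈ Finset.range n,
          ((tailCount S (v + 1) : ℂ) - tailCount S' (v + 1)) * 1 ^ v = 0 := by
        simp only [one_pow, mul_one]
        rw [Finset.sum_sub_distrib, ← Nat.cast_sum, ← Nat.cast_sum, sum_tailCount, sum_tailCount,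
          sub_self]
      rw [h1]
      simp
    · have hr : 0 < ‖z - 1‖ := norm_pos_iff.2 (sub_ne_zero.2 h0)
      have h1 : ∑ v ∈ Finset.range n,
          ((tailCount S (v + 1) : ℂ) - tailCount S' (v + 1)) * z ^ v
          = m * (expo m S z - expo m S' z) / (z - 1) := by
        simp only [sub_mul]
        rw [Finset.sum_sub_distrib, sum_tailCount_mul_pow S h0, sum_tailCount_mul_pow S' h0, expo,
          expo, ← Finset.sum_div, ← Finset.sum_div]
        field_simp
      -- This is what the size `16 n` of the small table is for.
      have hsmall : 2 * (n : ℝ) / m ≤ 1 / 8 := by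
        rw [div_le_iff₀ hm0]
        linarith
      have h2 := norm_sub_le_two_mul_norm_exp_sub ((norm_expo_le (m := m) hz S).trans hsmall)
        ((norm_expo_le (m := m) hz S').trans hsmall)
      set e := Complex.exp (expo m S z)
      set e' := Complex.exp (expo m S' z)
      set w := charEst p z y
      have h3 : ‖e - e'‖ ≤ ‖w - e‖ + ‖w - e'‖ := by
        have := norm_sub_le (w - e') (w - e)
        rw [sub_sub_sub_cancel_left] at this
        linarith
      have h4 : ‖expo m S z - expo m S' z‖ ^ 2 ≤ 8 * ‖w - e‖ ^ 2 + 8 * ‖w - e'‖ ^ 2 := by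
        have h5 : ‖expo m S z - expo m S' z‖ ≤ 2 * (‖w - e‖ + ‖w - e'‖) := by linarith
        have h6 : ‖expo m S z - expo m S' z‖ ^ 2 ≤ (2 * (‖w - e‖ + ‖w - e'‖)) ^ 2 := by gcongr
        nlinarith [sq_nonneg (‖w - e‖ - ‖w - e'‖)]
      rw [h1, norm_div, norm_mul, Complex.norm_natCast, div_pow, mul_pow, ← mul_div_assoc,
        ← mul_div_assoc, ← add_div]
      refine div_le_div_of_nonneg_right ?_ (by positivity)
      calc (m : ℝ) ^ 2 * ‖expo m S z - expo m S' z‖ ^ 2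
          ≤ (m : ℝ) ^ 2 * (8 * ‖w - e‖ ^ 2 + 8 * ‖w - e'‖ ^ 2) := by gcongr
        _ = _ := by ring
  have hsum := Finset.sum_le_sum fun t (_ : t ∈ Finset.range n) => hterm t
  rw [hP, Finset.sum_add_distrib, ← Finset.mul_sum, ← Finset.mul_sum] at hsum
  rw [lightErr, inv_mul_le_iff₀ hnR] at hS hS'
  have h8 : 0 ≤ 8 * (m : ℝ) ^ 2 := by positivity
  have := mul_le_mul_of_nonneg_left hS h8
  have := mul_le_mul_of_nonneg_left hS' h8
  refine le_of_mul_le_mul_left ?_ hnR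
  linarith

end

section

open MeasureTheory

/-! ### The heavy part of the histogram -/

variable {k n m : ℕ}

/-- The unbiased estimate of the indicator of `v ≤ X` from a noisy value of `X`. -/
def stepEst (p : Set.Ioo (0 : ℝ) 1) (v y : ℤ) : ℝ :=
  (if v ≤ y then 1 else 0) - kap p * ((if y = v - 1 then 1 else 0) - if y = v then 1 else 0)

/-- The unbiased estimate of the number of cells with load at least `v`. -/
def tailEst (p : Set.Ioo (0 : ℝ) 1) (v : ℤ) (y : Fin m → ℤ) : ℝ := ∑ c, stepEst p v (y c)

/-- The weighted square distance between the estimated and the true tail counts, beyond `T`. -/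
def heavyErr (p : Set.Ioo (0 : ℝ) 1) (T : ℕ) (S : Fin n → Fin k) (y : Fin m → ℤ) : ℝ :=
  ∑ v ∈ Finset.Ico T n, ((v : ℝ) + 1) * (tailEst p (v + 1) y - tailCount S (v + 1)) ^ 2

theorem abs_stepEst_le (p : Set.Ioo (0 : ℝ) 1) (v y : ℤ) : |stepEst p v y| ≤ 1 + kap p := by
  have hk := kap_nonneg p
  rw [stepEst, abs_le]
  split_ifs <;> first | omega | constructor <;> linarith

/-- `stepEst` is `1 - κ Δ` applied to a step function, whose second difference is `+1` at `v - 1`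
and `-1` at `v`. -/
theorem integral_stepEst (p : Set.Ioo (0 : ℝ) 1) (v x : ℤ) :
    ∫ t, (stepEst p v (x + t) : ℂ) ∂lapMeasure p = if v ≤ x then 1 else 0 := by
  rw [← integral_lap_deconv p (F := fun y => if v ≤ y then 1 else 0) (B := 1)
    (fun y => by split_ifs <;> simp) x]
  congr 1
  funext t
  have h : (if v ≤ x + t + 1 then (1 : ℂ) else 0) - 2 * (if v ≤ x + t then 1 else 0)
      + (if v ≤ x + t - 1 then 1 else 0)
      = (if x + t = v - 1 then 1 else 0) - if x + t = v then 1 else 0 := by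
    split_ifs <;> first | omega | norm_num
  rw [h, stepEst]
  split_ifs <;> simp

theorem integrable_exp_lap {q : ℝ} (p : Set.Ioo (0 : ℝ) 1) (hp : (p : ℝ) = Real.exp (-q)) :
    Integrable (fun t : ℤ => Real.exp (q / 2 * |(t : ℝ)|)) (lapMeasure p) := by
  refine ⟨StronglyMeasurable.of_discrete.aestronglyMeasurable, ?_⟩
  rw [hasFiniteIntegral_iff_ofReal (ae_of_all _ fun t => (Real.exp_pos _).le)]
  exact (lintegral_lap_exp p hp).trans_lt (by simp)

theorem integral_exp_lap_le {q : ℝ} (p : Set.Ioo (0 : ℝ) 1) (hp : (p : ℝ) = Real.exp (-q)) :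
    ∫ t : ℤ, Real.exp (q / 2 * |(t : ℝ)|) ∂lapMeasure p ≤ 4 := by
  rw [integral_eq_lintegral_of_nonneg_ae (ae_of_all _ fun t => (Real.exp_pos _).le)
    StronglyMeasurable.of_discrete.aestronglyMeasurable]
  exact ENNReal.toReal_le_of_le_ofReal (by norm_num) (by simpa using lintegral_lap_exp p hp)

/-- Noise `t` flips only the levels between `x` and `x + t`, at most `|t|` of them, each of weight
at most `x + |t|`. -/
theorem sum_weighted_step_sub_sq_le (T n x : ℕ) (t : ℤ) :
    ∑ v ∈ Finset.Ico T n, ((v : ℝ) + 1) *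
      ((if (v : ℤ) + 1 ≤ x + t then (1 : ℝ) else 0) - if (v : ℤ) + 1 ≤ x then 1 else 0) ^ 2
      ≤ |(t : ℝ)| * (x + |(t : ℝ)|) := by
  have hpt : ∀ v : ℕ, ((v : ℝ) + 1) *
      ((if (v : ℤ) + 1 ≤ x + t then (1 : ℝ) else 0) - if (v : ℤ) + 1 ≤ x then 1 else 0) ^ 2
      ≤ if min (x : ℤ) (x + t) ≤ v ∧ (v : ℤ) < max (x : ℤ) (x + t) then (x : ℝ) + |(t : ℝ)|
        else 0 := by
    intro v
    by_cases h : min (x : ℤ) (x + t) ≤ v ∧ (v : ℤ) < max (x : ℤ) (x + t)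
    · rw [if_pos h]
      have h1 : (v : ℤ) + 1 ≤ x + |t| := by
        have := le_abs_self t
        have := abs_nonneg t
        omega
      have h2 : (v : ℝ) + 1 ≤ x + |(t : ℝ)| := by exact_mod_cast h1
      have h3 : ((if (v : ℤ) + 1 ≤ x + t then (1 : ℝ) else 0)
          - if (v : ℤ) + 1 ≤ x then 1 else 0) ^ 2 ≤ 1 := by
        split_ifs <;> norm_num
      calc _ ≤ ((v : ℝ) + 1) * 1 := by gcongr
        _ ≤ _ := by linarith
    · rw [if_neg h]
      have : ((v : ℤ) + 1 ≤ x + t) ↔ (v : ℤ) + 1 ≤ x := by omega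
      simp [this]
  refine (Finset.sum_le_sum fun v _ => hpt v).trans ?_
  rw [← Finset.sum_filter, Finset.sum_const, nsmul_eq_mul]
  refine mul_le_mul_of_nonneg_right ?_ (by positivity)
  have hcard : ((Finset.Ico T n).filter fun v : ℕ =>
      min (x : ℤ) (x + t) ≤ v ∧ (v : ℤ) < max (x : ℤ) (x + t)).card
      ≤ (Finset.Ico (min (x : ℤ) (x + t)) (max (x : ℤ) (x + t))).card := by
    refine Finset.card_le_card_of_injOn (fun v : ℕ => (v : ℤ)) (fun v hv => ?_)
      fun a _ b _ h => Nat.cast_injective h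
    simp only [Finset.coe_filter, Set.mem_ofPred_eq] at hv
    simpa using hv.2
  rw [Int.card_Ico] at hcard
  have h1 : (max (x : ℤ) (x + t) - min (x : ℤ) (x + t)).toNat = t.natAbs := by omega
  rw [h1] at hcard
  calc _ ≤ ((t.natAbs : ℕ) : ℝ) := by exact_mod_cast hcard
    _ = _ := by rw [Nat.cast_natAbs, Int.cast_abs]

/-- At most two levels see the spike, and their weights are within one of the noisy value. -/
theorem sum_weighted_spike_sq_le (T n x : ℕ) (t : ℤ) :
    ∑ v ∈ Finset.Ico T n, ((v : ℝ) + 1) *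
      ((if (x : ℤ) + t = v + 1 - 1 then (1 : ℝ) else 0) - if (x : ℤ) + t = v + 1 then 1 else 0) ^ 2
      ≤ 2 * (x + |(t : ℝ)| + 1) := by
  have hone : ∀ f : ℕ → ℤ, Function.Injective f →
      ∑ v ∈ Finset.Ico T n, (if (x : ℤ) + t = f v then (1 : ℝ) else 0) ≤ 1 := by
    intro f hf
    rw [Finset.sum_boole]
    have : ((Finset.Ico T n).filter fun v => (x : ℤ) + t = f v).card ≤ 1 := by
      refine Finset.card_le_one.2 fun a ha b hb => hf ?_
      rw [← (Finset.mem_filter.1 ha).2, ← (Finset.mem_filter.1 hb).2]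
    exact_mod_cast this
  have h1 := hone (fun v => v + 1 - 1) fun a b h => by simpa using h
  have h2 := hone (fun v => v + 1) fun a b h => by simpa using h
  have hpt : ∀ v : ℕ, ((v : ℝ) + 1) *
      ((if (x : ℤ) + t = v + 1 - 1 then (1 : ℝ) else 0) - if (x : ℤ) + t = v + 1 then 1 else 0) ^ 2
      ≤ (x + |(t : ℝ)| + 1) * ((if (x : ℤ) + t = v + 1 - 1 then (1 : ℝ) else 0)
        + if (x : ℤ) + t = v + 1 then 1 else 0) := by
    intro v
    have habs := le_abs_self (t : ℝ)
    split_ifs with h3 h4 h4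
    · omega
    · have : (x : ℝ) + t = v := by
        have : (x : ℤ) + t = v := by omega
        exact_mod_cast this
      norm_num
      linarith
    · have : (x : ℝ) + t = v + 1 := by exact_mod_cast h4
      norm_num
      linarith
    · simp
  refine (Finset.sum_le_sum fun v _ => hpt v).trans ?_
  rw [← Finset.mul_sum, Finset.sum_add_distrib]
  have : 0 ≤ (x : ℝ) + |(t : ℝ)| + 1 := by positivity
  nlinarith

/-- The weighted square error of the step estimates in one cell, beyond `T`. -/
def cellErr (p : Set.Ioo (0 : ℝ) 1) (T n x : ℕ) (t : ℤ) : ℝ :=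
  ∑ v ∈ Finset.Ico T n, ((v : ℝ) + 1) *
    (stepEst p (v + 1) (x + t) - if (v : ℤ) + 1 ≤ x then 1 else 0) ^ 2

theorem cellErr_le (p : Set.Ioo (0 : ℝ) 1) (T n x : ℕ) (t : ℤ) :
    cellErr p T n x t
      ≤ 2 * (|(t : ℝ)| * (x + |(t : ℝ)|)) + 4 * kap p ^ 2 * (x + |(t : ℝ)| + 1) := by
  have h1 := sum_weighted_step_sub_sq_le T n x t
  have h2 := sum_weighted_spike_sq_le T n x t
  calc cellErr p T n x t ≤ ∑ v ∈ Finset.Ico T n, (2 * (((v : ℝ) + 1) *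
        ((if (v : ℤ) + 1 ≤ x + t then (1 : ℝ) else 0) - if (v : ℤ) + 1 ≤ x then 1 else 0) ^ 2)
        + 2 * kap p ^ 2 * (((v : ℝ) + 1) * ((if (x : ℤ) + t = v + 1 - 1 then (1 : ℝ) else 0)
          - if (x : ℤ) + t = v + 1 then 1 else 0) ^ 2)) := by
        refine Finset.sum_le_sum fun v _ => ?_
        rw [stepEst]
        set a := (if (v : ℤ) + 1 ≤ x + t then (1 : ℝ) else 0)
        set b := (if (v : ℤ) + 1 ≤ x then (1 : ℝ) else 0)
        set s := (if (x : ℤ) + t = v + 1 - 1 then (1 : ℝ) else 0)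
          - if (x : ℤ) + t = v + 1 then 1 else 0
        have : (a - kap p * s - b) ^ 2 ≤ 2 * (a - b) ^ 2 + 2 * kap p ^ 2 * s ^ 2 := by
          nlinarith [sq_nonneg (a - b + kap p * s)]
        calc ((v : ℝ) + 1) * (a - kap p * s - b) ^ 2
            ≤ ((v : ℝ) + 1) * (2 * (a - b) ^ 2 + 2 * kap p ^ 2 * s ^ 2) := by gcongr
          _ = _ := by ring
    _ ≤ _ := by
        rw [Finset.sum_add_distrib, ← Finset.mul_sum, ← Finset.mul_sum]
        have h3 := mul_le_mul_of_nonneg_left h2 (by positivity : 0 ≤ 2 * kap p ^ 2)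
        linarith

/-- An empty cell whose noise stays below `T` influences no level beyond `T`. Without this the large
table, with order `n ^ 2` cells, would be far too noisy. -/
theorem cellErr_eq_zero (p : Set.Ioo (0 : ℝ) 1) {T n : ℕ} {t : ℤ} (ht : |(t : ℝ)| < T) :
    cellErr p T n 0 t = 0 := by
  refine Finset.sum_eq_zero fun v hv => ?_
  have hv' := (Finset.mem_Ico.1 hv).1
  have ht' : |t| < T := by exact_mod_cast ht
  have := le_abs_self t
  rw [stepEst, if_neg (by push_cast; omega), if_neg (by push_cast; omega),
    if_neg (by push_cast; omega), if_neg (by push_cast; omega)]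
  simp

/-- The exponential is split into two equal factors. One absorbs the polynomial in `|t|`, leaving
`q⁻⁵`; for an empty cell with `|t| ≥ T` the other is at least `n`, which pays for `1 / n`. This
dictates the 4 in the threshold. -/
theorem cellErr_le_exp {q : ℝ} (hq : 0 < q) (hq1 : q ≤ 1) (p : Set.Ioo (0 : ℝ) 1)
    (hp : (p : ℝ) = Real.exp (-q)) {T n : ℕ} (hn : n ≠ 0) (hT : 4 / q * Real.log n ≤ T) (x : ℕ)
    (t : ℤ) :
    cellErr p T n x t ≤ 96 / q ^ 5 * (x + 1 / n) * Real.exp (q / 2 * |(t : ℝ)|) := by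
  set τ := |(t : ℝ)| with hτ
  have hτ0 : 0 ≤ τ := abs_nonneg _
  have hnR : (0 : ℝ) < n := by positivity
  have hκ : kap p ^ 2 ≤ 1 / q ^ 4 := by
    have h1 := kap_le hq p hp
    have h0 := kap_nonneg p
    calc kap p ^ 2 ≤ (1 / q ^ 2) ^ 2 := by gcongr
      _ = 1 / q ^ 4 := by rw [div_pow]; ring
  set W := 2 * (τ * (1 + τ)) + 4 * kap p ^ 2 * (2 + τ) with hW
  set E := Real.exp (q / 4 * τ) with hE
  have hE2 : Real.exp (q / 2 * τ) = E * E := by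
    rw [hE, ← Real.exp_add]
    ring_nf
  have hE1 : 1 ≤ E := Real.one_le_exp (by positivity)
  have hWE : W ≤ 96 / q ^ 5 * E := by
    have ha : q * τ ≤ 4 * E := by
      have := Real.add_one_le_exp (q / 4 * τ)
      linarith
    have hb : q ^ 2 * τ ^ 2 ≤ 32 * E := by
      have := Real.quadratic_le_exp_of_nonneg (by positivity : 0 ≤ q / 4 * τ)
      rw [← hE] at this
      have h0 : 0 ≤ q * τ := by positivity
      nlinarith
    have hq5 : 0 < q ^ 5 := by positivity
    rw [div_mul_eq_mul_div, le_div_iff₀ hq5]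
    have hκ' : kap p ^ 2 * q ^ 4 ≤ 1 := by
      rwa [le_div_iff₀ (by positivity)] at hκ
    have hq3 : q ^ 3 ≤ 1 := pow_le_one₀ hq.le hq1
    have hq4 : q ^ 4 ≤ 1 := pow_le_one₀ hq.le hq1
    have e1 : 2 * τ * q ^ 5 ≤ 8 * E := by
      calc 2 * τ * q ^ 5 = 2 * (q * τ) * q ^ 4 := by ring
        _ ≤ 2 * (4 * E) * 1 := by gcongr
        _ = _ := by ring
    have e2 : 2 * τ ^ 2 * q ^ 5 ≤ 64 * E := by
      calc 2 * τ ^ 2 * q ^ 5 = 2 * (q ^ 2 * τ ^ 2) * q ^ 3 := by ring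
        _ ≤ 2 * (32 * E) * 1 := by gcongr
        _ = _ := by ring
    have e3 : 8 * kap p ^ 2 * q ^ 5 ≤ 8 * E := by
      calc 8 * kap p ^ 2 * q ^ 5 = 8 * (kap p ^ 2 * q ^ 4) * q := by ring
        _ ≤ 8 * 1 * 1 := by gcongr
        _ ≤ _ := by linarith
    have e4 : 4 * kap p ^ 2 * τ * q ^ 5 ≤ 16 * E := by
      calc 4 * kap p ^ 2 * τ * q ^ 5 = 4 * (kap p ^ 2 * q ^ 4) * (q * τ) := by ring
        _ ≤ 4 * 1 * (4 * E) := by gcongr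
        _ = _ := by ring
    rw [hW]
    linear_combination e1 + e2 + e3 + e4
  rw [hE2]
  have hq5 : 0 < 96 / q ^ 5 := by positivity
  rcases Nat.eq_zero_or_pos x with hx | hx
  · subst hx
    by_cases hlt : τ < T
    · rw [cellErr_eq_zero p hlt]
      positivity
    · push Not at hlt
      have hbig : (n : ℝ) ≤ E := by
        rw [hE, ← Real.log_le_iff_le_exp hnR]
        have h1 : 4 / q * Real.log n ≤ τ := hT.trans hlt
        rw [div_mul_eq_mul_div, div_le_iff₀ hq] at h1
        linarith
      have h1 : cellErr p T n 0 t ≤ W := by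
        refine (cellErr_le p T n 0 t).trans ?_
        rw [hW, ← hτ]
        have : 0 ≤ kap p ^ 2 := by positivity
        push_cast
        nlinarith
      calc cellErr p T n 0 t ≤ 96 / q ^ 5 * E := h1.trans hWE
        _ = 96 / q ^ 5 * (1 / n * (n * E)) := by field_simp
        _ ≤ 96 / q ^ 5 * (1 / n * (E * E)) := by gcongr
        _ = _ := by push_cast; ring
  · have hx1 : (1 : ℝ) ≤ x := by exact_mod_cast hx
    have h1 : cellErr p T n x t ≤ x * W := by
      refine (cellErr_le p T n x t).trans ?_
      rw [hW, ← hτ]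
      have hk : 0 ≤ kap p ^ 2 := by positivity
      have a1 : τ * (x + τ) ≤ x * (τ * (1 + τ)) := by nlinarith [mul_nonneg hτ0 hτ0]
      have a2 : (x : ℝ) + τ + 1 ≤ x * (2 + τ) := by nlinarith
      have a3 := mul_le_mul_of_nonneg_left a2 (by positivity : 0 ≤ 4 * kap p ^ 2)
      linarith
    calc cellErr p T n x t ≤ x * W := h1
      _ ≤ x * (96 / q ^ 5 * E) := by gcongr
      _ ≤ x * (96 / q ^ 5 * (E * E)) := by
          gcongr
          nlinarith
      _ ≤ _ := by
          have : 0 ≤ 96 / q ^ 5 * (1 / n) * (E * E) := by positivity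
          linarith

theorem sum_load (h : Fin k → Fin m) (S : Fin n → Fin k) : ∑ c, load h S c = n := by
  have := Finset.card_eq_sum_card_fiberwise (f := fun i => h (S i)) (s := Finset.univ)
    (t := Finset.univ) (fun _ _ => Finset.mem_univ _)
  simpa [load] using this.symm

/-- Without collisions the nonzero loads are the nonzero multiplicities. Level 0 is excluded, since
empty cells and absent elements need not match in number. -/
theorem tailCount_eq_of_injOn {h : Fin k → Fin m} {S : Fin n → Fin k}
    (hinj : Set.InjOn h (Set.range S)) {v : ℕ} (hv : v ≠ 0) :
    (Finset.univ.filter fun c => v ≤ load h S c).card = tailCount S v := by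
  have hsupp : ∀ j, histogram S j ≠ 0 → j ∈ Set.range S := fun j hj => by
    obtain ⟨i, hi⟩ := Finset.card_pos.1 (Nat.pos_of_ne_zero hj)
    exact ⟨i, (Finset.mem_filter.1 hi).2⟩
  have hload : ∀ j ∈ Set.range S, load h S (h j) = histogram S j := fun j hj => by
    rw [load_eq, Finset.sum_eq_single_of_mem j (Finset.mem_univ j) fun j' _ hne => ?_, if_pos rfl]
    by_cases hj' : histogram S j' = 0
    · rw [hj', ite_self]
    · exact if_neg fun he => hne (hinj (hsupp j' hj') hj he)
  have himg : (Finset.univ.filter fun c => v ≤ load h S c)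
      = (Finset.univ.filter fun j => v ≤ histogram S j).image h := by
    ext c
    simp only [Finset.mem_filter, Finset.mem_univ, true_and, Finset.mem_image]
    constructor
    · intro hc
      obtain ⟨i, hi⟩ := Finset.card_pos.1 ((Nat.pos_of_ne_zero hv).trans_le hc)
      have hi' := (Finset.mem_filter.1 hi).2
      refine ⟨S i, ?_, hi'⟩
      rwa [← hload (S i) ⟨i, rfl⟩, hi']
    · rintro ⟨j, hj, rfl⟩
      rwa [hload j (hsupp j (by omega))]
  rw [himg, Finset.card_image_of_injOn, tailCount]
  intro a ha b hb hab
  simp only [Finset.coe_filter, Finset.mem_univ, true_and, Set.mem_ofPred_eq] at ha hb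
  exact hinj (hsupp a (by omega)) (hsupp b (by omega)) hab

theorem heavyErr_nonneg (p : Set.Ioo (0 : ℝ) 1) (T : ℕ) (S : Fin n → Fin k) (y : Fin m → ℤ) :
    0 ≤ heavyErr p T S y := Finset.sum_nonneg fun v _ => by positivity

theorem integrable_tailEst_sub_sq {C : Type} [Fintype C] (p : Set.Ioo (0 : ℝ) 1) (v : ℤ)
    (a : ℝ) (μ : Measure (C → ℤ)) [IsFiniteMeasure μ] (Y : (C → ℤ) → Fin m → ℤ) :
    Integrable (fun y => (tailEst p v (Y y) - a) ^ 2) μ := by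
  refine integrable_of_norm_le (B := (m * (1 + kap p) + |a|) ^ 2) fun y => ?_
  rw [norm_pow, Real.norm_eq_abs]
  gcongr
  refine (abs_sub _ _).trans (add_le_add ?_ le_rfl)
  refine (Finset.abs_sum_le_sum_abs _ _).trans ?_
  refine (Finset.sum_le_sum fun c _ => abs_stepEst_le p v (Y y c)).trans (le_of_eq ?_)
  rw [Finset.sum_const, Finset.card_univ, Fintype.card_fin, nsmul_eq_mul]

theorem integrable_heavyErr {C : Type} [Fintype C] (p : Set.Ioo (0 : ℝ) 1) (T : ℕ)
    (S : Fin n → Fin k) (μ : Measure (C → ℤ)) [IsFiniteMeasure μ] (Y : (C → ℤ) → Fin m → ℤ) :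
    Integrable (fun y => heavyErr p T S (Y y)) μ :=
  integrable_finsetSum _ fun _ _ => (integrable_tailEst_sub_sq p _ _ μ Y).const_mul _

theorem integral_tailEst_sub_sq {B : Type} [Fintype B] [DecidableEq B] (p : Set.Ioo (0 : ℝ) 1)
    (v : ℤ) (X : Fin m → ℕ) :
    ∫ y, (tailEst p v (fun c => X c + y (Sum.inl c)) - ∑ c, if v ≤ X c then (1 : ℝ) else 0) ^ 2
        ∂(Measure.pi fun _ : Fin m ⊕ B => lapMeasure p)
      = ∑ c, ∫ t, (stepEst p v (X c + t) - if v ≤ X c then 1 else 0) ^ 2 ∂lapMeasure p := by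
  set u : Fin m ⊕ B → ℤ → ℂ := Sum.elim
    (fun c t => ((stepEst p v (X c + t) - if v ≤ X c then 1 else 0 : ℝ) : ℂ)) fun _ _ => 0 with hu
  have hbound : ∀ x t : ℤ, |stepEst p v (x + t)| ≤ 1 + kap p := fun x t => abs_stepEst_le p v _
  have hk := kap_nonneg p
  have h := integral_norm_sq_sum_pi (lapMeasure p) (u := u) (B := 1 + kap p + 1)
    (fun c t => by
      rcases c with c | c
      · simp only [hu, Sum.elim_inl, Complex.norm_real, Real.norm_eq_abs]
        refine (abs_sub _ _).trans (add_le_add (hbound _ _) ?_)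
        split_ifs <;> simp
      · simp only [hu, Sum.elim_inr, norm_zero]
        linarith)
    (fun c => by
      rcases c with c | c
      · simp only [hu, Sum.elim_inl, Complex.ofReal_sub]
        rw [integral_sub (integrable_of_norm_le (B := 1 + kap p) fun t => by
          rw [Complex.norm_real]; exact hbound _ _) (integrable_const _), integral_stepEst]
        split_ifs <;> simp
      · simp [hu])
  have hnorm : ∀ y : Fin m ⊕ B → ℤ, ‖∑ c, u c (y c)‖ ^ 2
      = (tailEst p v (fun c => X c + y (Sum.inl c)) - ∑ c, if v ≤ X c then (1 : ℝ) else 0) ^ 2 := by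
    intro y
    rw [Fintype.sum_sum_type]
    simp only [hu, Sum.elim_inl, Sum.elim_inr, Finset.sum_const_zero, add_zero]
    rw [← Complex.ofReal_sum, Complex.norm_real, Real.norm_eq_abs, sq_abs, Finset.sum_sub_distrib]
    rfl
  simp only [hnorm] at h
  rw [h, Fintype.sum_sum_type]
  simp only [hu, Sum.elim_inl, Sum.elim_inr, Complex.norm_real, Real.norm_eq_abs, sq_abs, norm_zero]
  simp

/-- The expectation of `heavyErr` over the noise, for a hash function without collisions. -/
theorem integral_heavyErr_le {B : Type} [Fintype B] [DecidableEq B] {q : ℝ} (hq : 0 < q)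
    (hq1 : q ≤ 1) (p : Set.Ioo (0 : ℝ) 1) (hp : (p : ℝ) = Real.exp (-q)) {T : ℕ} (hn : n ≠ 0)
    (hT : 4 / q * Real.log n ≤ T) {h : Fin k → Fin m} {S : Fin n → Fin k}
    (hinj : Set.InjOn h (Set.range S)) :
    ∫ y, heavyErr p T S (fun c => load h S c + y (Sum.inl c))
        ∂(Measure.pi fun _ : Fin m ⊕ B => lapMeasure p)
      ≤ 384 / q ^ 5 * (n + m / n) := by
  have htail : ∀ v : ℕ, (tailCount S (v + 1) : ℝ)
      = ∑ c, if (v : ℤ) + 1 ≤ load h S c then (1 : ℝ) else 0 := fun v => by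
    rw [Finset.sum_boole, ← tailCount_eq_of_injOn hinj (Nat.succ_ne_zero v)]
    norm_cast
  have hcint : ∀ (v : ℤ) (c : Fin m), Integrable (fun t =>
      (stepEst p v (load h S c + t) - if v ≤ load h S c then 1 else 0) ^ 2) (lapMeasure p) := by
    intro v c
    refine integrable_of_norm_le (B := (1 + kap p + 1) ^ 2) fun t => ?_
    rw [norm_pow, Real.norm_eq_abs]
    gcongr
    refine (abs_sub _ _).trans (add_le_add (abs_stepEst_le p v _) ?_)
    split_ifs <;> simp
  have hmain : ∫ y, heavyErr p T S (fun c => load h S c + y (Sum.inl c))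
        ∂(Measure.pi fun _ : Fin m ⊕ B => lapMeasure p)
      = ∑ c, ∫ t, cellErr p T n (load h S c) t ∂lapMeasure p := by
    unfold heavyErr cellErr
    rw [integral_finsetSum _ fun v _ => (integrable_tailEst_sub_sq p _ _ _ _).const_mul _]
    have h1 : ∀ c, ∫ t, ∑ v ∈ Finset.Ico T n, ((v : ℝ) + 1) *
        (stepEst p (v + 1) (load h S c + t) - if (v : ℤ) + 1 ≤ load h S c then 1 else 0) ^ 2
          ∂lapMeasure p
        = ∑ v ∈ Finset.Ico T n, ((v : ℝ) + 1) * ∫ t,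
        (stepEst p (v + 1) (load h S c + t) - if (v : ℤ) + 1 ≤ load h S c then 1 else 0) ^ 2
          ∂lapMeasure p := fun c => by
      rw [integral_finsetSum _ fun v _ => (hcint _ c).const_mul _]
      simp only [integral_const_mul]
    simp only [h1]
    rw [Finset.sum_comm]
    refine Finset.sum_congr rfl fun v _ => ?_
    rw [integral_const_mul, htail, integral_tailEst_sub_sq, Finset.mul_sum]
  rw [hmain]
  have hcell : ∀ c, ∫ t, cellErr p T n (load h S c) t ∂lapMeasure p
      ≤ 384 / q ^ 5 * (load h S c + 1 / n) := by
    intro c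
    calc ∫ t, cellErr p T n (load h S c) t ∂lapMeasure p
        ≤ ∫ t : ℤ, 96 / q ^ 5 * (load h S c + 1 / n) * Real.exp (q / 2 * |(t : ℝ)|)
          ∂lapMeasure p := by
          refine integral_mono (integrable_finsetSum _ fun v _ => (hcint _ c).const_mul _)
            ((integrable_exp_lap p hp).const_mul _) fun t => ?_
          exact cellErr_le_exp hq hq1 p hp hn hT _ t
      _ ≤ 96 / q ^ 5 * (load h S c + 1 / n) * 4 := by
          rw [integral_const_mul]
          gcongr
          exact integral_exp_lap_le p hp
      _ = _ := by ring
  refine (Finset.sum_le_sum fun c _ => hcell c).trans (le_of_eq ?_)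
  rw [← Finset.mul_sum, Finset.sum_add_distrib, ← Nat.cast_sum, sum_load,
    Finset.sum_const, Finset.card_univ, Fintype.card_fin, nsmul_eq_mul, mul_one_div]

/-- Overwriting `h j` by an arbitrary cell is injective on colliding functions, since the lost value
can be read off at `j'`. -/
theorem card_collision_mul_le {j j' : Fin k} (hne : j ≠ j') :
    (Finset.univ.filter fun h : Fin k → Fin m => h j = h j').card * m ≤ m ^ k := by
  have := Finset.card_le_card_of_injOn
    (s := (Finset.univ.filter fun h : Fin k → Fin m => h j = h j') ×ˢ (Finset.univ : Finset (Fin m)))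
    (t := (Finset.univ : Finset (Fin k → Fin m)))
    (fun x => Function.update x.1 j x.2) (fun _ _ => Finset.mem_coe.2 (Finset.mem_univ _)) (by
      rintro ⟨h, c⟩ hh ⟨h', c'⟩ hh' he
      simp only [Finset.coe_product, Finset.coe_filter, Finset.mem_univ, true_and, Finset.coe_univ,
        Set.mem_prod, Set.mem_ofPred_eq, Set.mem_univ, and_true] at hh hh'
      simp only at he
      have hc : c = c' := by simpa using congrFun he j
      have ho : ∀ i, i ≠ j → h i = h' i := fun i hi => by simpa [hi] using congrFun he i
      refine Prod.ext (funext fun i => ?_) hc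
      by_cases hi : i = j
      · subst hi
        change h i = h' i
        rw [hh, hh', ho j' hne.symm]
      · exact ho i hi)
  simpa [Finset.card_product] using this

open Classical in
/-- A random hash function into `m` cells has collisions on a dataset of size `n` with probability
at most `n ^ 2 / m`. -/
theorem average_not_injOn_le (hm : m ≠ 0) (S : Fin n → Fin k) :
    ((m : ℝ) ^ k)⁻¹ * ∑ h : Fin k → Fin m, (if Set.InjOn h (Set.range S) then 0 else 1)
      ≤ (n : ℝ) ^ 2 / m := by
  have hmR : (0 : ℝ) < m := by positivity
  have hpt : ∀ h : Fin k → Fin m, (if Set.InjOn h (Set.range S) then (0 : ℝ) else 1)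
      ≤ ∑ x : Fin n × Fin n, if S x.1 ≠ S x.2 ∧ h (S x.1) = h (S x.2) then 1 else 0 := by
    intro h
    split_ifs with hinj
    · exact Finset.sum_nonneg fun x _ => by split_ifs <;> simp
    · simp only [Set.InjOn, Set.mem_range, forall_exists_index, forall_apply_eq_imp_iff] at hinj
      push Not at hinj
      obtain ⟨i, i', he, hne⟩ := hinj
      refine le_trans ?_ (Finset.single_le_sum (f := fun x : Fin n × Fin n =>
        if S x.1 ≠ S x.2 ∧ h (S x.1) = h (S x.2) then (1 : ℝ) else 0)
        (fun x _ => by split_ifs <;> simp) (Finset.mem_univ (i, i')))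
      simp [he, hne]
  have hcount : ∀ x : Fin n × Fin n, ∑ h : Fin k → Fin m,
      (if S x.1 ≠ S x.2 ∧ h (S x.1) = h (S x.2) then (1 : ℝ) else 0) ≤ (m : ℝ) ^ k / m := by
    intro x
    by_cases hne : S x.1 = S x.2
    · simp only [hne, ne_eq, not_true_eq_false, false_and, if_false, Finset.sum_const_zero]
      positivity
    · simp only [ne_eq, hne, not_false_eq_true, true_and]
      rw [Finset.sum_boole, le_div_iff₀ hmR]
      exact_mod_cast card_collision_mul_le hne
  calc _ ≤ ((m : ℝ) ^ k)⁻¹ * ∑ h : Fin k → Fin m, ∑ x : Fin n × Fin n,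
        (if S x.1 ≠ S x.2 ∧ h (S x.1) = h (S x.2) then (1 : ℝ) else 0) := by
        gcongr
        exact hpt _
    _ ≤ ((m : ℝ) ^ k)⁻¹ * ∑ _x : Fin n × Fin n, (m : ℝ) ^ k / m := by
        rw [Finset.sum_comm]
        gcongr
        exact hcount _
    _ = _ := by
        simp
        field_simp

/-- Two datasets that both fit a noisy sketch have close tail counts beyond `T`. -/
theorem sum_weighted_sq_tailCount_sub_le (p : Set.Ioo (0 : ℝ) 1) {T : ℕ} {S S' : Fin n → Fin k}
    {y : Fin m → ℤ} {θ : ℝ} (hS : heavyErr p T S y ≤ θ) (hS' : heavyErr p T S' y ≤ θ) :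
    ∑ v ∈ Finset.Ico T n, ((v : ℝ) + 1) *
      ((tailCount S (v + 1) : ℝ) - tailCount S' (v + 1)) ^ 2 ≤ 4 * θ := by
  have hpt : ∀ v ∈ Finset.Ico T n, ((v : ℝ) + 1) *
      ((tailCount S (v + 1) : ℝ) - tailCount S' (v + 1)) ^ 2
      ≤ 2 * (((v : ℝ) + 1) * (tailEst p (v + 1) y - tailCount S (v + 1)) ^ 2)
        + 2 * (((v : ℝ) + 1) * (tailEst p (v + 1) y - tailCount S' (v + 1)) ^ 2) := by
    intro v _
    set a : ℝ := (tailCount S (v + 1) : ℝ)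
    set b : ℝ := (tailCount S' (v + 1) : ℝ)
    set w := tailEst p (v + 1) y
    have : (a - b) ^ 2 ≤ 2 * (w - a) ^ 2 + 2 * (w - b) ^ 2 := by
      nlinarith [sq_nonneg (2 * w - a - b)]
    calc ((v : ℝ) + 1) * (a - b) ^ 2
        ≤ ((v : ℝ) + 1) * (2 * (w - a) ^ 2 + 2 * (w - b) ^ 2) := by gcongr
      _ = _ := by ring
  have h := Finset.sum_le_sum hpt
  rw [Finset.sum_add_distrib, ← Finset.mul_sum, ← Finset.mul_sum] at h
  rw [heavyErr] at hS hS'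
  linarith

end

section

open MeasureTheory

variable {k n M m : ℕ}

/-! ### Recovering a dataset from a noisy sketch -/

/-- The sum of the cell vectors of a dataset, for a pair of hash functions, collects the loads. -/
theorem sum_unitVec_hash (hA : Fin k → Fin M) (hB : Fin k → Fin m) (S : Fin n → Fin k) :
    ((List.ofFn S).map (unitVec (fun x => Sum.inl (hA x)) fun x => Sum.inr (hB x))).sum
      = Sum.elim (fun c => (load hA S c : ℤ)) fun c => (load hB S c : ℤ) := by
  rw [List.map_ofFn, List.sum_ofFn]
  funext c
  rw [Finset.sum_apply]
  rcases c with c | c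
  · simp [unitVec, load, Pi.single_apply, eq_comm]
  · simp [unitVec, load, Pi.single_apply, eq_comm]

/-- Events of the sketch of a dataset, in terms of the noise. -/
theorem sketch_hash_apply (p : Set.Ioo (0 : ℝ) 1) (hA : Fin k → Fin M) (hB : Fin k → Fin m)
    (S : Fin n → Fin k) (E : Set (Fin M ⊕ Fin m → ℤ)) :
    (sketch p (fun x => Sum.inl (hA x)) (fun x => Sum.inr (hB x))
        (List.ofFn S)).law.toOuterMeasure E
      = (Measure.pi fun _ : Fin M ⊕ Fin m => lapMeasure p)
        {y | (y + Sum.elim (fun c => (load hA S c : ℤ)) fun c => (load hB S c : ℤ)) ∈ E} := by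
  rw [sketch, Conv.law_mul_dirac, sum_unitVec_hash, PMF.toOuterMeasure_map_apply, ← noise_toMeasure,
    PMF.toMeasure_apply_eq_toOuterMeasure]
  rfl

/-- The sketch with values `y` looks like the sketch of `S`. -/
def Fits (p : Set.Ioo (0 : ℝ) 1) (T : ℕ) (a b : ℝ) (y : Fin M ⊕ Fin m → ℤ) (S : Fin n → Fin k) :
    Prop :=
  heavyErr p T S (fun c => y (Sum.inl c)) ≤ a ∧ lightErr p S (fun c => y (Sum.inr c)) ≤ b

theorem sq_sum_abs_light_le (T : ℕ) (d : ℕ → ℝ) :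
    (∑ v ∈ (Finset.range n).filter (· < T), |d v|) ^ 2 ≤ T * ∑ v ∈ Finset.range n, d v ^ 2 := by
  refine sq_sum_le_card_mul_sum_sq.trans ?_
  have hc : ((Finset.range n).filter (· < T)).card ≤ T := by
    refine (Finset.card_le_card (t := Finset.range T) fun v hv => ?_).trans (by simp)
    exact Finset.mem_range.2 (Finset.mem_filter.1 hv).2
  simp only [sq_abs]
  have := Finset.sum_le_sum_of_subset_of_nonneg (Finset.filter_subset (· < T) (Finset.range n))
    (f := fun v => d v ^ 2) fun v _ _ => sq_nonneg _
  gcongr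

/-- Cauchy–Schwarz with weights `1 / (v + 1)`, whose sum is harmonic: only a logarithm is lost,
however many levels there are. -/
theorem sq_sum_abs_heavy_le (T : ℕ) (d : ℕ → ℝ) :
    (∑ v ∈ Finset.Ico T n, |d v|) ^ 2
      ≤ (1 + Real.log n) * ∑ v ∈ Finset.Ico T n, ((v : ℝ) + 1) * d v ^ 2 := by
  refine (Finset.sum_sq_le_sum_mul_sum_of_sq_le_mul _
    (f := fun v : ℕ => ((v : ℝ) + 1)⁻¹) (g := fun v : ℕ => ((v : ℝ) + 1) * d v ^ 2)
    (fun v _ => by positivity) (fun v _ => by positivity) fun v _ => ?_).trans ?_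
  · have : (v : ℝ) + 1 ≠ 0 := by positivity
    rw [sq_abs, inv_mul_cancel_left₀ this]
  · gcongr
    refine le_trans ?_ (harmonic_le_one_add_log n)
    rw [harmonic]
    push_cast
    refine Finset.sum_le_sum_of_subset_of_nonneg (fun v hv => ?_) fun v _ _ => by positivity
    exact Finset.mem_range.2 (Finset.mem_Ico.1 hv).2

/-- The threshold between light and heavy elements. -/
def threshold (q : ℝ) (n : ℕ) : ℕ := ⌈4 / q * Real.log n⌉₊

/-- Two datasets that fit the same noisy sketch are close in the anonymous distance. -/
theorem anonDist_le_of_fits {q : ℝ} (hq : 0 < q) (hq1 : q ≤ 1) (hn : 2 ≤ n)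
    (p : Set.Ioo (0 : ℝ) 1) {y : Fin M ⊕ Fin (16 * n) → ℤ} {S S' : Fin n → Fin k}
    (hS : Fits p (threshold q n) (969600 * n / q ^ 5) (20 / (n * q ^ 4)) y S)
    (hS' : Fits p (threshold q n) (969600 * n / q ^ 5) (20 / (n * q ^ 4)) y S') :
    anonDist S S' ≤ 4000 * √(n * Real.log n / q ^ 5) := by
  have hn0 : (0 : ℝ) < n := by positivity
  have hlog : 0.69 ≤ Real.log n := by
    have h2 : Real.log 2 ≤ Real.log n := Real.log_le_log (by norm_num) (by exact_mod_cast hn)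
    linarith [Real.log_two_gt_d9]
  set d : ℕ → ℝ := fun v => (tailCount S (v + 1) : ℝ) - tailCount S' (v + 1) with hd
  have hL : ∑ v ∈ Finset.range n, d v ^ 2 ≤ 81920 * n / q ^ 4 := by
    refine (sum_sq_tailCount_sub_le (by omega) le_rfl p hS.2 hS'.2).trans (le_of_eq ?_)
    push_cast
    field_simp
    norm_num
  have hH : ∑ v ∈ Finset.Ico (threshold q n) n, ((v : ℝ) + 1) * d v ^ 2
      ≤ 3878400 * n / q ^ 5 := by
    refine (sum_weighted_sq_tailCount_sub_le p hS.1 hS'.1).trans (le_of_eq ?_)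
    ring
  have hT : (threshold q n : ℝ) ≤ 6 * Real.log n / q := by
    have h1 : (threshold q n : ℝ) ≤ 4 / q * Real.log n + 1 :=
      (Nat.ceil_lt_add_one (by positivity)).le
    have h2 : 1 ≤ 2 * Real.log n / q := by
      rw [le_div_iff₀ hq]
      linarith
    calc _ ≤ 4 / q * Real.log n + 2 * Real.log n / q := by linarith
      _ = _ := by ring
  have hr : 0 ≤ n * Real.log n / q ^ 5 := by positivity
  have h1 : ∑ v ∈ (Finset.range n).filter (· < threshold q n), |d v|
      ≤ 800 * √(n * Real.log n / q ^ 5) := by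
    refine abs_le_of_sq_le_sq' ((sq_sum_abs_light_le _ d).trans ?_) (by positivity) |>.2
    rw [mul_pow, Real.sq_sqrt hr]
    calc (threshold q n : ℝ) * ∑ v ∈ Finset.range n, d v ^ 2
        ≤ 6 * Real.log n / q * (81920 * n / q ^ 4) := by gcongr
      _ = 491520 * (n * Real.log n / q ^ 5) := by
          field_simp
          norm_num
      _ ≤ _ := by gcongr; norm_num
  have h2 : ∑ v ∈ Finset.Ico (threshold q n) n, |d v| ≤ 3200 * √(n * Real.log n / q ^ 5) := by
    refine abs_le_of_sq_le_sq' ((sq_sum_abs_heavy_le _ d).trans ?_) (by positivity) |>.2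
    rw [mul_pow, Real.sq_sqrt hr]
    calc (1 + Real.log n) * ∑ v ∈ Finset.Ico (threshold q n) n, ((v : ℝ) + 1) * d v ^ 2
        ≤ 2.5 * Real.log n * (3878400 * n / q ^ 5) := by
          gcongr
          linarith
      _ = 9696000 * (n * Real.log n / q ^ 5) := by
          ring
      _ ≤ _ := by gcongr; norm_num
  have hsplit : anonDist S S' = ∑ v ∈ (Finset.range n).filter (· < threshold q n), |d v|
      + ∑ v ∈ Finset.Ico (threshold q n) n, |d v| := by
    rw [anonDist, ← Finset.sum_filter_add_sum_filter_not _ (· < threshold q n)]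
    congr 2
    ext v
    simp only [Finset.mem_filter, Finset.mem_range, Finset.mem_Ico]
    omega
  linarith

/-- Markov's inequality for the light error, averaged over the hash functions. -/
theorem average_lightErr_gt_le {A : Type} [Fintype A] [DecidableEq A] {q : ℝ} (hq : 0 < q)
    (hq1 : q ≤ 1) (hn : n ≠ 0) (p : Set.Ioo (0 : ℝ) 1) (hp : (p : ℝ) = Real.exp (-q))
    (S : Fin n → Fin k) :
    (((16 * n : ℕ) : ℝ) ^ k)⁻¹ * ∑ h : Fin k → Fin (16 * n),
      (Measure.pi fun _ : A ⊕ Fin (16 * n) => lapMeasure p).real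
        {y | 20 / (n * q ^ 4) < lightErr p S (fun c => load h S c + y (Sum.inr c))} ≤ 0.05 := by
  have hn0 : (0 : ℝ) < n := by positivity
  have hm : 4 ≤ 16 * n := by omega
  have havg := average_integral_lightErr_le (A := A) hm hn p S
  have hk := kap_le hq p hp
  have hk0 := kap_nonneg p
  -- The expected light error is at most `1 / (n q ^ 4)`. The tolerance is twenty times that, so
  -- Markov gives 0.05.
  have hbound : 2 * (((16 * n : ℕ) : ℝ)⁻¹ * (2 * kap p + 4 * kap p ^ 2))
      + 14 * (n / ((16 * n : ℕ) : ℝ) ^ 2) ≤ 1 / (n * q ^ 4) := by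
    have hq4 : 1 ≤ 1 / q ^ 4 := by
      rw [le_div_iff₀ (by positivity)]
      simpa using pow_le_one₀ hq.le hq1
    have hkq : kap p ≤ 1 / q ^ 4 := by
      refine hk.trans ?_
      exact one_div_le_one_div_of_le (by positivity) (pow_le_pow_of_le_one hq.le hq1 (by norm_num))
    have hkk : kap p ^ 2 ≤ 1 / q ^ 4 := by
      calc kap p ^ 2 ≤ (1 / q ^ 2) ^ 2 := by gcongr
        _ = _ := by ring
    push_cast
    calc 2 * ((16 * (n : ℝ))⁻¹ * (2 * kap p + 4 * kap p ^ 2)) + 14 * (n / (16 * (n : ℝ)) ^ 2)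
        = (n : ℝ)⁻¹ * ((2 * kap p + 4 * kap p ^ 2) / 8 + 14 / 256 * 1) := by
          field_simp
          ring
      _ ≤ (n : ℝ)⁻¹ * ((2 * (1 / q ^ 4) + 4 * (1 / q ^ 4)) / 8 + 14 / 256 * (1 / q ^ 4)) := by
          gcongr
      _ ≤ (n : ℝ)⁻¹ * (1 / q ^ 4) := by
          gcongr
          linarith
      _ = _ := by
          field_simp
  have hmark : ∀ h : Fin k → Fin (16 * n),
      (Measure.pi fun _ : A ⊕ Fin (16 * n) => lapMeasure p).real
        {y | 20 / (n * q ^ 4) < lightErr p S (fun c => load h S c + y (Sum.inr c))}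
      ≤ n * q ^ 4 / 20 * ∫ y, lightErr p S (fun c => load h S c + y (Sum.inr c))
        ∂(Measure.pi fun _ : A ⊕ Fin (16 * n) => lapMeasure p) := by
    intro h
    have hM := mul_meas_ge_le_integral_of_nonneg (ae_of_all _ fun y => lightErr_nonneg p S _)
      (integrable_lightErr p (by omega) hn S
        (Measure.pi fun _ : A ⊕ Fin (16 * n) => lapMeasure p)
        fun y c => load h S c + y (Sum.inr c)) (20 / (n * q ^ 4))
    rw [div_mul_eq_mul_div, div_le_iff₀ (by positivity)] at hM
    rw [div_mul_eq_mul_div, le_div_iff₀ (by norm_num)]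
    refine le_trans ?_ (hM.trans_eq (mul_comm _ _))
    rw [mul_comm]
    refine mul_le_mul_of_nonneg_left (measureReal_mono fun y hy => ?_) (by positivity)
    simp only [Set.mem_ofPred_eq] at hy ⊢
    exact hy.le
  calc _ ≤ (((16 * n : ℕ) : ℝ) ^ k)⁻¹ * ∑ h : Fin k → Fin (16 * n), n * q ^ 4 / 20 *
        ∫ y, lightErr p S (fun c => load h S c + y (Sum.inr c))
          ∂(Measure.pi fun _ : A ⊕ Fin (16 * n) => lapMeasure p) := by
        gcongr
        exact hmark _
    _ = n * q ^ 4 / 20 * ((((16 * n : ℕ) : ℝ) ^ k)⁻¹ * ∑ h : Fin k → Fin (16 * n),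
        ∫ y, lightErr p S (fun c => load h S c + y (Sum.inr c))
          ∂(Measure.pi fun _ : A ⊕ Fin (16 * n) => lapMeasure p)) := by
        rw [← Finset.mul_sum]
        ring
    _ ≤ n * q ^ 4 / 20 * (1 / (n * q ^ 4)) := by
        gcongr
        exact havg.trans hbound
    _ = 0.05 := by
        field_simp
        norm_num

/-- Markov's inequality for the heavy error, averaged over the hash functions. -/
theorem average_heavyErr_gt_le {B : Type} [Fintype B] [DecidableEq B] {q : ℝ} (hq : 0 < q)
    (hq1 : q ≤ 1) (hn : n ≠ 0) (p : Set.Ioo (0 : ℝ) 1) (hp : (p : ℝ) = Real.exp (-q))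
    (S : Fin n → Fin k) :
    (((100 * n ^ 2 : ℕ) : ℝ) ^ k)⁻¹ * ∑ h : Fin k → Fin (100 * n ^ 2),
      (Measure.pi fun _ : Fin (100 * n ^ 2) ⊕ B => lapMeasure p).real
        {y | 969600 * n / q ^ 5
          < heavyErr p (threshold q n) S (fun c => load h S c + y (Sum.inl c))} ≤ 0.05 := by
  classical
  have hn0 : (0 : ℝ) < n := by positivity
  have hM0 : 100 * n ^ 2 ≠ 0 := by positivity
  have hmark : ∀ h : Fin k → Fin (100 * n ^ 2),
      (Measure.pi fun _ : Fin (100 * n ^ 2) ⊕ B => lapMeasure p).real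
        {y | 969600 * n / q ^ 5
          < heavyErr p (threshold q n) S (fun c => load h S c + y (Sum.inl c))}
      ≤ (if Set.InjOn h (Set.range S) then 0 else 1) + 0.04 := by
    intro h
    split_ifs with hinj
    · have hM := mul_meas_ge_le_integral_of_nonneg (ae_of_all _ fun y => heavyErr_nonneg p _ S _)
        (integrable_heavyErr p (threshold q n) S
          (Measure.pi fun _ : Fin (100 * n ^ 2) ⊕ B => lapMeasure p)
          fun y c => load h S c + y (Sum.inl c)) (969600 * n / q ^ 5)
      -- With `100 n ^ 2` cells the expectation is at most `384 * 101 n / q ^ 5`, which is 0.04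
      -- times the tolerance; collisions account for the remaining 0.01.
      have hI := integral_heavyErr_le (B := B) hq hq1 p hp hn (Nat.le_ceil _) hinj
      have h1 : 969600 * n / q ^ 5 * (Measure.pi fun _ : Fin (100 * n ^ 2) ⊕ B =>
          lapMeasure p).real {y | 969600 * n / q ^ 5
            < heavyErr p (threshold q n) S (fun c => load h S c + y (Sum.inl c))}
          ≤ 969600 * n / q ^ 5 * 0.04 := by
        refine le_trans ?_ ((hM.trans hI).trans (le_of_eq ?_))
        · refine mul_le_mul_of_nonneg_left (measureReal_mono fun y hy => ?_) (by positivity)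
          simp only [Set.mem_ofPred_eq] at hy ⊢
          exact hy.le
        · push_cast
          field_simp
          norm_num
      rw [zero_add]
      exact le_of_mul_le_mul_left h1 (by positivity)
    · exact measureReal_le_one.trans (by norm_num)
  calc _ ≤ (((100 * n ^ 2 : ℕ) : ℝ) ^ k)⁻¹ * ∑ h : Fin k → Fin (100 * n ^ 2),
        ((if Set.InjOn h (Set.range S) then 0 else 1) + 0.04) := by
        gcongr
        exact hmark _
    _ = (((100 * n ^ 2 : ℕ) : ℝ) ^ k)⁻¹ * ∑ h : Fin k → Fin (100 * n ^ 2),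
        (if Set.InjOn h (Set.range S) then 0 else 1) + 0.04 := by
        have : (((100 * n ^ 2 : ℕ) : ℝ) ^ k) ≠ 0 := by positivity
        rw [Finset.sum_add_distrib, mul_add, Finset.sum_const, Finset.card_univ, Fintype.card_fun,
          Fintype.card_fin, Fintype.card_fin, nsmul_eq_mul, Nat.cast_pow, inv_mul_cancel_left₀ this]
    _ ≤ (n : ℝ) ^ 2 / (100 * n ^ 2 : ℕ) + 0.04 := by
        gcongr
        exact average_not_injOn_le hM0 S
    _ = 0.05 := by
        push_cast
        field_simp
        norm_num

end

/-! ### The decoder and the accuracy of the mechanisms -/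

section

open MeasureTheory

variable {k n : ℕ}

/-- Pairs of hash functions, into `100 n ^ 2` cells and into `16 n` cells. -/
abbrev HashPair (k n : ℕ) : Type := (Fin k → Fin (100 * n ^ 2)) × (Fin k → Fin (16 * n))

/-- The cells of the sketch. -/
abbrev Cell (n : ℕ) : Type := Fin (100 * n ^ 2) ⊕ Fin (16 * n)

/-- The cell of the first hash function. -/
def cellA (w : HashPair k n) (x : Fin k) : Cell n := Sum.inl (w.1 x)

/-- The cell of the second hash function. -/
def cellB (w : HashPair k n) (x : Fin k) : Cell n := Sum.inr (w.2 x)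

/-- The sketch with values `y` looks like the sketch of `S`, up to the expected noise. -/
def FitsNoise (q : ℝ) (p : Set.Ioo (0 : ℝ) 1) (y : Cell n → ℤ) (S : Fin n → Fin k) : Prop :=
  Fits p (threshold q n) (969600 * n / q ^ 5) (20 / (n * q ^ 4)) y S

/-- The noisy sketch of a dataset fits the dataset, except with small probability. -/
theorem tsum_not_fits_le [NeZero n] {q : ℝ} (hq : 0 < q) (hq1 : q ≤ 1) (p : Set.Ioo (0 : ℝ) 1)
    (hp : (p : ℝ) = Real.exp (-q)) (S : Fin n → Fin k) :
    ∑' w : HashPair k n, PMF.uniformOfFintype (HashPair k n) w *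
      (sketch p (cellA w) (cellB w) (List.ofFn S)).law.toOuterMeasure {y | ¬ FitsNoise q p y S}
      ≤ ENNReal.ofReal 0.1 := by
  have hn : n ≠ 0 := NeZero.ne n
  set μ : Measure (Cell n → ℤ) := Measure.pi fun _ => lapMeasure p with hμ
  set H : (Fin k → Fin (100 * n ^ 2)) → ℝ := fun h => μ.real {y | 969600 * n / q ^ 5
    < heavyErr p (threshold q n) S (fun c => load h S c + y (Sum.inl c))} with hH
  set L : (Fin k → Fin (16 * n)) → ℝ := fun h => μ.real {y | 20 / (n * q ^ 4)
    < lightErr p S (fun c => load h S c + y (Sum.inr c))} with hL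
  set a : ℝ := ((100 * n ^ 2 : ℕ) : ℝ) ^ k with ha
  set b : ℝ := ((16 * n : ℕ) : ℝ) ^ k with hb
  have ha0 : 0 < a := by positivity
  have hb0 : 0 < b := by positivity
  have hsumH : a⁻¹ * ∑ h, H h ≤ 0.05 := average_heavyErr_gt_le hq hq1 hn p hp S
  have hsumL : b⁻¹ * ∑ h, L h ≤ 0.05 := average_lightErr_gt_le hq hq1 hn p hp S
  have hterm : ∀ w : HashPair k n, PMF.uniformOfFintype (HashPair k n) w *
      (sketch p (cellA w) (cellB w) (List.ofFn S)).law.toOuterMeasure {y | ¬ FitsNoise q p y S}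
      ≤ ENNReal.ofReal ((a * b)⁻¹ * (H w.1 + L w.2)) := by
    intro w
    have hcard : PMF.uniformOfFintype (HashPair k n) w = ENNReal.ofReal (a * b)⁻¹ := by
      rw [PMF.uniformOfFintype_apply, ENNReal.ofReal_inv_of_pos (by positivity),
        ← ENNReal.ofReal_natCast]
      simp [a, b]
    rw [hcard, ENNReal.ofReal_mul (by positivity)]
    gcongr
    have hs := sketch_hash_apply p w.1 w.2 S {y | ¬ FitsNoise q p y S}
    refine hs.trans_le ?_
    rw [ENNReal.ofReal_add measureReal_nonneg measureReal_nonneg, ofReal_measureReal,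
      ofReal_measureReal]
    refine (measure_mono fun y hy => ?_).trans (measure_union_le _ _)
    by_contra hc
    simp only [Set.mem_union, Set.mem_ofPred_eq, not_or, not_lt] at hc
    refine hy ⟨?_, ?_⟩
    · simpa [add_comm] using hc.1
    · simpa [add_comm] using hc.2
  rw [tsum_fintype]
  refine (Finset.sum_le_sum fun w _ => hterm w).trans ?_
  rw [← ENNReal.ofReal_sum_of_nonneg fun w _ =>
    mul_nonneg (by positivity) (add_nonneg measureReal_nonneg measureReal_nonneg)]
  refine ENNReal.ofReal_le_ofReal ?_
  have hsplit : ∑ w : HashPair k n, (a * b)⁻¹ * (H w.1 + L w.2)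
      = a⁻¹ * ∑ h, H h + b⁻¹ * ∑ h, L h := by
    rw [← Finset.mul_sum, Fintype.sum_prod_type]
    simp only [Finset.sum_add_distrib, Finset.sum_const, Finset.card_univ, Fintype.card_fun,
      Fintype.card_fin, nsmul_eq_mul, ← Finset.mul_sum, Nat.cast_pow]
    rw [← ha, ← hb]
    field_simp
  rw [hsplit]
  linarith

open Classical in
/-- The estimate of `g` at some dataset that fits the sketch. -/
def decode (g : Estimator k) (q : ℝ) (p : Set.Ioo (0 : ℝ) 1) (y : Cell n → ℤ) : ℝ :=
  if h : ∃ S : Fin n → Fin k, FitsNoise q p y S then g n h.choose else 0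

/-- The answer computed from the noisy sketch is close to the estimate of `g`. -/
theorem sketchAnswer_decode_le [NeZero n] (hn : 2 ≤ n) {q β : ℝ} (hq : 0 < q) (hq1 : q ≤ 1)
    (p : Set.Ioo (0 : ℝ) 1) (hp : (p : ℝ) = Real.exp (-q)) (g : Estimator k) (hg : g.IsSymmetric)
    (hβ : g.sensitivity n * (4000 * √(n * Real.log n / q ^ 5)) ≤ β) (S : Fin n → Fin k) :
    (sketchAnswer p (PMF.uniformOfFintype (HashPair k n)) cellA cellB (fun _ => decode g q p)
      (List.ofFn S)).toOuterMeasure {z | β < |z - g n S|} ≤ ENNReal.ofReal 0.1 := by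
  rw [sketchAnswer, PMF.toOuterMeasure_bind_apply]
  refine le_trans (ENNReal.tsum_le_tsum fun w => ?_) (tsum_not_fits_le hq hq1 p hp S)
  rw [PMF.toOuterMeasure_map_apply]
  gcongr
  intro y hy hfit
  -- The decoder need not find `S` itself: when `S` fits, a choice exists, and any two fits are
  -- close enough for `g`.
  have hex : ∃ S' : Fin n → Fin k, FitsNoise q p y S' := ⟨S, hfit⟩
  have hdec : decode g q p y = g n hex.choose := dif_pos hex
  have hlt : β < |decode g q p y - g n S| := hy
  rw [hdec] at hlt
  refine absurd hlt (not_lt.2 ((g.abs_sub_le_anonDist hg _ _).trans (le_trans ?_ hβ)))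
  exact mul_le_mul_of_nonneg_left (anonDist_le_of_fits hq hq1 hn p hex.choose_spec hfit)
    (g.sensitivity_nonneg n)

/-- A mechanism whose answer is close to an accurate estimator is accurate. -/
theorem estimates_of_isAccurate {g : Estimator k} {f : PMF (Fin k) → ℝ} {α : ℝ}
    (hacc : g.IsAccurate f (α / 2) n) {M : (Fin n → Fin k) → PMF ℝ}
    (hM : ∀ S, (M S).toOuterMeasure {z | α / 2 < |z - g n S|} ≤ ENNReal.ofReal 0.1) :
    Estimates M f α := by
  intro D
  have hD := hacc D
  rw [PMF.toOuterMeasure_bind_apply]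
  set E : Set (Fin n → Fin k) := {S | α / 2 < |g n S - f D|} with hE
  have hpt : ∀ S, iid D n S * (M S).toOuterMeasure {z | α < |z - f D|}
      ≤ E.indicator (iid D n) S + iid D n S * ENNReal.ofReal 0.1 := by
    intro S
    by_cases hS : S ∈ E
    · rw [Set.indicator_of_mem hS]
      refine le_add_right ?_
      calc _ ≤ iid D n S * 1 := by
            gcongr
            exact ((M S).toOuterMeasure.mono (Set.subset_univ _)).trans_eq
              (((M S).toOuterMeasure_apply_eq_one_iff _).2 (Set.subset_univ _))
        _ = _ := mul_one _
    · refine le_add_left ?_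
      gcongr
      refine le_trans ((M S).toOuterMeasure.mono fun z hz => ?_) (hM S)
      have hz' : α < |z - f D| := hz
      have hS' : |g n S - f D| ≤ α / 2 := not_lt.1 hS
      have := abs_sub_le z (g n S) (f D)
      change α / 2 < |z - g n S|
      linarith
  refine (ENNReal.tsum_le_tsum hpt).trans_lt ?_
  rw [ENNReal.tsum_add, ENNReal.tsum_mul_right, PMF.tsum_coe, one_mul, ← PMF.toOuterMeasure_apply]
  calc _ < ENNReal.ofReal 0.1 + ENNReal.ofReal 0.1 :=
        ENNReal.add_lt_add_right ENNReal.ofReal_ne_top hD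
    _ = ENNReal.ofReal 0.2 := by
        rw [← ENNReal.ofReal_add (by norm_num) (by norm_num)]
        norm_num

/-- Extracting the bound from a sample complexity. -/
theorem of_iInf_le {Q : ℕ → Prop} (h : (⨅ (N : ℕ) (_ : ∀ i, N ≤ i → Q i), (N : ℕ∞)) ≤ n) :
    Q n := by
  -- Comparing strictly with `n + 1` makes the infimum yield an actual admissible `N ≤ n`, and rules
  -- out the value `⊤`.
  have h1 : (⨅ (N : ℕ) (_ : ∀ i, N ≤ i → Q i), (N : ℕ∞)) < (n + 1 : ℕ) :=
    h.trans_lt (by exact_mod_cast Nat.lt_succ_self n)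
  simp only [iInf_lt_iff] at h1
  obtain ⟨N, hN, hlt⟩ := h1
  exact hN n (by have : N < n + 1 := by exact_mod_cast hlt
                 omega)

theorem IsDP.mono {X R : Type*} {ε ε' δ : ℝ} {M : (Fin n → X) → PMF R} (h : IsDP ε δ M)
    (hε : ε ≤ ε') : IsDP ε' δ M := fun S S' hS E => by
  refine (h S S' hS E).trans ?_
  gcongr

theorem isDP_const {X R : Type*} {ε δ : ℝ} (hε : 0 ≤ ε) (r : PMF R) :
    IsDP ε δ fun _ : Fin n → X => r := fun _ _ _ E => by
  refine le_add_right ?_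
  calc r.toOuterMeasure E = 1 * r.toOuterMeasure E := (one_mul _).symm
    _ ≤ _ := by
      gcongr
      simpa using hε

theorem exists_const_stream (X : Type) {ε : ℝ} (hε : 0 ≤ ε) (r : ℝ) :
    ∃ A : StreamAlg X, A.IsPanPrivate ε ∧ ∀ {n : ℕ} (S : Fin n → X), A.run S = PMF.pure r := by
  let A : StreamAlg X := ⟨Unit, PMF.pure (), fun _ _ => PMF.pure (), fun _ => PMF.pure r⟩
  have hlaw : ∀ l : List X, A.stateLaw l = PMF.pure () := fun l => by
    induction l using List.reverseRecOn with
    | nil => rfl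
    | append_singleton l x ih =>
      rw [StreamAlg.stateLaw, List.foldl_append] at *
      simp [A]
  refine ⟨A, fun t => ?_, fun S => ?_⟩
  · simp only [hlaw]
    exact isDP_const hε _
  · rw [StreamAlg.run, hlaw, PMF.pure_bind]

theorem exists_const_shuffle (X : Type) {ε δ : ℝ} (hε : 0 ≤ ε) (r : ℝ) :
    ∃ P : ShuffleProtocol X, (∀ n, P.IsShuffleDP n ε δ) ∧
      ∀ {n : ℕ} (S : Fin n → X), P.run S = PMF.pure r := by
  let P : ShuffleProtocol X := ⟨Unit, PMF.pure (), Unit, fun _ _ => PMF.pure 0, fun _ _ => PMF.pure r⟩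
  have hlaw : ∀ (w : Unit) (l : List X), P.shuffled w l = PMF.pure 0 := fun w l => by
    induction l with
    | nil => rfl
    | cons x l ih =>
      rw [ShuffleProtocol.shuffled, ih]
      simp [P, PMF.pure_map]
  refine ⟨P, fun n w => ?_, fun S => ?_⟩
  · have : (fun S : Fin n → X => P.shuffled w (List.ofFn S)) = fun _ => PMF.pure 0 :=
      funext fun S => hlaw w _
    rw [this]
    exact isDP_const hε _
  · rw [ShuffleProtocol.run, PMF.pure_bind, hlaw, PMF.pure_bind]

/-- The accuracy of the sketch, in terms of `errBound`. -/
theorem sqrt_div_le_errBound {b ε : ℝ} (hb : 0 < b) (hε : 0 < ε) (hn : 2 ≤ n) :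
    4000 * √(n * Real.log n / (ε / (4 * b)) ^ 5)
      ≤ errBound (8000 * (4 * b) ^ (5 / 2 : ℝ)) n ε := by
  have hlog : 1 / 16 ≤ Real.log n := by
    have h2 : Real.log 2 ≤ Real.log n := Real.log_le_log (by norm_num) (by exact_mod_cast hn)
    linarith [Real.log_two_gt_d9]
  have hl : 0 < Real.log n := by linarith
  have h52 : ∀ x : ℝ, 0 < x → √(x ^ 5) = x ^ (5 / 2 : ℝ) := fun x hx => by
    rw [Real.sqrt_eq_rpow, ← Real.rpow_natCast, ← Real.rpow_mul hx.le]
    norm_num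
  -- Since `log n ≥ 1 / 16`, the extra factor `(log n) ^ (1/4)` is at least `1 / 2`. This turns 4000
  -- into 8000.
  have hroot : √(Real.log n) ≤ 2 * Real.log n ^ (3 / 4 : ℝ) := by
    have h4 : (1 / 2 : ℝ) ≤ Real.log n ^ (1 / 4 : ℝ) := by
      calc (1 / 2 : ℝ) = (1 / 16 : ℝ) ^ (1 / 4 : ℝ) := by
            rw [show (1 / 16 : ℝ) = (1 / 2) ^ (4 : ℕ) by norm_num, ← Real.rpow_natCast,
              ← Real.rpow_mul (by norm_num)]
            norm_num
        _ ≤ _ := by gcongr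
    have h34 : Real.log n ^ (3 / 4 : ℝ) = √(Real.log n) * Real.log n ^ (1 / 4 : ℝ) := by
      rw [Real.sqrt_eq_rpow, ← Real.rpow_add hl]
      norm_num
    rw [h34]
    nlinarith [Real.sqrt_nonneg (Real.log n)]
  rw [Real.sqrt_div' _ (by positivity), h52 _ (by positivity), Real.sqrt_mul (by positivity),
    Real.div_rpow hε.le (by positivity), errBound, div_div_eq_mul_div, ← mul_div_assoc]
  gcongr ?_ / _
  calc _ = 4000 * (4 * b) ^ (5 / 2 : ℝ) * √(n : ℝ) * √(Real.log n) := by ring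
    _ ≤ 4000 * (4 * b) ^ (5 / 2 : ℝ) * √(n : ℝ) * (2 * Real.log n ^ (3 / 4 : ℝ)) := by gcongr
    _ = _ := by ring

/-- For `n ≤ 1` all datasets have anonymous distance zero, so a constant answer reproduces `g`
exactly and is private for free. -/
theorem Estimator.exists_eq_of_le_one (g : Estimator k) (hg : g.IsSymmetric) (hn : n ≤ 1) :
    ∃ r : ℝ, ∀ S : Fin n → Fin k, g n S = r := by
  by_cases h : Nonempty (Fin n → Fin k)
  · obtain ⟨S₀⟩ := h
    refine ⟨g n S₀, fun S => ?_⟩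
    have := g.abs_sub_le_anonDist hg S S₀
    rw [anonDist_eq_zero_of_le_one hn, mul_zero] at this
    exact sub_eq_zero.1 (abs_nonpos_iff.1 this)
  · exact ⟨0, fun S => (h ⟨S⟩).elim⟩

end

end SymmEst

end

theorem theorem5p1 (ε₀ : ℝ) (hε₀ : 0 < ε₀) :
    ∃ c : ℝ, 0 < c ∧ ∃ K : ℕ, 0 < K ∧
      ∀ (ε δ α : ℝ), 0 < ε → ε ≤ ε₀ → 0 < δ → δ ≤ 1 → 0 < α →
      ∀ (k : ℕ) (f : PMF (Fin k) → ℝ), SymmEst.IsSymmetricProperty f →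
      ∀ g : SymmEst.Estimator k, g.IsSymmetric →
      ∀ n : ℕ,
        (K : ℕ∞) * (g.sampleComplexity f (α / 2) + g.sensitivityComplexity c (α / 2) ε) ≤ n →
        (∃ A : SymmEst.StreamAlg (Fin k),
          A.IsPanPrivate ε ∧ SymmEst.Estimates (n := n) A.run f α) ∧
        (∃ P : SymmEst.ShuffleProtocol (Fin k),
          P.IsShuffleDP n ε δ ∧ SymmEst.Estimates (n := n) P.run f α) := by
  set b : ℝ := max 1 ε₀
  have hb1 : 1 ≤ b := le_max_left _ _
  have hb : 0 < b := by linarith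
  -- The constant comes from `sqrt_div_le_errBound`, with `b` making both `q ≤ 1` and `4 q ≤ ε`
  -- hold. One batch of samples serves estimation and privacy, so `K = 1`.
  refine ⟨8000 * (4 * b) ^ (5 / 2 : ℝ), by positivity, 1, one_pos, ?_⟩
  intro ε δ α hε hεε₀ hδ _ hα k f _ g hg n hnK
  rw [Nat.cast_one, one_mul] at hnK
  have hacc : g.IsAccurate f (α / 2) n := SymmEst.of_iInf_le (le_self_add.trans hnK)
  have hsens := SymmEst.of_iInf_le
    (Q := fun i => g.sensitivity i * SymmEst.errBound (8000 * (4 * b) ^ (5 / 2 : ℝ)) i ε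
      ≤ 0.1 * (α / 2)) (le_add_self.trans hnK)
  rcases le_or_gt n 1 with hn | hn
  · obtain ⟨r, hr⟩ := g.exists_eq_of_le_one hg hn
    have hclose : ∀ S : Fin n → Fin k,
        (PMF.pure r).toOuterMeasure {z | α / 2 < |z - g n S|} ≤ ENNReal.ofReal 0.1 := by
      intro S
      rw [PMF.toOuterMeasure_pure_apply, if_neg]
      · exact zero_le
      · simpa [hr S] using by linarith
    obtain ⟨A, hA, hrun⟩ := SymmEst.exists_const_stream (Fin k) hε.le r
    obtain ⟨P, hP, hrun'⟩ := SymmEst.exists_const_shuffle (Fin k) (δ := δ) hε.le r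
    exact ⟨⟨A, hA, SymmEst.estimates_of_isAccurate hacc fun S => by rw [hrun]; exact hclose S⟩,
      ⟨P, hP n, SymmEst.estimates_of_isAccurate hacc fun S => by rw [hrun']; exact hclose S⟩⟩
  · have hn0 : n ≠ 0 := by omega
    have : NeZero n := ⟨hn0⟩
    set q : ℝ := ε / (4 * b) with hqdef
    have hq : 0 < q := by positivity
    have hqε : 4 * q ≤ ε := by
      have : 4 * q = ε / b := by rw [hqdef]; field_simp
      rw [this]
      exact div_le_self hε.le hb1
    have hq1 : q ≤ 1 := by
      rw [hqdef, div_le_one (by positivity)]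
      linarith [le_max_right (1 : ℝ) ε₀, show ε₀ ≤ b from le_max_right _ _]
    obtain ⟨p, hp⟩ : ∃ p : Set.Ioo (0 : ℝ) 1, (p : ℝ) = Real.exp (-q) :=
      ⟨⟨_, Real.exp_pos _, by simpa using hq⟩, rfl⟩
    -- This has room to spare: the hypothesis gives a tenth of `α / 2`, and `α / 2` is the share of
    -- the error left for the mechanism.
    have hβ : g.sensitivity n * (4000 * √(n * Real.log n / q ^ 5)) ≤ α / 2 := by
      refine (mul_le_mul_of_nonneg_left (SymmEst.sqrt_div_le_errBound hb hε hn)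
        (g.sensitivity_nonneg n)).trans (hsens.trans ?_)
      linarith
    have hclose := SymmEst.sketchAnswer_decode_le hn hq hq1 p hp g hg hβ
    refine ⟨⟨SymmEst.sketchStream p (PMF.uniformOfFintype (SymmEst.HashPair k n)) SymmEst.cellA
      SymmEst.cellB fun _ => SymmEst.decode g q p,
      fun t => (SymmEst.sketchStream_isPanPrivate p hp _ _ _ _ t).mono hqε,
      SymmEst.estimates_of_isAccurate hacc fun S => ?_⟩, ?_⟩
    · rw [SymmEst.sketchStream_run]
      exact hclose S
    · obtain ⟨P, hP, hrun⟩ := SymmEst.exists_sketch_shuffle hδ p hp hn0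
        (PMF.uniformOfFintype (SymmEst.HashPair k n)) SymmEst.cellA SymmEst.cellB
        fun _ => SymmEst.decode g q p
      exact ⟨P, fun w => (hP w).mono hqε,
        SymmEst.estimates_of_isAccurate hacc fun S => by rw [hrun]; exact hclose S⟩
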